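/- Let $\mu$ be a Borel probability measure on $\mathbb{R}^d$ with finite second moment and a density, i.e. $\mu\in\mathcal P_2(\mathbb R^d)$ and $\mu\ll$ Lebesgue measure. Notation. * $C_X$ is the set of maps $X:\mathbb{R}^d\times[0,1]\to\mathbb{R}^d$ in $H^1(0,1;L^2(\mu))$ that start from the identity: $X$ and $\partial_tX$ are in $L^2(\mu\otimes[0,1])$, and for $\mu$-a.e. $x$ the trajectory $X(x,\cdot)$ is in $AC^2(0,1;\mathbb R^d)$ and $X(x,0)=x$. We write $X_t=X(\cdot,t)$. * $C_\rho=AC^2(0,1;(\mathcal P_2(\mathbb R^d),W_2))$ is the set of curves $\rho:[0,1]\to\mathcal P_2(\mathbb{R}^d)$ for which there is $m\in L^2(0,1)$ with $W_2(\rho_s,\rho_t)\le\int_s^t m(r)\,dr$ for all $0\le s\le t\le 1$. * $C_v$ is the set of vector fields $v:\mathbb{R}^d\times[0,1]\to\mathbb{R}^d$ that on every compact set $B\subset\mathbb{R}^d$ are bounded and Lipschitz continuous in $x$, with constants depending on $B$ but not on $t\in[0,1]$. * $C_{(X,v)}$ is the set of pairs $(X,v)$ with $X\in C_X$ and $\partial_tX(x,t)=v(X(x,t),t)$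 for $\mu$-a.e. $x$ and a.e. $t\in[0,1]$. * For couplings $F,G:\mathcal P_2(\mathbb{R}^d)\times\mathbb{R}^d\to\mathbb{R}$, a map $X\in C_X$ and a reference curve $\rho\in C_\rho$ such that $(x,t)\mapsto F[\rho_t](x)$ and $G[\rho_1]$ are Borel, $$\mathcal J(X;\rho)=\mathbb{E}_{x\sim\mu}\Big[\int_0^1\Big(\tfrac12\|\partial_tX(x,t)\|^2+F[\rho_t](X(x,t))\Big)dt+G[\rho_1](X(x,1))\Big]\in[-\infty,\infty].$$ Here the running cost and the terminal cost are each integrated as (integral of the positive part) minus (integral of the negative part), and $\infty-\infty$ is read as $-\infty$. Lemma. Let $X^{(\ell+1/2)}\in C_X$ and set $\rho^{(\ell+1)}_t:=(X^{(\ell+1/2)}_t)_\#\mu$ for $t\in[0,1]$. Then: 1. $\rho^{(\ell+1)}\in C_\rho$. 2. The flow-matching regression $$\min_v\int_0^1\int\big\|v(X^{(\ell+1/2)}(x,t),t)-\partial_tX^{(\ell+1/2)}(x,t)\big\|^2\,d\mu(x)\,dt$$ over all Borel vector fields $v$ has a solution $v^{(\ell+1)}$. It is unique in the sense that any two solutions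 $v,w$ satisfy $v_t=w_t$ $\rho^{(\ell+1)}_t$-a.e. for a.e. $t\in[0,1]$. 3. If a solution $v^{(\ell+1)}$ is in $C_v$, then there exists $X^{(\ell+1)}\in C_X$ with $(X^{(\ell+1)},v^{(\ell+1)})\in C_{(X,v)}$. For all such $X^{(\ell+1)}$, all couplings $F,G$, and every reference curve $\rho\in C_\rho$ as above, $$\mathcal J(X^{(\ell+1)};\rho)\le\mathcal J(X^{(\ell+1/2)};\rho).$$ -/

import Mathlib

open MeasureTheory Set
open scoped ENNReal

noncomputable section

namespace MFG

/-- The state space `ℝ^d` with its Euclidean norm. -/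
abbrev Sp (d : ℕ) : Type := EuclideanSpace ℝ (Fin d)

/-- Lebesgue measure on the time interval `[0,1]`. -/
abbrev time : Measure ℝ := volume.restrict (Icc (0 : ℝ) 1)

/-- `P₂(ℝ^d)`: Borel probability measures with finite second moment. -/
def MemP2 {d : ℕ} (m : Measure (Sp d)) : Prop :=
  IsProbabilityMeasure m ∧ ∫⁻ x, ‖x‖ₑ ^ 2 ∂m < ⊤

/-- `π` is a coupling of `m₁` and `m₂`. -/
def IsCoupling {d : ℕ} (m₁ m₂ : Measure (Sp d)) (π : Measure (Sp d × Sp d)) : Prop :=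
  π.map Prod.fst = m₁ ∧ π.map Prod.snd = m₂

/-- The Wasserstein distance
`W₂(m₁, m₂) = (inf_π ∫ ‖y - z‖² dπ(y,z))^{1/2}`, the infimum being over all couplings. -/
def W2 {d : ℕ} (m₁ m₂ : Measure (Sp d)) : ℝ≥0∞ :=
  (⨅ (π : Measure (Sp d × Sp d)) (_ : IsCoupling m₁ m₂ π),
    ∫⁻ p, edist p.1 p.2 ^ 2 ∂π) ^ (1 / 2 : ℝ)

/-- `l ∈ AC²(0,1)` with respect to the distance `δ`: there is `m ∈ L²(0,1)` such that
`δ(l(s), l(t)) ≤ ∫_s^t m(r) dr` for `0 ≤ s ≤ t ≤ 1`. (Curves are taken on the closed interval,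
so that the end points are the continuous extensions.) -/
def IsAC2 {α : Type*} (δ : α → α → ℝ≥0∞) (l : ℝ → α) : Prop :=
  ∃ m : ℝ → ℝ, MemLp m 2 time ∧
    ∀ s t : ℝ, 0 ≤ s → s ≤ t → t ≤ 1 → δ (l s) (l t) ≤ ENNReal.ofReal (∫ r in s..t, m r)

/-- `C_ρ = AC²(0,1; (P₂(ℝ^d), W₂))`. Only the values of `ρ` on `[0,1]` matter. -/
def MemCrho {d : ℕ} (ρ : ℝ → Measure (Sp d)) : Prop :=
  (∀ t ∈ Icc (0 : ℝ) 1, MemP2 (ρ t)) ∧ IsAC2 W2 ρ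

/-- The time derivative `∂ₜX(x,t)`. For `X ∈ C_X` it exists for `μ`-a.e. `x` and a.e. `t`. -/
def dt {d : ℕ} (X : Sp d → ℝ → Sp d) (x : Sp d) (t : ℝ) : Sp d :=
  deriv (X x) t

/-- `C_X = H¹(0,1; L²(μ))`, with trajectories starting from their label: `X` and `∂ₜX` belong to
`L²(μ ⊗ [0,1])`, and for `μ`-a.e. `x` the trajectory `X(x,·)` is in `AC²(0,1; ℝ^d)` and
`X(x,0) = x`. Only the values of `X` for `t ∈ [0,1]` matter. -/
structure MemCX {d : ℕ} (μ : Measure (Sp d)) (X : Sp d → ℝ → Sp d) : Prop where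
  memLp : MemLp (fun p : Sp d × ℝ => X p.1 p.2) 2 (μ.prod time)
  ac : ∀ᵐ x ∂μ, IsAC2 edist (X x)
  memLp_dt : MemLp (fun p : Sp d × ℝ => dt X p.1 p.2) 2 (μ.prod time)
  start : ∀ᵐ x ∂μ, X x 0 = x

/-- `(X, v) ∈ C_{(X,v)}`: `X ∈ C_X` and `∂ₜX(x,t) = v(X(x,t),t)` for `μ`-a.e. `x` and a.e. `t`. -/
def MemCXv {d : ℕ} (μ : Measure (Sp d)) (X v : Sp d → ℝ → Sp d) : Prop :=
  MemCX μ X ∧ ∀ᵐ x ∂μ, ∀ᵐ t ∂time, dt X x t = v (X x t) t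

/-- `v ∈ C_v`: on every compact set `B ⊂ ℝ^d`, the field `v(·,t)` is bounded and Lipschitz in the
space variable, with constants that do not depend on `t ∈ [0,1]`. -/
def MemCv {d : ℕ} (v : Sp d → ℝ → Sp d) : Prop :=
  ∀ B : Set (Sp d), IsCompact B → ∃ C L : ℝ, ∀ t ∈ Icc (0 : ℝ) 1,
    (∀ x ∈ B, ‖v x t‖ ≤ C) ∧ ∀ x ∈ B, ∀ y ∈ B, ‖v x t - v y t‖ ≤ L * ‖x - y‖

/-- The flow-matching loss `∫₀¹ ∫ ‖v(X(x,t),t) - ∂ₜX(x,t)‖² dμ(x) dt ∈ [0,∞]`. -/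
def fmLoss {d : ℕ} (μ : Measure (Sp d)) (X v : Sp d → ℝ → Sp d) : ℝ≥0∞ :=
  ∫⁻ t, ∫⁻ x, ‖v (X x t) t - dt X x t‖ₑ ^ 2 ∂μ ∂time

/-- `v` solves the flow-matching regression for `X`: it is a Borel vector field that minimizes the
loss over all Borel vector fields. -/
def IsFlowMatching {d : ℕ} (μ : Measure (Sp d)) (X v : Sp d → ℝ → Sp d) : Prop :=
  Measurable (Function.uncurry v) ∧
    ∀ w : Sp d → ℝ → Sp d, Measurable (Function.uncurry w) → fmLoss μ X v ≤ fmLoss μ X w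

/-- The extended integral `∫ f⁺ dm - ∫ f⁻ dm ∈ [-∞,∞]`, with `∞ - ∞ = -∞`. -/
def extIntegral {α : Type*} [MeasurableSpace α] (m : Measure α) (f : α → ℝ) : EReal :=
  ((∫⁻ a, ENNReal.ofReal (f a) ∂m : ℝ≥0∞) : EReal) -
    ((∫⁻ a, ENNReal.ofReal (-f a) ∂m : ℝ≥0∞) : EReal)

/-- The individual cost
`J(X;ρ) = E_{x∼μ}[∫₀¹ (½‖∂ₜX(x,t)‖² + F[ρₜ](X(x,t))) dt + G[ρ₁](X(x,1))] ∈ [-∞,∞]`.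
Only the values of `F` and `G` at measures in `P₂(ℝ^d)` matter when `ρ ∈ C_ρ`. -/
def cost {d : ℕ} (μ : Measure (Sp d)) (F G : Measure (Sp d) → Sp d → ℝ)
    (X : Sp d → ℝ → Sp d) (ρ : ℝ → Measure (Sp d)) : EReal :=
  extIntegral (μ.prod time)
      (fun p => 1 / 2 * ‖dt X p.1 p.2‖ ^ 2 + F (ρ p.2) (X p.1 p.2)) +
    extIntegral μ (fun x => G (ρ 1) (X x 1))

end MFG

end

/-!
The regression is an orthogonal projection in `L²(μ ⊗ [0,1])` onto the closed subspace of the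
functions of `(X(x,t), t)`. So a solution `v` exists, it is unique up to null sets, and it is the
mean velocity of the trajectories: `∂ₜX - v(X, ·)` is orthogonal to every square-integrable
function of `(X, ·)` (`IsVelocity.hasMeanVelocity`). In particular `∫ ‖v(X)‖² ≤ ∫ ‖∂ₜX‖²`. That the
laws `ρ_t` form a curve in `AC²` follows from Minkowski's integral inequality, the trajectories
themselves providing the couplings (`IsVelocity.memCrho`).

The main point is that, for `v ∈ C_v`, almost every characteristic of `v` exists up to time `1`,
and that the characteristics have the same laws `ρ_t` as the trajectories `X` they replace. The
coupling terms `F` and `G` depend on the laws alone, hence do not change, and the kinetic energy of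
the characteristics is `½ ∫ ‖v(X)‖²`, at most that of `X`. No uniqueness theorem for weak solutions
of the continuity equation is needed; instead the trajectories are compared with the flows of the
truncations `v_n` of `v` outside the ball of radius `2n`, which are bounded and Lipschitz in space.

* Let `ψ` be bounded and Lipschitz, `T ∈ [0,1]`, and let `U_t(y) = ψ(flow of v_n from (t,y) to time
  T)` be its backward transport. Along a trajectory, `θ_n(X_t) U_t(X_t)`, where the cutoff `θ_n` is
  supported where `v_n = v`, should have a derivative with small mean: the contributions of `∂ₜX`
  and `v` cancel on average as `v` is the mean velocity, and what remains is the flux of `v` where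
  `θ_n` is not constant, of size `C/n`. Since `U_t` is only Lipschitz, it is mollified at scale
  `ε`; this costs an error of order `ε` per unit of time, since `v_n` is Lipschitz
  (`IsMollifier.abs_mollify_flow_sub_le`). The mollified function has a Lipschitz gradient, so that
  the change over a time step is controlled to second order
  (`HasMeanVelocity.abs_integral_step_le`). Summing over a partition, and letting the mesh, then
  `ε`, then `1/n` tend to `0`, one finds that the laws of the flows of `v_n` converge weakly to
  `ρ_T` (`HasMeanVelocity.tendsto_integral_flow`).
* A characteristic that starts in the ball of radius `a` and leaves the ball of radius `2q` has to
  travel the distance `2q - a` inside the latter. By the weak convergence, the mean distance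
  travelled there is at most `∫ ‖v(X)‖`, so that the probability of leaving is at most `C/(2q - a)`
  (`HasMeanVelocity.sub_mul_measureReal_le`). Hence almost every characteristic is eventually equal
  to the flows of the truncations, and its law at time `t` is the weak limit `ρ_t`
  (`IsCharacteristic.map_eq`).
-/

noncomputable section

namespace MFG

set_option linter.unusedSectionVars false

open Filter Topology
open scoped RealInnerProductSpace BoundedContinuousFunction

section Euclidean

variable {E : Type*} [NormedAddCommGroup E] [InnerProductSpace ℝ E] [FiniteDimensional ℝ E]
  [MeasurableSpace E] [BorelSpace E]

/-! ### Flows of bounded Lipschitz vector fields that are only measurable in time -/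

/-- A Borel time-dependent vector field, bounded by `M` and globally `L`-Lipschitz in space. No
regularity in time is required. -/
structure IsLipField (w : E → ℝ → E) (M L : ℝ) : Prop where
  meas : Measurable (Function.uncurry w)
  bound : ∀ x t, ‖w x t‖ ≤ M
  lip : ∀ x y t, ‖w x t - w y t‖ ≤ L * ‖x - y‖
  L_nonneg : 0 ≤ L

lemma IsLipField.M_nonneg {w : E → ℝ → E} {M L : ℝ} (hw : IsLipField w M L) : 0 ≤ M :=
  (norm_nonneg _).trans (hw.bound 0 0)

lemma IsLipField.intervalIntegrable {w : E → ℝ → E} {M L : ℝ} (hw : IsLipField w M L)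
    {γ : ℝ → E} (hγ : Measurable γ) (a b : ℝ) :
    IntervalIntegrable (fun r => w (γ r) r) volume a b := by
  have hm : Measurable fun r => w (γ r) r := hw.meas.comp (hγ.prodMk measurable_id)
  refine (intervalIntegrable_const (c := M)).mono_fun hm.aestronglyMeasurable ?_
  filter_upwards with r
  rw [Real.norm_of_nonneg hw.M_nonneg]
  exact hw.bound _ _

/-- The integral form of Grönwall's inequality. -/
lemma le_mul_exp_of_le_add_integral {f : ℝ → ℝ} (hf : Continuous f) {a L s T : ℝ} (hL : 0 ≤ L)
    (h : ∀ t ∈ Icc s T, f t ≤ a + L * ∫ r in s..t, f r) :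
    ∀ t ∈ Icc s T, f t ≤ a * Real.exp (L * (t - s)) := by
  intro t ht
  have hd : ∀ t, HasDerivAt (fun t => a + L * ∫ r in s..t, f r) (L * f t) t := fun t =>
    ((intervalIntegral.integral_hasDerivAt_right (hf.intervalIntegrable _ _)
      hf.stronglyMeasurable.stronglyMeasurableAtFilter hf.continuousAt).const_mul L).const_add a
  have := le_gronwallBound_of_liminf_deriv_right_le
    (f := fun t => a + L * ∫ r in s..t, f r) (f' := fun t => L * f t) (δ := a) (K := L) (ε := 0)
    (a := s) (b := T) (fun t _ => (hd t).continuousAt.continuousWithinAt)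
    (fun x _ r hr => by
      have := (hd x).hasDerivWithinAt.liminf_right_slope_le hr
      simpa [slope] using this)
    (by simp) (fun x hx => by
      have := h x ⟨hx.1, hx.2.le⟩
      simpa using mul_le_mul_of_nonneg_left this hL) t ht
  rw [gronwallBound_ε0] at this
  exact (h t ht).trans this

/-- Two solutions of the same Lipschitz equation separate at most exponentially. -/
lemma IsLipField.dist_solution_le {w : E → ℝ → E} {M L : ℝ} (hw : IsLipField w M L)
    {γ₁ γ₂ : ℝ → E} (h₁ : Continuous γ₁) (h₂ : Continuous γ₂) {x₁ x₂ : E} {s T : ℝ}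
    (e₁ : ∀ t ∈ Icc s T, γ₁ t = x₁ + ∫ r in s..t, w (γ₁ r) r)
    (e₂ : ∀ t ∈ Icc s T, γ₂ t = x₂ + ∫ r in s..t, w (γ₂ r) r) :
    ∀ t ∈ Icc s T, ‖γ₁ t - γ₂ t‖ ≤ ‖x₁ - x₂‖ * Real.exp (L * (t - s)) := by
  refine le_mul_exp_of_le_add_integral (h₁.sub h₂).norm hw.L_nonneg fun t ht => ?_
  have hi₁ := hw.intervalIntegrable h₁.measurable s t
  have hi₂ := hw.intervalIntegrable h₂.measurable s t
  simp only [Pi.sub_apply]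
  rw [e₁ t ht, e₂ t ht, add_sub_add_comm, ← intervalIntegral.integral_sub hi₁ hi₂]
  refine (norm_add_le _ _).trans (add_le_add_right ?_ _)
  rw [← intervalIntegral.integral_const_mul]
  refine intervalIntegral.norm_integral_le_of_norm_le ht.1 ?_
    (((h₁.sub h₂).norm.const_mul L).intervalIntegrable _ _)
  filter_upwards with r _ using hw.lip _ _ _

lemma IsLipField.solution_unique {w : E → ℝ → E} {M L : ℝ} (hw : IsLipField w M L)
    {γ₁ γ₂ : ℝ → E} (h₁ : Continuous γ₁) (h₂ : Continuous γ₂) {x : E} {s T : ℝ}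
    (e₁ : ∀ t ∈ Icc s T, γ₁ t = x + ∫ r in s..t, w (γ₁ r) r)
    (e₂ : ∀ t ∈ Icc s T, γ₂ t = x + ∫ r in s..t, w (γ₂ r) r) :
    ∀ t ∈ Icc s T, γ₁ t = γ₂ t := fun t ht => by
  have := hw.dist_solution_le h₁ h₂ e₁ e₂ t ht
  rw [sub_self, norm_zero, zero_mul] at this
  exact sub_eq_zero.1 (norm_le_zero_iff.1 this)

/-- Global existence of solutions in the sense of Carathéodory. The integral operator is a
contraction for the weighted supremum norm with weight `exp (-(2L+1)(t-s))`. Solutions are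
continued by their initial value to times before `s`. -/
lemma IsLipField.exists_solution {w : E → ℝ → E} {M L : ℝ} (hw : IsLipField w M L) (s : ℝ)
    (x : E) : ∃ γ : ℝ → E, Continuous γ ∧ (∀ t ≤ s, γ t = x) ∧
      ∀ t, s ≤ t → γ t = x + ∫ r in s..t, w (γ r) r := by
  have hL := hw.L_nonneg
  have hM := hw.M_nonneg
  set lam : ℝ := 2 * L + 1 with hlam
  have hlam1 : 1 ≤ lam := by linarith
  let g : (ℝ →ᵇ E) → ℝ → E := fun β r => Real.exp (lam * (r - s)) • β r
  have hg : ∀ β, Continuous (g β) := fun β => by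
    have := β.continuous
    fun_prop
  have hi : ∀ β a b, IntervalIntegrable (fun r => w (g β r) r) volume a b := fun β =>
    hw.intervalIntegrable (hg β).measurable
  let P : (ℝ →ᵇ E) → ℝ → E := fun β t =>
    Real.exp (-(lam * (max t s - s))) • (x + ∫ r in s..max t s, w (g β r) r)
  have hPc : ∀ β, Continuous (P β) := fun β => by
    have h1 : Continuous fun t : ℝ => max t s := by fun_prop
    have h2 := (intervalIntegral.continuous_primitive (hi β) s).comp h1
    exact Continuous.smul (by fun_prop) (continuous_const.add h2)
  have hPb : ∀ β t, ‖P β t‖ ≤ ‖x‖ + M := fun β t => by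
    have hu : 0 ≤ max t s - s := by simp
    rw [norm_smul, Real.norm_of_nonneg (Real.exp_nonneg _)]
    have h1 : ‖∫ r in s..max t s, w (g β r) r‖ ≤ M * (max t s - s) := by
      have := intervalIntegral.norm_integral_le_of_norm_le_const (a := s) (b := max t s)
        (f := fun r => w (g β r) r) (C := M) (fun r _ => hw.bound _ _)
      rwa [abs_of_nonneg hu] at this
    have h2 : Real.exp (-(lam * (max t s - s))) ≤ 1 := by
      rw [Real.exp_le_one_iff]; nlinarith
    have h3 : Real.exp (-(lam * (max t s - s))) * (max t s - s) ≤ 1 := by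
      rw [Real.exp_neg, inv_mul_le_one₀ (Real.exp_pos _)]
      have := Real.add_one_le_exp (lam * (max t s - s))
      nlinarith
    have h4 := Real.exp_nonneg (-(lam * (max t s - s)))
    calc _ ≤ Real.exp (-(lam * (max t s - s))) * (‖x‖ + M * (max t s - s)) := by
          gcongr
          exact (norm_add_le _ _).trans (by gcongr)
      _ ≤ ‖x‖ + M := by nlinarith [norm_nonneg x]
  let Q : (ℝ →ᵇ E) → (ℝ →ᵇ E) := fun β =>
    BoundedContinuousFunction.ofNormedAddCommGroup (P β) (hPc β) (‖x‖ + M) (hPb β)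
  have hQ : ContractingWith (1 / 2 : NNReal) Q := by
    refine ⟨by norm_num, LipschitzWith.of_dist_le_mul fun β₁ β₂ => ?_⟩
    rw [BoundedContinuousFunction.dist_le (by positivity)]
    intro t
    change dist (P β₁ t) (P β₂ t) ≤ _
    have hu : s ≤ max t s := le_max_right _ _
    set τ := max t s
    have hD := dist_nonneg (x := β₁) (y := β₂)
    have hpos := Real.exp_pos (lam * (τ - s))
    have hint : ∫ r in s..τ, L * Real.exp (lam * (r - s)) * dist β₁ β₂
        ≤ 1 / 2 * Real.exp (lam * (τ - s)) * dist β₁ β₂ := by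
      have h1 : ∀ r ∈ uIcc s τ, HasDerivAt
          (fun r => L / lam * Real.exp (lam * (r - s)) * dist β₁ β₂)
          (L * Real.exp (lam * (r - s)) * dist β₁ β₂) r := fun r _ => by
        have h2 : HasDerivAt (fun r => lam * (r - s)) (lam * 1) r :=
          ((hasDerivAt_id r).sub_const s).const_mul lam
        convert! (h2.exp.const_mul (L / lam)).mul_const (dist β₁ β₂) using 1
        field_simp
      rw [intervalIntegral.integral_eq_sub_of_hasDerivAt h1
        (Continuous.intervalIntegrable (by fun_prop) _ _)]
      have h3 : L / lam ≤ 1 / 2 := by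
        rw [div_le_div_iff₀ (by linarith) (by norm_num)]; linarith
      have h4 : 0 ≤ L / lam * Real.exp (lam * (s - s)) * dist β₁ β₂ := by positivity
      have h5 : L / lam * Real.exp (lam * (τ - s)) * dist β₁ β₂ ≤
        1 / 2 * Real.exp (lam * (τ - s)) * dist β₁ β₂ := by gcongr
      linarith
    rw [dist_eq_norm, ← smul_sub, norm_smul, Real.norm_of_nonneg (Real.exp_nonneg _),
      add_sub_add_left_eq_sub, ← intervalIntegral.integral_sub (hi _ _ _) (hi _ _ _),
      Real.exp_neg, inv_mul_le_iff₀ hpos]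
    refine (intervalIntegral.norm_integral_le_of_norm_le hu ?_
      (Continuous.intervalIntegrable (by fun_prop) _ _)).trans (hint.trans (le_of_eq ?_))
    · filter_upwards with r _
      refine (hw.lip _ _ _).trans ?_
      rw [mul_assoc]
      gcongr
      simp only [g]
      rw [← smul_sub, norm_smul, Real.norm_of_nonneg (Real.exp_nonneg _), ← dist_eq_norm]
      gcongr
      exact BoundedContinuousFunction.dist_coe_le_dist r
    · push_cast; ring
  obtain ⟨β, hβ, -⟩ := hQ.exists_fixedPoint 0 (edist_ne_top _ _)
  have hβt : ∀ t, β t = P β t := fun t => by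
    conv_lhs => rw [← hβ.eq]
    rfl
  refine ⟨fun t => Real.exp (lam * (max t s - s)) • β t, ?_, fun t ht => ?_, fun t ht => ?_⟩
  · have := β.continuous
    fun_prop
  · simp [hβt, P, max_eq_right ht]
  · have h1 : ∫ r in s..t, w (Real.exp (lam * (max r s - s)) • β r) r =
        ∫ r in s..t, w (g β r) r := by
      refine intervalIntegral.integral_congr fun r hr => ?_
      rw [uIcc_of_le ht] at hr
      simp only [g, max_eq_left hr.1]
    beta_reduce
    rw [h1, hβt]
    simp only [P, max_eq_left ht]
    rw [smul_smul, ← Real.exp_add, add_neg_cancel, Real.exp_zero, one_smul]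

open Classical in
/-- The flow of `w`: `flow w s x t` is the position at time `t ≥ s` of the solution of
`γ' = w(γ, ·)` that is at `x` at time `s`. For `t ≤ s` it is `x`. -/
def flow (w : E → ℝ → E) (s : ℝ) (x : E) : ℝ → E :=
  if h : ∃ γ : ℝ → E, Continuous γ ∧ (∀ t ≤ s, γ t = x) ∧
      ∀ t, s ≤ t → γ t = x + ∫ r in s..t, w (γ r) r then h.choose else fun _ => x

section Flow

variable {w : E → ℝ → E} {M L : ℝ}

lemma flow_spec (hw : IsLipField w M L) (s : ℝ) (x : E) :
    Continuous (flow w s x) ∧ (∀ t ≤ s, flow w s x t = x) ∧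
      ∀ t, s ≤ t → flow w s x t = x + ∫ r in s..t, w (flow w s x r) r := by
  have h := hw.exists_solution s x
  rw [flow, dif_pos h]
  exact h.choose_spec

lemma continuous_flow (hw : IsLipField w M L) (s : ℝ) (x : E) : Continuous (flow w s x) :=
  (flow_spec hw s x).1

lemma flow_of_le (hw : IsLipField w M L) {s t : ℝ} (x : E) (h : t ≤ s) : flow w s x t = x :=
  (flow_spec hw s x).2.1 t h

lemma flow_eq (hw : IsLipField w M L) {s t : ℝ} (x : E) (h : s ≤ t) :
    flow w s x t = x + ∫ r in s..t, w (flow w s x r) r :=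
  (flow_spec hw s x).2.2 t h

lemma flow_lipschitz (hw : IsLipField w M L) {s t : ℝ} (h : s ≤ t) (x y : E) :
    ‖flow w s x t - flow w s y t‖ ≤ ‖x - y‖ * Real.exp (L * (t - s)) :=
  hw.dist_solution_le (T := t) (continuous_flow hw s x) (continuous_flow hw s y)
    (fun _ ht => flow_eq hw x ht.1) (fun _ ht => flow_eq hw y ht.1) t ⟨h, le_rfl⟩

lemma flow_unique (hw : IsLipField w M L) {γ : ℝ → E} (hγ : Continuous γ) {x : E} {s T : ℝ}
    (e : ∀ t ∈ Icc s T, γ t = x + ∫ r in s..t, w (γ r) r) :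
    ∀ t ∈ Icc s T, flow w s x t = γ t :=
  hw.solution_unique (continuous_flow hw s x) hγ (fun _ ht => flow_eq hw x ht.1) e

lemma flow_sub (hw : IsLipField w M L) {s t t' : ℝ} (x : E) (h : s ≤ t) (h' : s ≤ t') :
    flow w s x t' = flow w s x t + ∫ r in t..t', w (flow w s x r) r := by
  rw [flow_eq hw x h, flow_eq hw x h', add_assoc, intervalIntegral.integral_add_adjacent_intervals]
  all_goals exact hw.intervalIntegrable (continuous_flow hw s x).measurable _ _

lemma norm_flow_sub_le (hw : IsLipField w M L) {s t t' : ℝ} (x : E) (h : s ≤ t) (h' : s ≤ t') :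
    ‖flow w s x t' - flow w s x t‖ ≤ M * |t' - t| := by
  rw [flow_sub hw x h h', add_sub_cancel_left]
  exact intervalIntegral.norm_integral_le_of_norm_le_const (fun r _ => hw.bound _ _)

lemma flow_flow (hw : IsLipField w M L) {s t T : ℝ} (x : E) (hst : s ≤ t) (htT : t ≤ T) :
    flow w t (flow w s x t) T = flow w s x T :=
  flow_unique hw (continuous_flow hw s x)
    (fun _ hr => flow_sub hw x hst (hst.trans hr.1)) T ⟨htT, le_rfl⟩

lemma continuous_uncurry_flow (hw : IsLipField w M L) (s : ℝ) :
    Continuous fun p : E × ℝ => flow w s p.1 p.2 := by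
  rw [continuous_iff_continuousAt]
  rintro ⟨x, t⟩
  rw [ContinuousAt, tendsto_iff_norm_sub_tendsto_zero]
  -- at frozen time the flow is Lipschitz in the label, with a locally bounded constant
  have key : ∀ p : E × ℝ, ‖flow w s p.1 p.2 - flow w s x t‖ ≤
      ‖p.1 - x‖ * Real.exp (L * (max p.2 s - s)) + ‖flow w s x p.2 - flow w s x t‖ := by
    rintro ⟨y, r⟩
    refine (norm_sub_le_norm_sub_add_norm_sub _ (flow w s x r) _).trans (add_le_add_left ?_ _)
    rcases le_total s r with h | h
    · simpa [max_eq_left h] using flow_lipschitz hw h y x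
    · simp [flow_of_le hw _ h, max_eq_right h]
  refine squeeze_zero (fun _ => norm_nonneg _) key ?_
  have h1 : Continuous fun p : E × ℝ => ‖p.1 - x‖ * Real.exp (L * (max p.2 s - s)) +
      ‖flow w s x p.2 - flow w s x t‖ := by
    have := continuous_flow hw s x
    fun_prop
  simpa using h1.tendsto (x, t)

lemma ae_hasDerivAt_flow (hw : IsLipField w M L) (s T : ℝ) (x : E) :
    ∀ᵐ t ∂volume.restrict (Icc s T), HasDerivAt (flow w s x) (w (flow w s x t) t) t := by
  rcases lt_or_ge T s with h | h
  · simp [Icc_eq_empty_of_lt h]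
  rw [ae_restrict_iff' measurableSet_Icc]
  have h1 := (hw.intervalIntegrable (continuous_flow hw s x).measurable s
    (T + 1)).ae_hasDerivAt_integral
  have h2 : ∀ᵐ t : ℝ, t ≠ s := by simp [ae_iff, measure_singleton]
  filter_upwards [h1, h2] with t ht hts htI
  have h3 : s < t := lt_of_le_of_ne htI.1 hts.symm
  rw [uIcc_of_le (by linarith)] at ht
  have h4 := ht ⟨htI.1, by linarith [htI.2]⟩ s ⟨le_rfl, by linarith⟩
  refine (h4.const_add x).congr_of_eventuallyEq ?_
  filter_upwards [lt_mem_nhds h3] with r hr using flow_eq hw x hr.le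

end Flow

/-! ### Test functions with Lipschitz gradient -/

/-- `φ` is a bounded `C^{1,1}` function with gradient field `G`, all bounds being quantified by `K`.
The gradient enters only through the second-order Taylor estimate, a condition that passes to
averages of translates of `φ`. -/
structure IsC11 (φ : E → ℝ) (G : E → E) (K : ℝ) : Prop where
  bound : ∀ x, |φ x| ≤ K
  lip : ∀ x y, |φ x - φ y| ≤ K * ‖x - y‖
  bound_grad : ∀ x, ‖G x‖ ≤ K
  lip_grad : ∀ x y, ‖G x - G y‖ ≤ K * ‖x - y‖
  taylor : ∀ x y, |φ y - φ x - ⟪G x, y - x⟫| ≤ K * ‖y - x‖ ^ 2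

section C11

variable {φ θ : E → ℝ} {G H : E → E} {K K' : ℝ}

lemma IsC11.nonneg (h : IsC11 φ G K) : 0 ≤ K := (abs_nonneg _).trans (h.bound 0)

lemma IsC11.continuous_grad (h : IsC11 φ G K) : Continuous G := by
  refine (LipschitzWith.of_dist_le_mul (K := K.toNNReal) fun x y => ?_).continuous
  rw [dist_eq_norm, dist_eq_norm, Real.coe_toNNReal _ h.nonneg]
  exact h.lip_grad x y

lemma IsC11.continuous (h : IsC11 φ G K) : Continuous φ := by
  refine (LipschitzWith.of_dist_le_mul (K := K.toNNReal) fun x y => ?_).continuous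
  rw [Real.dist_eq, dist_eq_norm, Real.coe_toNNReal _ h.nonneg]
  exact h.lip x y

lemma IsC11.mul (hθ : IsC11 θ H K) (hφ : IsC11 φ G K') :
    IsC11 (fun x => θ x * φ x) (fun x => θ x • G x + φ x • H x) (4 * K * K') := by
  have hK := hθ.nonneg
  have hK' := hφ.nonneg
  have hKK := mul_nonneg hK hK'
  have e1 : ∀ x, ‖θ x • G x‖ ≤ K * K' := fun x => by
    rw [norm_smul, Real.norm_eq_abs]
    exact mul_le_mul (hθ.bound x) (hφ.bound_grad x) (norm_nonneg _) hK
  have e2 : ∀ x, ‖φ x • H x‖ ≤ K * K' := fun x => by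
    rw [norm_smul, Real.norm_eq_abs, mul_comm K]
    exact mul_le_mul (hφ.bound x) (hθ.bound_grad x) (norm_nonneg _) hK'
  refine ⟨fun x => ?_, fun x y => ?_, fun x => ?_, fun x y => ?_, fun x y => ?_⟩
  · rw [abs_mul]
    have := mul_le_mul (hθ.bound x) (hφ.bound x) (abs_nonneg _) hK
    linarith
  · have : θ x * φ x - θ y * φ y = θ x * (φ x - φ y) + φ y * (θ x - θ y) := by ring
    rw [this]
    refine (abs_add_le _ _).trans ?_
    rw [abs_mul, abs_mul]
    have a1 := mul_le_mul (hθ.bound x) (hφ.lip x y) (abs_nonneg _) hK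
    have a2 := mul_le_mul (hφ.bound y) (hθ.lip x y) (abs_nonneg _) hK'
    nlinarith [norm_nonneg (x - y), mul_nonneg hKK (norm_nonneg (x - y))]
  · exact (norm_add_le _ _).trans (by linarith [e1 x, e2 x])
  · have : θ x • G x + φ x • H x - (θ y • G y + φ y • H y) =
        (θ x • (G x - G y) + (θ x - θ y) • G y) + (φ x • (H x - H y) + (φ x - φ y) • H y) := by
      module
    rw [this]
    have a1 := mul_le_mul (hθ.bound x) (hφ.lip_grad x y) (norm_nonneg _) hK
    have a2 := mul_le_mul (hθ.lip x y) (hφ.bound_grad y) (norm_nonneg _) (by positivity)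
    have a3 := mul_le_mul (hφ.bound x) (hθ.lip_grad x y) (norm_nonneg _) hK'
    have a4 := mul_le_mul (hφ.lip x y) (hθ.bound_grad y) (norm_nonneg _) (by positivity)
    refine (norm_add_le _ _).trans ((add_le_add (norm_add_le _ _) (norm_add_le _ _)).trans ?_)
    rw [norm_smul, norm_smul, norm_smul, norm_smul, Real.norm_eq_abs, Real.norm_eq_abs,
      Real.norm_eq_abs, Real.norm_eq_abs]
    nlinarith
  · have : θ y * φ y - θ x * φ x - ⟪θ x • G x + φ x • H x, y - x⟫ =
        θ x * (φ y - φ x - ⟪G x, y - x⟫) + φ x * (θ y - θ x - ⟪H x, y - x⟫) +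
          (θ y - θ x) * (φ y - φ x) := by
      rw [inner_add_left, real_inner_smul_left, real_inner_smul_left]; ring
    rw [this]
    refine (abs_add_le _ _).trans ((add_le_add_left (abs_add_le _ _) _).trans ?_)
    rw [abs_mul, abs_mul, abs_mul]
    have a1 := mul_le_mul (hθ.bound x) (hφ.taylor x y) (abs_nonneg _) hK
    have a2 := mul_le_mul (hφ.bound x) (hθ.taylor x y) (abs_nonneg _) hK'
    have a3 := mul_le_mul (hθ.lip y x) (hφ.lip y x) (abs_nonneg _) (by positivity)
    nlinarith [mul_nonneg hKK (sq_nonneg ‖y - x‖)]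

/-- Dilating a test function by a factor `r ≥ 1` does not worsen its bounds. -/
lemma IsC11.dilate (h : IsC11 φ G K) {r : ℝ} (hr : 1 ≤ r) :
    IsC11 (fun x => φ (r⁻¹ • x)) (fun x => r⁻¹ • G (r⁻¹ • x)) K := by
  have hK := h.nonneg
  have h0 : 0 < r⁻¹ := by positivity
  have h1 : r⁻¹ ≤ 1 := inv_le_one_of_one_le₀ hr
  have hn : ∀ x y : E, ‖r⁻¹ • x - r⁻¹ • y‖ = r⁻¹ * ‖x - y‖ := fun x y => by
    rw [← smul_sub, norm_smul, Real.norm_of_nonneg h0.le]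
  have hs : ∀ x y : E, ‖r⁻¹ • x - r⁻¹ • y‖ ≤ ‖x - y‖ := fun x y => by
    rw [hn]; exact mul_le_of_le_one_left (norm_nonneg _) h1
  refine ⟨fun x => h.bound _, fun x y => (h.lip _ _).trans (by gcongr; exact hs x y), fun x => ?_,
    fun x y => ?_, fun x y => ?_⟩
  · rw [norm_smul, Real.norm_of_nonneg h0.le]
    exact (mul_le_of_le_one_left (norm_nonneg _) h1).trans (h.bound_grad _)
  · rw [← smul_sub, norm_smul, Real.norm_of_nonneg h0.le]
    refine (mul_le_of_le_one_left (norm_nonneg _) h1).trans ((h.lip_grad _ _).trans ?_)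
    gcongr
    exact hs x y
  · have := h.taylor (r⁻¹ • x) (r⁻¹ • y)
    rw [← smul_sub, inner_smul_right, ← real_inner_smul_left] at this
    refine this.trans ?_
    rw [smul_sub]
    gcongr
    exact hs y x

open InnerProductSpace in
/-- Compactly supported `C²` functions are test functions. -/
lemma exists_isC11_of_hasCompactSupport {f : E → ℝ} (hf : ContDiff ℝ 2 f)
    (hc : HasCompactSupport f) : ∃ K, IsC11 f (gradient f) K := by
  have hd : Differentiable ℝ f := hf.differentiable (by norm_num)
  have hfd : ContDiff ℝ 1 (fderiv ℝ f) := hf.fderiv_right (by norm_num)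
  have hcd := hc.fderiv ℝ
  obtain ⟨C₁, h₁⟩ := hc.exists_bound_of_continuous hf.continuous
  obtain ⟨C₂, h₂⟩ := hf.lipschitzWith_of_hasCompactSupport hc (by norm_num)
  obtain ⟨C₃, h₃⟩ := hcd.exists_bound_of_continuous hfd.continuous
  obtain ⟨C₄, h₄⟩ := hfd.lipschitzWith_of_hasCompactSupport hcd (by norm_num)
  have hgr : ∀ x, (toDual ℝ E) (gradient f x) = fderiv ℝ f x := fun x => by simp [gradient]
  have hng : ∀ x, ‖gradient f x‖ = ‖fderiv ℝ f x‖ := fun x => by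
    rw [← hgr, LinearIsometryEquiv.norm_map]
  have hng2 : ∀ x y, ‖gradient f x - gradient f y‖ = ‖fderiv ℝ f x - fderiv ℝ f y‖ := fun x y => by
    rw [← hgr, ← hgr, ← map_sub, LinearIsometryEquiv.norm_map]
  set K := max (max C₁ C₂) (max C₃ C₄) with hK
  have k₁ : C₁ ≤ K := (le_max_left _ _).trans (le_max_left _ _)
  have k₂ : (C₂ : ℝ) ≤ K := (le_max_right _ _).trans (le_max_left _ _)
  have k₃ : C₃ ≤ K := (le_max_left _ _).trans (le_max_right _ _)
  have k₄ : (C₄ : ℝ) ≤ K := (le_max_right _ _).trans (le_max_right _ _)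
  have hl : ∀ x y, ‖fderiv ℝ f x - fderiv ℝ f y‖ ≤ K * ‖x - y‖ := fun x y => by
    have := h₄.dist_le_mul x y
    rw [dist_eq_norm, dist_eq_norm] at this
    exact this.trans (by gcongr)
  refine ⟨K, fun x => (h₁ x).trans k₁, fun x y => ?_, fun x => ?_, fun x y => ?_, fun x y => ?_⟩
  · have := h₂.dist_le_mul x y
    rw [dist_eq_norm, dist_eq_norm] at this
    exact this.trans (by gcongr)
  · rw [hng]; exact (h₃ x).trans k₃
  · rw [hng2]; exact hl x y
  · have h5 : ⟪gradient f x, y - x⟫ = fderiv ℝ f x (y - x) := by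
      rw [← hgr, toDual_apply_apply]
    have := Convex.norm_image_sub_le_of_norm_fderiv_le' (𝕜 := ℝ) (f := f) (s := segment ℝ x y)
      (C := K * ‖y - x‖) (φ := fderiv ℝ f x) (fun z _ => hd z) (fun z hz => (hl z x).trans ?_)
      (convex_segment x y) (left_mem_segment ℝ x y) (right_mem_segment ℝ x y)
    · rw [h5, ← Real.norm_eq_abs]
      exact this.trans (le_of_eq (by ring))
    · have hK0 : 0 ≤ K := C₂.2.trans k₂
      gcongr
      obtain ⟨a, b, ha, hb, hab, rfl⟩ := hz
      have : a • x + b • y - x = b • (y - x) := by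
        rw [← eq_sub_iff_add_eq] at hab; subst hab; module
      rw [this, norm_smul, Real.norm_of_nonneg hb]
      exact mul_le_of_le_one_left (norm_nonneg _) (by linarith)

end C11

/-- A `C^{1,1}` probability kernel supported in the closed ball of radius `ε`. -/
structure IsMollifier (η : E → ℝ) (Gη : E → E) (K ε : ℝ) : Prop where
  c11 : IsC11 η Gη K
  zero : ∀ x, ε < ‖x‖ → η x = 0
  zero_grad : ∀ x, ε < ‖x‖ → Gη x = 0
  nonneg : ∀ x, 0 ≤ η x
  integral_eq : ∫ x, η x = 1

lemma exists_isMollifier {ε : ℝ} (hε : 0 < ε) :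
    ∃ (η : E → ℝ) (Gη : E → E) (K : ℝ), IsMollifier η Gη K ε := by
  let f : ContDiffBump (0 : E) := ⟨ε / 2, ε, by positivity, by linarith⟩
  obtain ⟨K, hK⟩ := exists_isC11_of_hasCompactSupport (f.contDiff_normed (μ := volume) (n := 2))
    f.hasCompactSupport_normed
  have hz : ∀ x, ε < ‖x‖ → x ∉ tsupport (f.normed volume) := fun x hx => by
    rw [f.tsupport_normed_eq]
    simpa using hx
  refine ⟨_, _, K, hK, fun x hx => image_eq_zero_of_notMem_tsupport (hz x hx), fun x hx => ?_,
    f.nonneg_normed, f.integral_normed⟩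
  have : fderiv ℝ (f.normed volume) x = 0 := by
    have h1 : x ∉ tsupport (fderiv ℝ (f.normed volume)) :=
      fun h => hz x hx (tsupport_fderiv_subset ℝ h)
    exact image_eq_zero_of_notMem_tsupport h1
  simp [gradient, this]

/-- The average of the translates of `u` with weight `η`. -/
def mollify (η : E → ℝ) (u : E → ℝ) (x : E) : ℝ := ∫ y, u y * η (x - y)

/-- The gradient field of `mollify η u`, the derivative falling on the kernel. -/
def mollifyGrad (Gη : E → E) (u : E → ℝ) (x : E) : E := ∫ y, u y • Gη (x - y)

section Mollify

variable {η : E → ℝ} {Gη : E → E} {K ε : ℝ} {u u' : E → ℝ}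

lemma IsMollifier.integrable_mul (hη : IsMollifier η Gη K ε) (hu : Continuous u) (x : E) :
    Integrable fun y => u y * η (x - y) := by
  have hc := hη.c11.continuous
  refine Continuous.integrable_of_hasCompactSupport (by fun_prop)
    (HasCompactSupport.of_support_subset_isCompact (isCompact_closedBall x ε) fun y hy => ?_)
  by_contra h
  rw [mem_closedBall_iff_norm', not_le] at h
  exact hy (by simp [hη.zero _ h])

lemma IsMollifier.integrable_smul (hη : IsMollifier η Gη K ε) (hu : Continuous u) (x : E) :
    Integrable fun y => u y • Gη (x - y) := by
  have hc := hη.c11.continuous_grad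
  refine Continuous.integrable_of_hasCompactSupport (by fun_prop)
    (HasCompactSupport.of_support_subset_isCompact (isCompact_closedBall x ε) fun y hy => ?_)
  by_contra h
  rw [mem_closedBall_iff_norm', not_le] at h
  exact hy (by simp [hη.zero_grad _ h])

lemma mollify_eq (x : E) : mollify η u x = ∫ z, u (x - z) * η z := by
  rw [mollify, ← integral_sub_left_eq_self (fun y => u y * η (x - y)) volume x]
  simp

lemma IsMollifier.integrable_shift (hη : IsMollifier η Gη K ε) (hu : Continuous u) (x : E) :
    Integrable fun z => u (x - z) * η z := by
  have := (hη.integrable_mul hu x).comp_sub_left x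
  simpa using this

lemma IsMollifier.abs_mollify_sub_le (hη : IsMollifier η Gη K ε) (hu : Continuous u)
    (hu' : Continuous u') {x x' : E} {c : ℝ}
    (h : ∀ z, ‖z‖ ≤ ε → |u (x - z) - u' (x' - z)| ≤ c) :
    |mollify η u x - mollify η u' x'| ≤ c := by
  have hηi : Integrable η := by
    have := hη.integrable_shift (u := fun _ => 1) continuous_const 0
    simpa using this
  rw [mollify_eq, mollify_eq, ← integral_sub (hη.integrable_shift hu x)
    (hη.integrable_shift hu' x'), ← Real.norm_eq_abs]
  refine (norm_integral_le_of_norm_le (hηi.const_mul c) (ae_of_all _ fun z => ?_)).trans ?_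
  · rw [← sub_mul, norm_mul, Real.norm_eq_abs, Real.norm_of_nonneg (hη.nonneg z)]
    rcases le_or_gt ‖z‖ ε with hz | hz
    · exact mul_le_mul_of_nonneg_right (h z hz) (hη.nonneg z)
    · simp [hη.zero z hz]
  · rw [integral_const_mul, hη.integral_eq, mul_one]

lemma IsMollifier.abs_mollify_sub_const_le (hη : IsMollifier η Gη K ε) (hu : Continuous u)
    {x : E} {a c : ℝ} (h : ∀ z, ‖z‖ ≤ ε → |u (x - z) - a| ≤ c) :
    |mollify η u x - a| ≤ c := by
  have h1 := hη.abs_mollify_sub_le hu (u' := fun _ => a) continuous_const (x := x) (x' := 0) h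
  have h2 : mollify η (fun _ => a) 0 = a := by
    rw [mollify_eq, integral_const_mul, hη.integral_eq, mul_one]
  rwa [h2] at h1

lemma IsMollifier.abs_mollify_le (hη : IsMollifier η Gη K ε) (hu : Continuous u)
    (hb : ∀ y, |u y| ≤ 1) (x : E) : |mollify η u x| ≤ 1 := by
  simpa using hη.abs_mollify_sub_const_le hu (a := 0) (x := x) (c := 1) fun z _ => by
    simpa using hb _

/-- A function supported in two balls of radius `ε` has a small integral. -/
lemma norm_integral_le_of_support_subset_balls {F : Type*} [NormedAddCommGroup F] [NormedSpace ℝ F]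
    {f : E → F} {x x' : E} {ε c : ℝ} (hc : 0 ≤ c) (hf : ∀ y, ‖f y‖ ≤ c)
    (h0 : ∀ y, ε < ‖x - y‖ → ε < ‖x' - y‖ → f y = 0) :
    ‖∫ y, f y‖ ≤ c * (2 * volume.real (Metric.closedBall (0 : E) ε)) := by
  have h1 : ∫ y in Metric.closedBall x ε ∪ Metric.closedBall x' ε, f y = ∫ y, f y := by
    refine setIntegral_eq_integral_of_forall_compl_eq_zero fun y hy => ?_
    rw [mem_union, not_or, mem_closedBall_iff_norm', mem_closedBall_iff_norm', not_le, not_le] at hy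
    exact h0 y hy.1 hy.2
  have hfin : volume (Metric.closedBall x ε ∪ Metric.closedBall x' ε) < ⊤ :=
    ((isCompact_closedBall x ε).union (isCompact_closedBall x' ε)).measure_lt_top
  rw [← h1]
  refine (norm_setIntegral_le_of_norm_le_const hfin fun y _ => hf y).trans ?_
  gcongr
  refine (measureReal_union_le _ _).trans (le_of_eq ?_)
  rw [two_mul]
  congr 1 <;> simp [Measure.real, Measure.addHaar_closedBall_center]

/-- The mollification of a function bounded by `1` is a test function, with bounds that depend on
the kernel alone. -/
lemma IsMollifier.isC11_mollify (hη : IsMollifier η Gη K ε) (hu : Continuous u)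
    (hb : ∀ y, |u y| ≤ 1) :
    IsC11 (mollify η u) (mollifyGrad Gη u)
      (K * (2 * volume.real (Metric.closedBall (0 : E) ε))) := by
  have hK := hη.c11.nonneg
  have hi := fun x => hη.integrable_mul hu x
  have hg := fun x => hη.integrable_smul hu x
  have hz := fun (x y : E) (h : ε < ‖x - y‖) => hη.zero _ h
  have hzg := fun (x y : E) (h : ε < ‖x - y‖) => hη.zero_grad _ h
  have hm : ∀ (y : E) {a b : ℝ}, |a| ≤ b → |u y * a| ≤ b := fun y a b h => by
    rw [abs_mul]
    exact (mul_le_of_le_one_left (abs_nonneg _) (hb y)).trans h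
  have hs : ∀ (y : E) {a : E} {b : ℝ}, ‖a‖ ≤ b → ‖u y • a‖ ≤ b := fun y a b h => by
    rw [norm_smul]
    exact (mul_le_of_le_one_left (norm_nonneg _) (hb y)).trans h
  refine ⟨fun x => ?_, fun x x' => ?_, fun x => ?_, fun x x' => ?_, fun x x' => ?_⟩
  · rw [← Real.norm_eq_abs]
    refine norm_integral_le_of_support_subset_balls (x := x) (x' := x) hK
      (fun y => hm y (hη.c11.bound _)) fun y h _ => by simp [hz x y h]
  · rw [mollify, mollify, ← integral_sub (hi x) (hi x'), mul_right_comm, ← Real.norm_eq_abs]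
    refine norm_integral_le_of_support_subset_balls (x := x) (x' := x') (by positivity)
      (fun y => ?_) fun y h h' => by simp [hz x y h, hz x' y h']
    rw [← mul_sub]
    exact hm y (by simpa using hη.c11.lip (x - y) (x' - y))
  · refine norm_integral_le_of_support_subset_balls (x := x) (x' := x) hK
      (fun y => hs y (hη.c11.bound_grad _)) fun y h _ => by simp [hzg x y h]
  · rw [mollifyGrad, mollifyGrad, ← integral_sub (hg x) (hg x'), mul_right_comm]
    refine norm_integral_le_of_support_subset_balls (x := x) (x' := x') (by positivity)
      (fun y => ?_) fun y h h' => by simp [hzg x y h, hzg x' y h']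
    rw [← smul_sub]
    exact hs y (by simpa using hη.c11.lip_grad (x - y) (x' - y))
  · have h1 : ⟪mollifyGrad Gη u x, x' - x⟫ = ∫ y, u y * ⟪Gη (x - y), x' - x⟫ := by
      rw [real_inner_comm, mollifyGrad, ← integral_inner (hg x)]
      refine integral_congr_ae (ae_of_all _ fun y => ?_)
      simp only
      rw [inner_smul_right, real_inner_comm]
    have h2 : Integrable fun y => u y * ⟪Gη (x - y), x' - x⟫ := by
      refine ((hg x).inner_const (𝕜 := ℝ) (x' - x)).congr (ae_of_all _ fun y => ?_)
      simp only
      rw [real_inner_smul_left]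
    rw [h1, mollify, mollify, ← integral_sub (hi x') (hi x),
      ← integral_sub (by exact (hi x').sub (hi x)) h2, mul_right_comm, ← Real.norm_eq_abs]
    refine norm_integral_le_of_support_subset_balls (x := x) (x' := x') (by positivity)
      (fun y => ?_) fun y h h' => by simp [hz x y h, hz x' y h', hzg x y h]
    rw [← mul_sub, ← mul_sub]
    exact hm y (by simpa using hη.c11.taylor (x - y) (x' - y))

end Mollify

/-! ### One time step along a trajectory -/

section Path

variable {φ θ : E → ℝ} {G H : E → E} {K K' : ℝ} {γ a : ℝ → E} {t t' : ℝ}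

lemma IsC11.intervalIntegrable_inner (h : IsC11 φ G K) (hγ : Measurable γ)
    (ha : IntervalIntegrable a volume t t') :
    IntervalIntegrable (fun s => ⟪G (γ s), a s⟫) volume t t' := by
  refine (ha.norm.const_mul K).mono_fun (AEStronglyMeasurable.inner (𝕜 := ℝ)
    (h.continuous_grad.measurable.comp hγ).aestronglyMeasurable
    ha.aestronglyMeasurable_restrict_uIoc)
    (ae_of_all _ fun s => ?_)
  beta_reduce
  rw [norm_mul, norm_norm, Real.norm_of_nonneg h.nonneg]
  exact (norm_inner_le_norm _ _).trans (by gcongr; exact h.bound_grad _)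

/-- First-order expansion of a test function for the displacement `∫ a`, the gradient being
evaluated along a path `γ` that stays within `I` of the base point. -/
lemma IsC11.abs_sub_sub_integral_le (h : IsC11 φ G K) (htt : t ≤ t') (hγ : Measurable γ)
    (ha : IntervalIntegrable a volume t t') {I : ℝ} (hI : ∀ s ∈ Icc t t', ‖γ s - γ t‖ ≤ I) :
    |φ (γ t + ∫ s in t..t', a s) - φ (γ t) - ∫ s in t..t', ⟪G (γ s), a s⟫| ≤
      K * (∫ s in t..t', ‖a s‖) ^ 2 + K * I * ∫ s in t..t', ‖a s‖ := by
  have hK := h.nonneg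
  have hc : IntervalIntegrable (fun s => ⟪G (γ t), a s⟫) volume t t' :=
    h.intervalIntegrable_inner (γ := fun _ => γ t) measurable_const ha
  have hd := h.intervalIntegrable_inner hγ ha
  have e1 : ⟪G (γ t), ∫ s in t..t', a s⟫ = ∫ s in t..t', ⟪G (γ t), a s⟫ := by
    rw [intervalIntegral.integral_of_le htt, intervalIntegral.integral_of_le htt,
      integral_inner ha.1]
  have h1 := h.taylor (γ t) (γ t + ∫ s in t..t', a s)
  rw [add_sub_cancel_left, e1] at h1
  have hn : ‖∫ s in t..t', a s‖ ≤ ∫ s in t..t', ‖a s‖ :=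
    intervalIntegral.norm_integral_le_integral_norm htt
  have h2 : |(∫ s in t..t', ⟪G (γ t), a s⟫) - ∫ s in t..t', ⟪G (γ s), a s⟫| ≤
      K * I * ∫ s in t..t', ‖a s‖ := by
    rw [← intervalIntegral.integral_sub hc hd, ← intervalIntegral.integral_const_mul,
      ← Real.norm_eq_abs]
    refine intervalIntegral.norm_integral_le_of_norm_le htt (ae_of_all _ fun s hs => ?_)
      (ha.norm.const_mul _)
    rw [← inner_sub_left]
    refine (norm_inner_le_norm _ _).trans ?_
    gcongr
    rw [norm_sub_rev]
    exact (h.lip_grad _ _).trans (by gcongr; exact hI s ⟨hs.1.le, hs.2⟩)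
  calc _ = |(φ (γ t + ∫ s in t..t', a s) - φ (γ t) - ∫ s in t..t', ⟪G (γ t), a s⟫) +
        ((∫ s in t..t', ⟪G (γ t), a s⟫) - ∫ s in t..t', ⟪G (γ s), a s⟫)| := by ring_nf
    _ ≤ _ := (abs_add_le _ _).trans (add_le_add (h1.trans (by gcongr)) h2)

lemma norm_sub_le_integral_norm (ha : IntervalIntegrable a volume t t')
    (hγa : ∀ s ∈ Icc t t', γ s = γ t + ∫ r in t..s, a r) {s : ℝ} (hs : s ∈ Icc t t') :
    ‖γ s - γ t‖ ≤ ∫ r in t..t', ‖a r‖ := by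
  rw [hγa s hs, add_sub_cancel_left]
  refine (intervalIntegral.norm_integral_le_integral_norm hs.1).trans ?_
  exact intervalIntegral.integral_mono_interval le_rfl hs.1 hs.2
    (ae_of_all _ fun _ => norm_nonneg _) ha.norm

/-- Transporting the test function along the flow of `w` for one time step compensates the
displacement by `w` along any path `γ`, up to an error of second order in the step plus a
mollification error of first order. -/
lemma IsMollifier.abs_mollify_flow_sub_le {η : E → ℝ} {Gη : E → E} {K ε M L Λ : ℝ} {w : E → ℝ → E}
    (hη : IsMollifier η Gη K ε) (hw : IsLipField w M L) {U : E → ℝ} (hΛ : 0 ≤ Λ)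
    (hU : ∀ x y, |U x - U y| ≤ Λ * ‖x - y‖) (hUc : Continuous U) (htt : t ≤ t') (hγ : Measurable γ)
    {I : ℝ} (hI : ∀ s ∈ Icc t t', ‖γ s - γ t‖ ≤ I) :
    |mollify η U (γ t + ∫ s in t..t', w (γ s) s) -
      mollify η (fun y => U (flow w t y t')) (γ t)| ≤
      Λ * L * (t' - t) * (ε + M * (t' - t) + I) := by
  have hL := hw.L_nonneg
  have hM := hw.M_nonneg
  have hfc : Continuous fun y => flow w t y t' :=
    (continuous_uncurry_flow hw t).comp (by fun_prop : Continuous fun y : E => (y, t'))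
  refine hη.abs_mollify_sub_le hUc (hUc.comp hfc) fun z hz => ?_
  refine (hU _ _).trans ?_
  rw [mul_assoc, mul_assoc]
  refine mul_le_mul_of_nonneg_left ?_ hΛ
  beta_reduce
  rw [flow_eq hw _ htt]
  have e : γ t + (∫ s in t..t', w (γ s) s) - z -
      (γ t - z + ∫ s in t..t', w (flow w t (γ t - z) s) s) =
      ∫ s in t..t', (w (γ s) s - w (flow w t (γ t - z) s) s) := by
    rw [intervalIntegral.integral_sub (hw.intervalIntegrable hγ _ _)
      (hw.intervalIntegrable (continuous_flow hw _ _).measurable _ _)]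
    abel
  rw [e]
  have := intervalIntegral.norm_integral_le_of_norm_le_const (a := t) (b := t')
    (f := fun s => w (γ s) s - w (flow w t (γ t - z) s) s)
    (C := L * (ε + M * (t' - t) + I)) (fun s hs => ?_)
  · rw [abs_of_nonneg (sub_nonneg.2 htt)] at this
    linarith
  · rw [uIoc_of_le htt] at hs
    refine (hw.lip _ _ _).trans ?_
    gcongr
    have h1 := norm_flow_sub_le hw (γ t - z) le_rfl hs.1.le
    rw [flow_of_le hw _ le_rfl, abs_of_pos (sub_pos.2 hs.1)] at h1
    have h2 := hI s ⟨hs.1.le, hs.2⟩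
    have e2 : γ s - flow w t (γ t - z) s =
        z - (flow w t (γ t - z) s - (γ t - z)) + (γ s - γ t) := by abel
    rw [e2]
    refine (norm_add_le _ _).trans (add_le_add ((norm_sub_le _ _).trans (add_le_add hz ?_)) h2)
    exact h1.trans (by gcongr; exact hs.2)

/-- The change of `θ * U_ε` along a trajectory in one time step, where `U` is transported by the
flow of `w`. -/
lemma IsMollifier.abs_step_le {η : E → ℝ} {Gη : E → E} {Kη ε M L Λ : ℝ} {w : E → ℝ → E}
    (hη : IsMollifier η Gη Kη ε) (hw : IsLipField w M L) {U : E → ℝ} (hΛ : 0 ≤ Λ)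
    (hU : ∀ x y, |U x - U y| ≤ Λ * ‖x - y‖) (hUc : Continuous U)
    (hφ : IsC11 (mollify η U) (mollifyGrad Gη U) K') (hθ : IsC11 θ H K) (hθ1 : ∀ x, |θ x| ≤ 1)
    (htt : t ≤ t') (hγ : Measurable γ) (ha : IntervalIntegrable a volume t t')
    (hγa : ∀ s ∈ Icc t t', γ s = γ t + ∫ r in t..s, a r) :
    |θ (γ t') * mollify η U (γ t') -
      θ (γ t) * mollify η (fun y => U (flow w t y t')) (γ t) -
      ∫ s in t..t', (⟪θ (γ s) • mollifyGrad Gη U (γ s) + mollify η U (γ s) • H (γ s), a s⟫ -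
        θ (γ s) * ⟪mollifyGrad Gη U (γ s), w (γ s) s⟫)| ≤
      (8 * K * K' + K' * M ^ 2 + K' * M + K * K' * M + Λ * L * (M + 1)) *
        ((t' - t) + ∫ s in t..t', ‖a s‖) ^ 2 + Λ * L * ε * (t' - t) := by
  set I := ∫ s in t..t', ‖a s‖ with hI
  have hI0 : 0 ≤ I := intervalIntegral.integral_nonneg htt fun _ _ => norm_nonneg _
  have hγI : ∀ s ∈ Icc t t', ‖γ s - γ t‖ ≤ I := fun s hs => norm_sub_le_integral_norm ha hγa hs
  have hh : 0 ≤ t' - t := sub_nonneg.2 htt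
  have hK := hθ.nonneg
  have hK' := hφ.nonneg
  have hM := hw.M_nonneg
  have hL := hw.L_nonneg
  have hwi := hw.intervalIntegrable hγ t t'
  have hP := hθ.mul hφ
  have hi1 := hP.intervalIntegrable_inner hγ ha
  have hi2 := hφ.intervalIntegrable_inner hγ hwi
  have hi3 : IntervalIntegrable (fun s => θ (γ s) * ⟪mollifyGrad Gη U (γ s), w (γ s) s⟫)
      volume t t' := by
    refine hi2.norm.mono_fun ((hθ.continuous.measurable.comp hγ).aestronglyMeasurable.mul
      hi2.aestronglyMeasurable_restrict_uIoc) (ae_of_all _ fun s => ?_)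
    beta_reduce
    rw [norm_mul, norm_norm]
    exact mul_le_of_le_one_left (norm_nonneg _) (hθ1 _)
  have hW : ∫ s in t..t', ‖w (γ s) s‖ ≤ M * (t' - t) := by
    refine (intervalIntegral.integral_mono_on htt hwi.norm intervalIntegrable_const
      fun s _ => hw.bound _ _).trans (le_of_eq ?_)
    simp [mul_comm]
  have hW0 : 0 ≤ ∫ s in t..t', ‖w (γ s) s‖ :=
    intervalIntegral.integral_nonneg htt fun _ _ => norm_nonneg _
  have hA := hP.abs_sub_sub_integral_le htt hγ ha hγI
  rw [← hγa t' ⟨htt, le_rfl⟩, ← hI] at hA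
  have hB := hφ.abs_sub_sub_integral_le htt hγ hwi hγI
  have hC := hη.abs_mollify_flow_sub_le hw hΛ hU hUc htt hγ hγI
  have hD : |θ (γ t) * (∫ s in t..t', ⟪mollifyGrad Gη U (γ s), w (γ s) s⟫) -
      ∫ s in t..t', θ (γ s) * ⟪mollifyGrad Gη U (γ s), w (γ s) s⟫| ≤ K * K' * M * I * (t' - t) := by
    rw [← intervalIntegral.integral_const_mul,
      ← intervalIntegral.integral_sub (hi2.const_mul _) hi3, ← Real.norm_eq_abs]
    have := intervalIntegral.norm_integral_le_of_norm_le_const (a := t) (b := t')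
      (f := fun s => θ (γ t) * ⟪mollifyGrad Gη U (γ s), w (γ s) s⟫ -
        θ (γ s) * ⟪mollifyGrad Gη U (γ s), w (γ s) s⟫)
      (C := K * I * (K' * M)) (fun s hs => ?_)
    · rw [abs_of_nonneg hh] at this
      linarith
    · rw [uIoc_of_le htt] at hs
      rw [← sub_mul, norm_mul]
      refine mul_le_mul ?_ ((norm_inner_le_norm _ _).trans (mul_le_mul (hφ.bound_grad _)
        (hw.bound _ _) (norm_nonneg _) hK')) (norm_nonneg _) (by positivity)
      refine (hθ.lip _ _).trans ?_
      rw [norm_sub_rev]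
      gcongr
      exact hγI s ⟨hs.1.le, hs.2⟩
  rw [intervalIntegral.integral_sub hi1 hi3]
  set Wv := ∫ s in t..t', w (γ s) s
  set iA := ∫ s in t..t',
    ⟪θ (γ s) • mollifyGrad Gη U (γ s) + mollify η U (γ s) • H (γ s), a s⟫
  set iB := ∫ s in t..t', ⟪mollifyGrad Gη U (γ s), w (γ s) s⟫
  set iD := ∫ s in t..t', θ (γ s) * ⟪mollifyGrad Gη U (γ s), w (γ s) s⟫
  set J := ∫ s in t..t', ‖w (γ s) s‖
  have e : θ (γ t') * mollify η U (γ t') -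
      θ (γ t) * mollify η (fun y => U (flow w t y t')) (γ t) - (iA - iD) =
      (θ (γ t') * mollify η U (γ t') - θ (γ t) * mollify η U (γ t) - iA) -
      θ (γ t) * (mollify η U (γ t + Wv) - mollify η U (γ t) - iB) +
      θ (γ t) * (mollify η U (γ t + Wv) - mollify η (fun y => U (flow w t y t')) (γ t)) -
      (θ (γ t) * iB - iD) := by ring
  have hm : ∀ {r c : ℝ}, |r| ≤ c → |θ (γ t) * r| ≤ c := fun h => by
    rw [abs_mul]
    exact (mul_le_of_le_one_left (abs_nonneg _) (hθ1 _)).trans h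
  rw [e]
  refine (abs_sub _ _).trans ((add_le_add ((abs_add_le _ _).trans (add_le_add ((abs_sub _ _).trans
    (add_le_add hA (hm hB))) (hm hC))) hD).trans ?_)
  set h := t' - t
  have hJ2 : J ^ 2 ≤ M ^ 2 * h ^ 2 := by
    rw [← mul_pow]; exact pow_le_pow_left₀ hW0 hW 2
  have hh2 : h ^ 2 ≤ (h + I) ^ 2 := by nlinarith
  have hI2 : I ^ 2 ≤ (h + I) ^ 2 := by nlinarith
  have hhI : h * I ≤ (h + I) ^ 2 := by nlinarith [mul_nonneg hh hI0]
  have b1 : K' * J ^ 2 ≤ K' * M ^ 2 * (h + I) ^ 2 := by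
    rw [mul_assoc]
    exact mul_le_mul_of_nonneg_left (hJ2.trans (by gcongr)) hK'
  have b2 : K' * I * J ≤ K' * M * (h + I) ^ 2 := by
    calc K' * I * J ≤ K' * I * (M * h) := by gcongr
      _ = K' * M * (h * I) := by ring
      _ ≤ _ := by gcongr
  have b3 : K * K' * M * I * h ≤ K * K' * M * (h + I) ^ 2 := by
    calc _ = K * K' * M * (h * I) := by ring
      _ ≤ _ := by gcongr
  have b4 : Λ * L * h * (ε + M * h + I) ≤ Λ * L * (M + 1) * (h + I) ^ 2 + Λ * L * ε * h := by
    calc _ = Λ * L * (M * h ^ 2 + h * I) + Λ * L * ε * h := by ring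
      _ ≤ Λ * L * (M * (h + I) ^ 2 + (h + I) ^ 2) + Λ * L * ε * h := by gcongr
      _ = _ := by ring
  have b5 : 4 * K * K' * I ^ 2 + 4 * K * K' * I * I ≤ 8 * K * K' * (h + I) ^ 2 := by
    calc _ = 8 * K * K' * I ^ 2 := by ring
      _ ≤ _ := by gcongr
  linarith

end Path

/-! ### Random trajectories and their mean velocity field -/

/-- The random trajectories `X`, with velocities `A`, have the vector field `v` as mean velocity:
`v(y,t)` is the conditional expectation of `A_t` given `X_t = y`. The conditional expectation is
encoded by orthogonality to all bounded Borel vector fields along `X`. -/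
structure HasMeanVelocity {Ω : Type*} [MeasurableSpace Ω] (μ : Measure Ω) (X A : Ω → ℝ → E)
    (v : E → ℝ → E) : Prop where
  meas_X : Measurable (Function.uncurry X)
  meas_v : Measurable (Function.uncurry v)
  memLp_A : MemLp (fun p : Ω × ℝ => A p.1 p.2) 2 (μ.prod time)
  integrable_v : Integrable (fun p : Ω × ℝ => v (X p.1 p.2) p.2) (μ.prod time)
  traj : ∀ᵐ x ∂μ, ∀ t ∈ Icc (0 : ℝ) 1, X x t = X x 0 + ∫ r in (0 : ℝ)..t, A x r
  orth : ∀ φ : E → ℝ → E, Measurable (Function.uncurry φ) → (∃ C, ∀ y t, ‖φ y t‖ ≤ C) →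
    ∫ p, ⟪φ (X p.1 p.2) p.2, A p.1 p.2 - v (X p.1 p.2) p.2⟫ ∂(μ.prod time) = 0

lemma sq_integral_le {f : ℝ → ℝ} {t t' : ℝ} (h : t ≤ t') (hf : IntervalIntegrable f volume t t')
    (hf2 : IntervalIntegrable (fun s => f s ^ 2) volume t t') :
    (∫ s in t..t', f s) ^ 2 ≤ (t' - t) * ∫ s in t..t', f s ^ 2 := by
  rcases h.eq_or_lt with rfl | hlt
  · simp
  set I := ∫ s in t..t', f s with hI
  -- expand the nonnegative integral of `((t' - t) f - I)²`
  have h1 : 0 ≤ ∫ s in t..t', ((t' - t) ^ 2 * f s ^ 2 - 2 * (t' - t) * I * f s + I ^ 2) :=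
    intervalIntegral.integral_nonneg h fun s _ => by
      nlinarith [sq_nonneg ((t' - t) * f s - I)]
  rw [intervalIntegral.integral_add ((hf2.const_mul _).sub (hf.const_mul _))
      intervalIntegrable_const, intervalIntegral.integral_sub (hf2.const_mul _) (hf.const_mul _),
    intervalIntegral.integral_const_mul, intervalIntegral.integral_const_mul, ← hI,
    intervalIntegral.integral_const, smul_eq_mul] at h1
  have h2 : 0 < t' - t := sub_pos.2 hlt
  by_contra! hc
  nlinarith [mul_pos h2 (sub_pos.2 hc)]

variable {Ω : Type*} [MeasurableSpace Ω] {μ : Measure Ω} [IsProbabilityMeasure μ]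

lemma time_restrict_Ioc {t t' : ℝ} (ht : 0 ≤ t) (ht' : t' ≤ 1) :
    time.restrict (Ioc t t') = volume.restrict (Ioc t t') := by
  rw [Measure.restrict_restrict measurableSet_Ioc, inter_eq_left.2]
  exact fun s hs => ⟨ht.trans hs.1.le, hs.2.trans ht'⟩

lemma prod_time_restrict {t t' : ℝ} (ht : 0 ≤ t) (ht' : t' ≤ 1) :
    μ.prod (volume.restrict (Ioc t t')) = (μ.prod time).restrict (univ ×ˢ Ioc t t') := by
  rw [← Measure.prod_restrict, Measure.restrict_univ, time_restrict_Ioc ht ht']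

lemma intervalIntegrable_of_time {f : ℝ → E} (hf : Integrable f time) {t t' : ℝ} (ht : 0 ≤ t)
    (htt : t ≤ t') (ht' : t' ≤ 1) : IntervalIntegrable f volume t t' := by
  rw [intervalIntegrable_iff_integrableOn_Ioc_of_le htt, IntegrableOn, ← time_restrict_Ioc ht ht']
  exact hf.restrict

namespace HasMeanVelocity

variable {X A : Ω → ℝ → E} {v : E → ℝ → E}

lemma measurable_at (hX : HasMeanVelocity μ X A v) (t : ℝ) : Measurable fun x => X x t :=
  hX.meas_X.comp (measurable_id.prodMk measurable_const)

lemma integrable_A (hX : HasMeanVelocity μ X A v) :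
    Integrable (fun p : Ω × ℝ => A p.1 p.2) (μ.prod time) :=
  hX.memLp_A.integrable (by norm_num)

lemma integrable_sq_A (hX : HasMeanVelocity μ X A v) :
    Integrable (fun p : Ω × ℝ => ‖A p.1 p.2‖ ^ 2) (μ.prod time) :=
  hX.memLp_A.integrable_norm_pow (by norm_num)

lemma ae_traj_sub (hX : HasMeanVelocity μ X A v) : ∀ᵐ x ∂μ, Integrable (A x) time ∧
    Integrable (fun s => ‖A x s‖ ^ 2) time ∧
    ∀ t t', 0 ≤ t → t ≤ t' → t' ≤ 1 → X x t' = X x t + ∫ r in t..t', A x r := by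
  filter_upwards [hX.traj, hX.integrable_A.prod_right_ae, hX.integrable_sq_A.prod_right_ae]
    with x h1 h2 h3
  refine ⟨h2, h3, fun t t' ht htt ht' => ?_⟩
  rw [h1 t ⟨ht, htt.trans ht'⟩, h1 t' ⟨ht.trans htt, ht'⟩, add_assoc,
    intervalIntegral.integral_add_adjacent_intervals
      (intervalIntegrable_of_time h2 le_rfl ht (htt.trans ht'))
      (intervalIntegrable_of_time h2 ht htt ht')]

/-- The expected change of `θ * U_ε` in one time step, where `U` is transported by the flow of `w`
and `w = v` on the support of `θ`. The first-order terms cancel because `v` is the mean velocity;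
what remains is the flux of `v` through the region where `θ` is not constant. -/
lemma abs_integral_step_le (hX : HasMeanVelocity μ X A v) {θ : E → ℝ} {H : E → E}
    {K K' κ : ℝ} (hθ : IsC11 θ H K) (hθ1 : ∀ x, |θ x| ≤ 1) (hκ : ∀ x, ‖H x‖ ≤ κ)
    {w : E → ℝ → E} {M L : ℝ} (hw : IsLipField w M L)
    (hwv : ∀ y, θ y ≠ 0 → ∀ t ∈ Icc (0 : ℝ) 1, w y t = v y t)
    {η : E → ℝ} {Gη : E → E} {Kη ε Λ : ℝ} (hη : IsMollifier η Gη Kη ε) {U : E → ℝ} (hΛ : 0 ≤ Λ)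
    (hU : ∀ x y, |U x - U y| ≤ Λ * ‖x - y‖) (hUc : Continuous U) (hU1 : ∀ y, |U y| ≤ 1)
    (hφ : IsC11 (mollify η U) (mollifyGrad Gη U) K')
    {C : ℝ} (hC : C = 8 * K * K' + K' * M ^ 2 + K' * M + K * K' * M + Λ * L * (M + 1))
    {t t' : ℝ} (ht : 0 ≤ t) (htt : t ≤ t') (ht' : t' ≤ 1) :
    |(∫ x, θ (X x t') * mollify η U (X x t') ∂μ) -
      ∫ x, θ (X x t) * mollify η (fun y => U (flow w t y t')) (X x t) ∂μ| ≤
      κ * (∫ s in t..t', ∫ x, ‖v (X x s) s‖ ∂μ) + (2 * C * (t' - t) ^ 2 +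
        2 * C * (t' - t) * (∫ s in t..t', ∫ x, ‖A x s‖ ^ 2 ∂μ) + Λ * L * ε * (t' - t)) := by
  have hh : 0 ≤ t' - t := sub_nonneg.2 htt
  have hM := hw.M_nonneg
  have hL := hw.L_nonneg
  have hK := hθ.nonneg
  have hK' := hφ.nonneg
  have hC0 : 0 ≤ C := by rw [hC]; positivity
  have hS : MeasurableSet (univ ×ˢ Ioc t t' : Set (Ω × ℝ)) :=
    MeasurableSet.univ.prod measurableSet_Ioc
  set P : Measure (Ω × ℝ) := μ.prod (volume.restrict (Ioc t t')) with hP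
  have hPr : P = (μ.prod time).restrict (univ ×ˢ Ioc t t') := prod_time_restrict ht ht'
  have hPle : P ≤ μ.prod time := by rw [hPr]; exact Measure.restrict_le_self
  have hPv : Integrable (fun p : Ω × ℝ => v (X p.1 p.2) p.2) P := hX.integrable_v.mono_measure hPle
  have hPA : Integrable (fun p : Ω × ℝ => A p.1 p.2) P := hX.integrable_A.mono_measure hPle
  have hPA2 : Integrable (fun p : Ω × ℝ => ‖A p.1 p.2‖ ^ 2) P :=
    hX.integrable_sq_A.mono_measure hPle
  have hXm : Measurable fun p : Ω × ℝ => X p.1 p.2 := hX.meas_X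
  have hfc : Continuous fun y => flow w t y t' :=
    (continuous_uncurry_flow hw t).comp (by fun_prop : Continuous fun y : E => (y, t'))
  have hφ0 := hη.isC11_mollify (hUc.comp hfc) (fun y => hU1 _)
  -- the integrand of the first-order term
  set G : E → E := fun y => θ y • mollifyGrad Gη U y + mollify η U y • H y with hG
  have hPθ := hθ.mul hφ
  set f : Ω × ℝ → ℝ := fun p => ⟪G (X p.1 p.2), A p.1 p.2⟫ -
    θ (X p.1 p.2) * ⟪mollifyGrad Gη U (X p.1 p.2), w (X p.1 p.2) p.2⟫ with hf
  have inner_int : ∀ {F : E → E} {B : Ω × ℝ → E} {c : ℝ}, Continuous F → (∀ y, ‖F y‖ ≤ c) →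
      Integrable B P → Integrable (fun p => ⟪F (X p.1 p.2), B p⟫) P := fun {F B c} hF hc hB => by
    refine Integrable.mono' (hB.norm.const_mul c) (AEStronglyMeasurable.inner (𝕜 := ℝ)
      (hF.measurable.comp hXm).aestronglyMeasurable hB.aestronglyMeasurable)
      (ae_of_all _ fun p => ?_)
    exact (norm_inner_le_norm _ _).trans (mul_le_mul_of_nonneg_right (hc _) (norm_nonneg _))
  have hi1 : Integrable (fun p => ⟪G (X p.1 p.2), A p.1 p.2⟫) P :=
    inner_int hPθ.continuous_grad hPθ.bound_grad hPA
  have hi1v : Integrable (fun p => ⟪G (X p.1 p.2), v (X p.1 p.2) p.2⟫) P :=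
    inner_int hPθ.continuous_grad hPθ.bound_grad hPv
  have hwP : Integrable (fun p : Ω × ℝ => w (X p.1 p.2) p.2) P := by
    refine Integrable.mono' (integrable_const M)
      (hw.meas.comp (hXm.prodMk measurable_snd)).aestronglyMeasurable (ae_of_all _ fun p => ?_)
    exact hw.bound _ _
  have hi2 : Integrable (fun p : Ω × ℝ =>
      θ (X p.1 p.2) * ⟪mollifyGrad Gη U (X p.1 p.2), w (X p.1 p.2) p.2⟫) P := by
    have := inner_int hφ.continuous_grad hφ.bound_grad hwP
    refine Integrable.mono' this.norm ((hθ.continuous.measurable.comp hXm).aestronglyMeasurable.mul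
      this.aestronglyMeasurable) (ae_of_all _ fun p => ?_)
    rw [norm_mul]
    exact mul_le_of_le_one_left (norm_nonneg _) (hθ1 _)
  have hfi : Integrable f P := hi1.sub hi2
  -- the mean velocity replaces the velocity
  have horth : ∫ p, ⟪G (X p.1 p.2), A p.1 p.2⟫ ∂P = ∫ p, ⟪G (X p.1 p.2), v (X p.1 p.2) p.2⟫ ∂P := by
    have h1 := hX.orth (fun y s => (Ioc t t').indicator (fun _ => G y) s) (by
        have : Function.uncurry (fun y s => (Ioc t t').indicator (fun _ => G y) s) =
            (univ ×ˢ Ioc t t').indicator (fun p : E × ℝ => G p.1) := by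
          ext1 ⟨y, s⟩; simp [indicator]
        rw [this]
        exact (hPθ.continuous_grad.measurable.comp measurable_fst).indicator
          (MeasurableSet.univ.prod measurableSet_Ioc))
      ⟨4 * K * K', fun y s => (norm_indicator_le_norm_self _ _).trans (hPθ.bound_grad y)⟩
    have h2 : ∫ p, ⟪G (X p.1 p.2), A p.1 p.2 - v (X p.1 p.2) p.2⟫ ∂P = 0 := by
      rw [hPr, ← integral_indicator hS, ← h1]
      refine integral_congr_ae (ae_of_all _ fun p => ?_)
      by_cases hp : p.2 ∈ Ioc t t' <;> simp [indicator, hp]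
    simp only [inner_sub_right] at h2
    rw [integral_sub hi1 hi1v] at h2
    linarith
  have hflux : |∫ p, f p ∂P| ≤ κ * ∫ s in t..t', ∫ x, ‖v (X x s) s‖ ∂μ := by
    have e1 : ∫ p, f p ∂P =
        ∫ p, mollify η U (X p.1 p.2) * ⟪H (X p.1 p.2), v (X p.1 p.2) p.2⟫ ∂P := by
      rw [hf, integral_sub hi1 hi2, horth, ← integral_sub hi1v hi2, hPr]
      refine setIntegral_congr_fun hS fun p hp => ?_
      have hp2 : p.2 ∈ Icc (0 : ℝ) 1 := ⟨ht.trans hp.2.1.le, hp.2.2.trans ht'⟩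
      simp only [hG, inner_add_left, real_inner_smul_left]
      by_cases h0 : θ (X p.1 p.2) = 0
      · simp [h0]
      · rw [hwv _ h0 _ hp2]; ring
    rw [e1, intervalIntegral.integral_of_le htt, ← integral_prod_symm _ hPv.norm,
      ← integral_const_mul, ← Real.norm_eq_abs]
    refine norm_integral_le_of_norm_le (hPv.norm.const_mul _) (ae_of_all _ fun p => ?_)
    rw [norm_mul, Real.norm_eq_abs]
    refine (mul_le_of_le_one_left (norm_nonneg _) (hη.abs_mollify_le hUc hU1 _)).trans ?_
    exact (norm_inner_le_norm _ _).trans (mul_le_mul_of_nonneg_right (hκ _) (norm_nonneg _))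
  have bdd_int : ∀ {F : E → ℝ} {c : ℝ} (r : ℝ), Continuous F → (∀ y, |F y| ≤ c) →
      Integrable (fun x => F (X x r)) μ := fun r hF hc =>
    Integrable.mono' (integrable_const _)
      (hF.measurable.comp (hX.measurable_at r)).aestronglyMeasurable (ae_of_all _ fun x => hc _)
  have hd1 := bdd_int t' hPθ.continuous hPθ.bound
  have hd0 : Integrable (fun x => θ (X x t) * mollify η (fun y => U (flow w t y t')) (X x t)) μ :=
    bdd_int t (hθ.mul hφ0).continuous (hθ.mul hφ0).bound
  have hfx : Integrable (fun x => ∫ s in t..t', f (x, s)) μ := by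
    simp only [intervalIntegral.integral_of_le htt]
    exact hfi.integral_prod_left
  have hA2x : Integrable (fun x => ∫ s in t..t', ‖A x s‖ ^ 2) μ := by
    simp only [intervalIntegral.integral_of_le htt]
    exact hPA2.integral_prod_left
  have hpath : ∀ᵐ x ∂μ, ‖θ (X x t') * mollify η U (X x t') -
      θ (X x t) * mollify η (fun y => U (flow w t y t')) (X x t) - ∫ s in t..t', f (x, s)‖ ≤
      2 * C * (t' - t) ^ 2 + 2 * C * (t' - t) * (∫ s in t..t', ‖A x s‖ ^ 2) +
        Λ * L * ε * (t' - t) := by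
    filter_upwards [hX.ae_traj_sub] with x hx
    have hAi := intervalIntegrable_of_time hx.1 ht htt ht'
    have hA2i := intervalIntegrable_of_time hx.2.1 ht htt ht'
    have hγ : Measurable (X x) := hX.meas_X.comp measurable_prodMk_left
    have h1 := hη.abs_step_le hw hΛ hU hUc hφ hθ hθ1 htt hγ hAi
      (fun s hs => hx.2.2 t s ht hs.1 (hs.2.trans ht'))
    rw [← hC] at h1
    refine h1.trans ?_
    have h2 := sq_integral_le htt hAi.norm hA2i
    have h3 : ((t' - t) + ∫ s in t..t', ‖A x s‖) ^ 2 ≤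
        2 * ((t' - t) ^ 2 + (t' - t) * ∫ s in t..t', ‖A x s‖ ^ 2) := by
      nlinarith [sq_nonneg ((t' - t) - ∫ s in t..t', ‖A x s‖)]
    nlinarith [mul_le_mul_of_nonneg_left h3 hC0]
  have e2 : ∫ x, (∫ s in t..t', f (x, s)) ∂μ = ∫ p, f p ∂P := by
    simp only [intervalIntegral.integral_of_le htt]
    rw [hP, integral_prod _ hfi]
  have e3 : ∫ x, (∫ s in t..t', ‖A x s‖ ^ 2) ∂μ = ∫ s in t..t', ∫ x, ‖A x s‖ ^ 2 ∂μ := by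
    simp only [intervalIntegral.integral_of_le htt]
    exact integral_integral_swap (f := fun x s => ‖A x s‖ ^ 2) hPA2
  have h4 := norm_integral_le_of_norm_le
    (((integrable_const (2 * C * (t' - t) ^ 2)).add (hA2x.const_mul (2 * C * (t' - t)))).add
      (integrable_const (Λ * L * ε * (t' - t)))) hpath
  rw [integral_sub (by exact hd1.sub hd0) hfx, integral_sub hd1 hd0, e2] at h4
  have e5 : ∫ x, (((2 * C * (t' - t) ^ 2 + 2 * C * (t' - t) * (∫ s in t..t', ‖A x s‖ ^ 2))) +
        Λ * L * ε * (t' - t)) ∂μ = 2 * C * (t' - t) ^ 2 +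
        2 * C * (t' - t) * (∫ s in t..t', ∫ x, ‖A x s‖ ^ 2 ∂μ) + Λ * L * ε * (t' - t) := by
    rw [integral_add (by exact (integrable_const _).add (hA2x.const_mul _)) (integrable_const _),
      integral_add (integrable_const _) (hA2x.const_mul _), integral_const, integral_const,
      integral_const_mul, e3]
    simp
  simp only [Pi.add_apply] at h4
  rw [e5] at h4
  rw [Real.norm_eq_abs, abs_le] at h4
  rw [abs_le] at hflux ⊢
  constructor <;> linarith [h4.1, h4.2, hflux.1, hflux.2]

end HasMeanVelocity

/-! ### Comparison with the flow of the mean velocity field -/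

namespace HasMeanVelocity

variable {X A : Ω → ℝ → E} {v : E → ℝ → E}

/-- The estimate for one time step, summed over a uniform partition of `[0,T]` whose mesh tends
to `0`. -/
lemma abs_integral_mollify_sub_le (hX : HasMeanVelocity μ X A v) {θ : E → ℝ} {H : E → E}
    {K κ : ℝ} (hθ : IsC11 θ H K) (hθ1 : ∀ x, |θ x| ≤ 1) (hκ : ∀ x, ‖H x‖ ≤ κ)
    {w : E → ℝ → E} {M L : ℝ} (hw : IsLipField w M L)
    (hwv : ∀ y, θ y ≠ 0 → ∀ t ∈ Icc (0 : ℝ) 1, w y t = v y t)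
    {η : E → ℝ} {Gη : E → E} {Kη ε l : ℝ} (hη : IsMollifier η Gη Kη ε) {ψ : E → ℝ} (hl : 0 ≤ l)
    (hψ : ∀ x y, |ψ x - ψ y| ≤ l * ‖x - y‖) (hψ1 : ∀ y, |ψ y| ≤ 1)
    {T : ℝ} (hT0 : 0 ≤ T) (hT1 : T ≤ 1) :
    |(∫ x, θ (X x T) * mollify η ψ (X x T) ∂μ) -
      ∫ x, θ (X x 0) * mollify η (fun y => ψ (flow w 0 y T)) (X x 0) ∂μ| ≤
      κ * (∫ s in (0 : ℝ)..T, ∫ x, ‖v (X x s) s‖ ∂μ) + l * Real.exp L * L * ε * T := by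
  have hL := hw.L_nonneg
  have hψc : Continuous ψ := by
    refine (LipschitzWith.of_dist_le_mul (K := l.toNNReal) fun x y => ?_).continuous
    rw [Real.dist_eq, dist_eq_norm, Real.coe_toNNReal _ hl]
    exact hψ x y
  set Λ := l * Real.exp L with hΛ
  have hΛ0 : 0 ≤ Λ := by positivity
  set K' := Kη * (2 * volume.real (Metric.closedBall (0 : E) ε))
  set C := 8 * K * K' + K' * M ^ 2 + K' * M + K * K' * M + Λ * L * (M + 1) with hC
  set B := ∫ s in (0 : ℝ)..T, ∫ x, ‖A x s‖ ^ 2 ∂μ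
  set Q := ∫ s in (0 : ℝ)..T, ∫ x, ‖v (X x s) s‖ ∂μ
  have hU : ∀ s, 0 ≤ s → s ≤ T → ∀ x y, |ψ (flow w s x T) - ψ (flow w s y T)| ≤ Λ * ‖x - y‖ := by
    intro s hs hsT x y
    refine (hψ _ _).trans ?_
    rw [hΛ, mul_assoc]
    refine mul_le_mul_of_nonneg_left ((flow_lipschitz hw hsT x y).trans ?_) hl
    rw [mul_comm]
    gcongr
    nlinarith
  have hUc : ∀ s, Continuous fun y => ψ (flow w s y T) := fun s =>
    hψc.comp ((continuous_uncurry_flow hw s).comp (by fun_prop : Continuous fun y : E => (y, T)))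
  have key : ∀ n : ℕ, 0 < n → |(∫ x, θ (X x T) * mollify η ψ (X x T) ∂μ) -
      ∫ x, θ (X x 0) * mollify η (fun y => ψ (flow w 0 y T)) (X x 0) ∂μ| ≤
      κ * Q + Λ * L * ε * T + (2 * C * T ^ 2 + 2 * C * T * B) * (1 / (n : ℝ)) := by
    intro n hn
    have hn' : (0 : ℝ) < n := by exact_mod_cast hn
    let τ : ℕ → ℝ := fun k => k * (T / n)
    have hTn : 0 ≤ T / n := by positivity
    have hτ0 : τ 0 = 0 := by simp [τ]
    have hτn : τ n = T := by simp only [τ]; field_simp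
    have hτs : ∀ k, τ (k + 1) - τ k = T / n := fun k => by simp only [τ]; push_cast; ring
    have hτp : ∀ k, 0 ≤ τ k := fun k => by positivity
    have hτT : ∀ k, k ≤ n → τ k ≤ T := fun k hk => by
      rw [← hτn]; simp only [τ]; gcongr
    let g : ℕ → ℝ := fun k => ∫ x, θ (X x (τ k)) *
      mollify η (fun y => ψ (flow w (τ k) y T)) (X x (τ k)) ∂μ
    have hstep : ∀ k ∈ Finset.range n, |g (k + 1) - g k| ≤
        κ * (∫ s in τ k..τ (k + 1), ∫ x, ‖v (X x s) s‖ ∂μ) + (2 * C * (T / n) ^ 2 +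
        2 * C * (T / n) * (∫ s in τ k..τ (k + 1), ∫ x, ‖A x s‖ ^ 2 ∂μ) +
          Λ * L * ε * (T / n)) := by
      intro k hk
      have hk' : k + 1 ≤ n := Finset.mem_range.1 hk
      have hle : τ k ≤ τ (k + 1) := by linarith [hτs k]
      have := hX.abs_integral_step_le hθ hθ1 hκ hw hwv hη hΛ0 (hU _ (hτp (k + 1)) (hτT _ hk'))
        (hUc _) (fun y => hψ1 _) (hη.isC11_mollify (hUc _) fun y => hψ1 _) hC (hτp k) hle
        ((hτT _ hk').trans hT1)
      simp only [flow_flow hw _ hle (hτT _ hk'), hτs] at this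
      exact this
    have hq : ∀ {f : ℝ → ℝ}, Integrable f time → ∑ k ∈ Finset.range n, ∫ s in τ k..τ (k + 1), f s =
        ∫ s in (0 : ℝ)..T, f s := fun hf => by
      rw [intervalIntegral.sum_integral_adjacent_intervals, hτ0, hτn]
      intro k hk
      exact intervalIntegrable_of_time hf (hτp k) (by linarith [hτs k]) ((hτT _ hk).trans hT1)
    have hsum := Finset.sum_le_sum hstep
    have hqv := hq (f := fun s => ∫ x, ‖v (X x s) s‖ ∂μ) hX.integrable_v.norm.integral_prod_right
    have hqA := hq (f := fun s => ∫ x, ‖A x s‖ ^ 2 ∂μ) hX.integrable_sq_A.integral_prod_right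
    simp only [Finset.sum_add_distrib, ← Finset.mul_sum, hqv, hqA, Finset.sum_const,
      Finset.card_range, nsmul_eq_mul] at hsum
    have htel := (Finset.abs_sum_le_sum_abs (fun k => g (k + 1) - g k) (Finset.range n)).trans hsum
    rw [Finset.sum_range_sub] at htel
    have gn : g n = ∫ x, θ (X x T) * mollify η ψ (X x T) ∂μ := by
      simp only [g, hτn, flow_of_le hw _ le_rfl]
    have g0 : g 0 = ∫ x, θ (X x 0) * mollify η (fun y => ψ (flow w 0 y T)) (X x 0) ∂μ := by
      simp only [g, hτ0]
    rw [gn, g0] at htel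
    refine htel.trans (le_of_eq ?_)
    field_simp
    ring
  have hlim : Tendsto (fun n : ℕ => κ * Q + Λ * L * ε * T +
      (2 * C * T ^ 2 + 2 * C * T * B) * (1 / (n : ℝ))) atTop (𝓝 (κ * Q + Λ * L * ε * T)) := by
    simpa using ((tendsto_one_div_atTop_nhds_zero_nat (𝕜 := ℝ)).const_mul
      (2 * C * T ^ 2 + 2 * C * T * B)).const_add (κ * Q + Λ * L * ε * T)
  exact ge_of_tendsto hlim ((eventually_gt_atTop 0).mono key)

lemma integrable_comp_bounded (hX : HasMeanVelocity μ X A v) {F : E → ℝ} {c : ℝ} (t : ℝ)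
    (hF : Continuous F) (hc : ∀ y, |F y| ≤ c) : Integrable (fun x => F (X x t)) μ :=
  Integrable.mono' (integrable_const c)
    (hF.measurable.comp (hX.measurable_at t)).aestronglyMeasurable (ae_of_all _ fun _ => hc _)

/-- Localized comparison of the law of `X_T` with the image of the law of `X_0` under the flow of a
Lipschitz field that agrees with the mean velocity on the support of the cutoff `θ`. The error is
the flux of the mean velocity through the transition region of `θ`; it does not involve the
Lipschitz constant of the field. -/
lemma abs_integral_sub_flow_le (hX : HasMeanVelocity μ X A v) {θ : E → ℝ} {H : E → E}
    {K κ : ℝ} (hθ : IsC11 θ H K) (hθ1 : ∀ x, |θ x| ≤ 1) (hκ : ∀ x, ‖H x‖ ≤ κ)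
    {w : E → ℝ → E} {M L : ℝ} (hw : IsLipField w M L)
    (hwv : ∀ y, θ y ≠ 0 → ∀ t ∈ Icc (0 : ℝ) 1, w y t = v y t) {l : ℝ} {ψ : E → ℝ} (hl : 0 ≤ l)
    (hψ : ∀ x y, |ψ x - ψ y| ≤ l * ‖x - y‖) (hψ1 : ∀ y, |ψ y| ≤ 1)
    {T : ℝ} (hT0 : 0 ≤ T) (hT1 : T ≤ 1) :
    |(∫ x, θ (X x T) * ψ (X x T) ∂μ) - ∫ x, θ (X x 0) * ψ (flow w 0 (X x 0) T) ∂μ| ≤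
      κ * ∫ s in (0 : ℝ)..T, ∫ x, ‖v (X x s) s‖ ∂μ := by
  have hL := hw.L_nonneg
  have hψc : Continuous ψ := by
    refine (LipschitzWith.of_dist_le_mul (K := l.toNNReal) fun x y => ?_).continuous
    rw [Real.dist_eq, dist_eq_norm, Real.coe_toNNReal _ hl]
    exact hψ x y
  have hUc : Continuous fun y => ψ (flow w 0 y T) :=
    hψc.comp ((continuous_uncurry_flow hw 0).comp (by fun_prop : Continuous fun y : E => (y, T)))
  set c := l * Real.exp L * L * T + l + l * Real.exp L with hc
  have hmol : ∀ {U : E → ℝ} {Λ : ℝ} (t : ℝ), 0 ≤ Λ → Continuous U → (∀ y, |U y| ≤ 1) →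
      (∀ x y, |U x - U y| ≤ Λ * ‖x - y‖) → ∀ {η Gη Kη ε}, IsMollifier η Gη Kη ε →
      |(∫ x, θ (X x t) * mollify η U (X x t) ∂μ) - ∫ x, θ (X x t) * U (X x t) ∂μ| ≤ Λ * ε := by
    intro U Λ t hΛ hUc hU1 hU η Gη Kη ε hη
    have h1 := hX.integrable_comp_bounded t (hθ.mul (hη.isC11_mollify hUc hU1)).continuous
      (hθ.mul (hη.isC11_mollify hUc hU1)).bound
    have h2 := hX.integrable_comp_bounded (F := fun y => θ y * U y) (c := 1) t
      (hθ.continuous.mul hUc) (fun y => by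
        rw [abs_mul]; exact mul_le_one₀ (hθ1 y) (abs_nonneg _) (hU1 y))
    rw [← integral_sub h1 h2, ← Real.norm_eq_abs]
    refine (norm_integral_le_of_norm_le_const (C := Λ * ε) (ae_of_all _ fun x => ?_)).trans
      (by simp)
    rw [← mul_sub, norm_mul]
    refine (mul_le_of_le_one_left (norm_nonneg _) (hθ1 _)).trans ?_
    refine hη.abs_mollify_sub_const_le hUc fun z hz => (hU _ _).trans ?_
    gcongr
    simpa using hz
  refine le_of_forall_pos_le_add fun δ hδ => ?_
  have hc0 : 0 ≤ c := by positivity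
  obtain ⟨η, Gη, Kη, hη⟩ := exists_isMollifier (E := E) (ε := δ / (c + 1)) (by positivity)
  have h1 := hX.abs_integral_mollify_sub_le hθ hθ1 hκ hw hwv hη hl hψ hψ1 hT0 hT1
  have h2 := hmol T hl hψc hψ1 hψ hη
  have h3 := hmol 0 (U := fun y => ψ (flow w 0 y T)) (Λ := l * Real.exp L) (by positivity) hUc
    (fun y => hψ1 _) (fun x y => by
      refine (hψ _ _).trans ?_
      rw [mul_assoc]
      refine mul_le_mul_of_nonneg_left ((flow_lipschitz hw hT0 x y).trans ?_) hl
      rw [mul_comm]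
      gcongr
      nlinarith) hη
  have h4 : c * (δ / (c + 1)) ≤ δ := by
    rw [mul_div_assoc', div_le_iff₀ (by positivity)]
    nlinarith
  have h5 : c * (δ / (c + 1)) = l * Real.exp L * L * (δ / (c + 1)) * T + l * (δ / (c + 1)) +
      l * Real.exp L * (δ / (c + 1)) := by rw [hc]; ring
  rw [abs_le] at h1 h2 h3 ⊢
  constructor <;> linarith [h1.1, h1.2, h2.1, h2.2, h3.1, h3.2]

end HasMeanVelocity

/-- `v` is bounded and Lipschitz in space on bounded sets, uniformly in time on `[0,1]`. -/
def IsLocLipField (v : E → ℝ → E) : Prop :=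
  ∀ R : ℝ, ∃ C L : ℝ, ∀ t ∈ Icc (0 : ℝ) 1, (∀ x, ‖x‖ ≤ R → ‖v x t‖ ≤ C) ∧
    ∀ x y, ‖x‖ ≤ R → ‖y‖ ≤ R → ‖v x t - v y t‖ ≤ L * ‖x - y‖

/-- A Lipschitz cutoff, equal to `1` for `‖x‖ ≤ R` and to `0` for `R + 1 ≤ ‖x‖`. -/
def ballCutoff (R : ℝ) (x : E) : ℝ := max 0 (min 1 (R + 1 - ‖x‖))

section Cutoff

variable {R : ℝ} {x y : E}

lemma ballCutoff_nonneg : 0 ≤ ballCutoff R x := le_max_left _ _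

lemma ballCutoff_le_one : ballCutoff R x ≤ 1 := max_le zero_le_one (min_le_left _ _)

lemma ballCutoff_eq_one (h : ‖x‖ ≤ R) : ballCutoff R x = 1 := by
  rw [ballCutoff, min_eq_left (by linarith), max_eq_right zero_le_one]

lemma ballCutoff_eq_zero (h : R + 1 ≤ ‖x‖) : ballCutoff R x = 0 := by
  rw [ballCutoff, max_eq_left ((min_le_right _ _).trans (by linarith))]

lemma abs_ballCutoff_sub_le : |ballCutoff R x - ballCutoff R y| ≤ ‖x - y‖ := by
  refine (abs_max_sub_max_le_max _ _ _ _).trans ?_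
  rw [sub_self, abs_zero, max_eq_right (abs_nonneg _)]
  refine (abs_min_sub_min_le_max _ _ _ _).trans ?_
  rw [sub_self, abs_zero, max_eq_right (abs_nonneg _), sub_sub_sub_cancel_left, norm_sub_rev]
  exact abs_norm_sub_norm_le y x

lemma continuous_ballCutoff : Continuous (ballCutoff R : E → ℝ) := by
  unfold ballCutoff
  fun_prop

end Cutoff

/-- Multiplying a locally Lipschitz field by the cutoff makes it globally Lipschitz. -/
lemma IsLocLipField.norm_cutoff_smul_sub_le {v : E → ℝ → E} {R C L : ℝ} {t : ℝ}
    (hC : ∀ x, ‖x‖ ≤ R + 1 → ‖v x t‖ ≤ C)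
    (hL : ∀ x y, ‖x‖ ≤ R + 1 → ‖y‖ ≤ R + 1 → ‖v x t - v y t‖ ≤ L * ‖x - y‖) (x y : E) :
    ‖ballCutoff R x • v x t - ballCutoff R y • v y t‖ ≤ (max C 0 + max L 0) * ‖x - y‖ := by
  have hC0 : 0 ≤ max C 0 := le_max_right _ _
  have hL0 : 0 ≤ max L 0 := le_max_right _ _
  wlog hxy : ‖x‖ ≤ ‖y‖ generalizing x y
  · rw [norm_sub_rev, norm_sub_rev x]
    exact this y x (not_le.1 hxy).le
  rcases le_or_gt ‖x‖ (R + 1) with hx | hx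
  · have hxC := (hC x hx).trans (le_max_left C 0)
    have h1 : ‖(ballCutoff R x - ballCutoff R y) • v x t‖ ≤ max C 0 * ‖x - y‖ := by
      rw [norm_smul, mul_comm]
      exact mul_le_mul hxC abs_ballCutoff_sub_le (norm_nonneg _) hC0
    rcases le_or_gt ‖y‖ (R + 1) with hy | hy
    · have e : ballCutoff R x • v x t - ballCutoff R y • v y t =
          (ballCutoff R x - ballCutoff R y) • v x t + ballCutoff R y • (v x t - v y t) := by module
      rw [e, add_mul]
      refine (norm_add_le _ _).trans (add_le_add h1 ?_)
      rw [norm_smul, Real.norm_of_nonneg ballCutoff_nonneg]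
      refine (mul_le_of_le_one_left (norm_nonneg _) ballCutoff_le_one).trans
        ((hL x y hx hy).trans ?_)
      gcongr
      exact le_max_left _ _
    · rw [ballCutoff_eq_zero hy.le, sub_zero] at h1
      rw [ballCutoff_eq_zero hy.le, zero_smul, sub_zero]
      refine h1.trans ?_
      gcongr
      linarith
  · rw [ballCutoff_eq_zero hx.le, ballCutoff_eq_zero (hx.le.trans hxy)]
    simp only [zero_smul, sub_self, norm_zero]
    positivity

/-- The field `v`, multiplied by the Lipschitz cutoff at radius `2n` and by the indicator function
of the time interval `[0,1]`. -/
def cutoffField (v : E → ℝ → E) (n : ℕ) (x : E) (t : ℝ) : E :=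
  (Icc (0 : ℝ) 1).indicator (fun t => ballCutoff (2 * n) x • v x t) t

lemma cutoffField_eq {v : E → ℝ → E} {n : ℕ} {x : E} {t : ℝ} (hx : ‖x‖ ≤ 2 * n)
    (ht : t ∈ Icc (0 : ℝ) 1) : cutoffField v n x t = v x t := by
  rw [cutoffField, indicator_of_mem ht, ballCutoff_eq_one hx, one_smul]

lemma exists_isLipField_cutoffField {v : E → ℝ → E} (hm : Measurable (Function.uncurry v))
    (hv : IsLocLipField v) (n : ℕ) : ∃ M L, IsLipField (cutoffField v n) M L := by
  obtain ⟨C, L, h⟩ := hv (2 * n + 1)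
  refine ⟨max C 0, max C 0 + max L 0, ?_, fun x t => ?_, fun x y t => ?_, by positivity⟩
  · have : Function.uncurry (cutoffField v n) = (univ ×ˢ Icc (0 : ℝ) 1).indicator
        (fun p : E × ℝ => ballCutoff (2 * n) p.1 • v p.1 p.2) := by
      ext1 ⟨x, t⟩
      simp [cutoffField, indicator]
    rw [this]
    exact ((continuous_ballCutoff.measurable.comp measurable_fst).smul hm).indicator
      (MeasurableSet.univ.prod measurableSet_Icc)
  · by_cases ht : t ∈ Icc (0 : ℝ) 1
    · rw [cutoffField, indicator_of_mem ht, norm_smul, Real.norm_of_nonneg ballCutoff_nonneg]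
      rcases le_or_gt ‖x‖ (2 * n + 1) with hx | hx
      · exact (mul_le_of_le_one_left (norm_nonneg _) ballCutoff_le_one).trans
          (((h t ht).1 x hx).trans (le_max_left _ _))
      · simp [ballCutoff_eq_zero hx.le]
    · simp [cutoffField, ht]
  · by_cases ht : t ∈ Icc (0 : ℝ) 1
    · simp only [cutoffField, indicator_of_mem ht]
      exact IsLocLipField.norm_cutoff_smul_sub_le (h t ht).1 (h t ht).2 x y
    · simp only [cutoffField, indicator_of_notMem ht, sub_self, norm_zero]
      positivity

lemma exists_isC11_cutoff : ∃ (θ : E → ℝ) (H : E → E) (K : ℝ), IsC11 θ H K ∧ (∀ x, |θ x| ≤ 1) ∧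
    (∀ x, ‖x‖ ≤ 1 → θ x = 1) ∧ ∀ x, 2 ≤ ‖x‖ → θ x = 0 := by
  let f : ContDiffBump (0 : E) := ⟨1, 2, by norm_num, by norm_num⟩
  obtain ⟨K, hK⟩ := exists_isC11_of_hasCompactSupport (f.contDiff (n := 2)) f.hasCompactSupport
  refine ⟨f, _, K, hK, fun x => ?_, fun x hx => f.one_of_mem_closedBall (by simpa using hx),
    fun x hx => f.zero_of_le_dist (by simpa using hx)⟩
  rw [abs_of_nonneg f.nonneg]
  exact f.le_one

namespace HasMeanVelocity

variable {X A : Ω → ℝ → E} {v : E → ℝ → E}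

lemma tendsto_integral_flow_of_abs_le_one (hX : HasMeanVelocity μ X A v) (hv : IsLocLipField v)
    {l : ℝ} {ψ : E → ℝ} (hl : 0 ≤ l) (hψ : ∀ x y, |ψ x - ψ y| ≤ l * ‖x - y‖)
    (hψ1 : ∀ y, |ψ y| ≤ 1) {T : ℝ} (hT0 : 0 ≤ T) (hT1 : T ≤ 1) :
    Tendsto (fun n => ∫ x, ψ (flow (cutoffField v n) 0 (X x 0) T) ∂μ) atTop
      (𝓝 (∫ x, ψ (X x T) ∂μ)) := by
  obtain ⟨θ, H, K, hθ, hθ1, hone, hzero⟩ := exists_isC11_cutoff (E := E)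
  have hψc : Continuous ψ := by
    refine (LipschitzWith.of_dist_le_mul (K := l.toNNReal) fun x y => ?_).continuous
    rw [Real.dist_eq, dist_eq_norm, Real.coe_toNNReal _ hl]
    exact hψ x y
  set V := ∫ s in (0 : ℝ)..T, ∫ x, ‖v (X x s) s‖ ∂μ
  let θn : ℕ → E → ℝ := fun n x => θ ((n : ℝ)⁻¹ • x)
  -- the mass outside the region where the cutoff equals one vanishes in the limit
  have htail : ∀ t, Tendsto (fun n => ∫ x, |1 - θn n (X x t)| ∂μ) atTop (𝓝 0) := fun t => by
    rw [← integral_zero Ω ℝ (μ := μ)]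
    refine tendsto_integral_of_dominated_convergence (fun _ => 2) (fun n => ?_)
      (integrable_const _) (fun n => ae_of_all _ fun x => ?_) (ae_of_all _ fun x => ?_)
    · have : Continuous fun y => |1 - θn n y| := by
        have := hθ.continuous
        fun_prop
      exact (this.measurable.comp (hX.measurable_at t)).aestronglyMeasurable
    · rw [Real.norm_eq_abs, abs_abs]
      have := hθ1 ((n : ℝ)⁻¹ • X x t)
      rw [abs_le] at this ⊢
      constructor <;> linarith [this.1, this.2]
    · refine tendsto_const_nhds.congr' ?_
      filter_upwards [eventually_ge_atTop ⌈‖X x t‖⌉₊, eventually_gt_atTop 0] with n hn hn0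
      have hn' : (0 : ℝ) < n := by exact_mod_cast hn0
      have : θn n (X x t) = 1 := by
        refine hone _ ?_
        rw [norm_smul, norm_inv, Real.norm_of_nonneg hn'.le, inv_mul_le_one₀ hn']
        exact (Nat.le_ceil _).trans (by exact_mod_cast hn)
      simp [this]
  have hbound : ∀ᶠ n : ℕ in atTop, ‖(∫ x, ψ (flow (cutoffField v n) 0 (X x 0) T) ∂μ) -
      ∫ x, ψ (X x T) ∂μ‖ ≤ (n : ℝ)⁻¹ * K * V + (∫ x, |1 - θn n (X x 0)| ∂μ) +
        ∫ x, |1 - θn n (X x T)| ∂μ := by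
    filter_upwards [eventually_gt_atTop 0] with n hn0
    have hn' : (1 : ℝ) ≤ n := by exact_mod_cast hn0
    obtain ⟨M, L, hw⟩ := exists_isLipField_cutoffField hX.meas_v hv n
    have hθn := hθ.dilate hn'
    have h1 := hX.abs_integral_sub_flow_le hθn (fun x => hθ1 _) (κ := (n : ℝ)⁻¹ * K) (fun x => by
        rw [norm_smul, norm_inv, Real.norm_of_nonneg (by linarith)]
        gcongr
        exact hθ.bound_grad _) hw (fun y hy t ht => cutoffField_eq (by
          by_contra! hc
          refine hy (hzero _ ?_)
          rw [norm_smul, norm_inv, Real.norm_of_nonneg (by linarith), ← div_eq_inv_mul,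
            le_div_iff₀ (by linarith)]
          exact hc.le) ht) hl hψ hψ1 hT0 hT1
    have hUc : Continuous fun y => ψ (flow (cutoffField v n) 0 y T) :=
      hψc.comp ((continuous_uncurry_flow hw 0).comp
        (by fun_prop : Continuous fun y : E => (y, T)))
    have hrem : ∀ {U : E → ℝ} (t : ℝ), Continuous U → (∀ y, |U y| ≤ 1) →
        |(∫ x, U (X x t) ∂μ) - ∫ x, θn n (X x t) * U (X x t) ∂μ| ≤
          ∫ x, |1 - θn n (X x t)| ∂μ := by
      intro U t hU hU1
      have i1 := hX.integrable_comp_bounded t hU hU1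
      have i2 := hX.integrable_comp_bounded (F := fun y => θn n y * U y) (c := 1) t
        (hθn.continuous.mul hU) (fun y => by
          rw [abs_mul]; exact mul_le_one₀ (hθ1 _) (abs_nonneg _) (hU1 y))
      have i3 := hX.integrable_comp_bounded (c := K) t hθn.continuous hθn.bound
      rw [← integral_sub i1 i2, ← Real.norm_eq_abs]
      refine norm_integral_le_of_norm_le ((integrable_const (1 : ℝ)).sub i3).abs
        (ae_of_all _ fun x => ?_)
      rw [← one_sub_mul, norm_mul]
      exact mul_le_of_le_one_right (norm_nonneg _) (hU1 _)
    have h2 := hrem 0 hUc (fun y => hψ1 _)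
    have h3 := hrem T hψc hψ1
    rw [Real.norm_eq_abs]
    rw [abs_le] at h1 h2 h3 ⊢
    constructor <;> linarith [h1.1, h1.2, h2.1, h2.2, h3.1, h3.2]
  rw [tendsto_iff_norm_sub_tendsto_zero]
  refine squeeze_zero' (Eventually.of_forall fun _ => norm_nonneg _) hbound ?_
  have h4 : Tendsto (fun n : ℕ => (n : ℝ)⁻¹ * K * V) atTop (𝓝 0) := by
    simpa using ((tendsto_inv_atTop_nhds_zero_nat (𝕜 := ℝ)).mul_const K).mul_const V
  simpa using (h4.add (htail 0)).add (htail T)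

/-- The images of the law of `X_0` under the flows of the truncated mean velocity fields converge
weakly to the law of `X_T`. -/
lemma tendsto_integral_flow (hX : HasMeanVelocity μ X A v) (hv : IsLocLipField v)
    {l B : ℝ} {ψ : E → ℝ} (hψ : ∀ x y, |ψ x - ψ y| ≤ l * ‖x - y‖)
    (hψB : ∀ y, |ψ y| ≤ B) {T : ℝ} (hT0 : 0 ≤ T) (hT1 : T ≤ 1) :
    Tendsto (fun n => ∫ x, ψ (flow (cutoffField v n) 0 (X x 0) T) ∂μ) atTop
      (𝓝 (∫ x, ψ (X x T) ∂μ)) := by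
  have hB0 : 0 ≤ B := (abs_nonneg _).trans (hψB 0)
  set c := B + 1 with hc
  have hcp : 0 < c := by positivity
  have h := hX.tendsto_integral_flow_of_abs_le_one hv (l := c⁻¹ * |l|) (ψ := fun x => c⁻¹ * ψ x)
    (by positivity) (fun x y => by
      rw [← mul_sub, abs_mul, abs_of_pos (inv_pos.2 hcp), mul_assoc]
      gcongr
      exact (hψ x y).trans (by gcongr; exact le_abs_self l))
    (fun y => by
      rw [abs_mul, abs_of_pos (inv_pos.2 hcp), inv_mul_le_one₀ hcp]
      linarith [hψB y]) hT0 hT1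
  simp only [integral_const_mul] at h
  simpa [← mul_assoc, mul_inv_cancel₀ hcp.ne'] using h.const_mul c

end HasMeanVelocity

/-! ### Almost every characteristic exists globally -/

/-- The truncated flow started at `x` stays where the truncation is not active. -/
def Confined (v : E → ℝ → E) (n : ℕ) (x : E) : Prop :=
  ∀ t ∈ Icc (0 : ℝ) 1, ‖flow (cutoffField v n) 0 x t‖ ≤ 2 * n

section Confined

variable {v : E → ℝ → E}

/-- A global solution that stays in the ball of radius `2n` is the truncated flow of every order
`m ≥ n`. -/
lemma flow_cutoffField_eq (hm : Measurable (Function.uncurry v)) (hv : IsLocLipField v)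
    {γ : ℝ → E} (hγ : Continuous γ) {x : E} {n m : ℕ} (hnm : n ≤ m)
    (hb : ∀ t ∈ Icc (0 : ℝ) 1, ‖γ t‖ ≤ 2 * n)
    (e : ∀ t ∈ Icc (0 : ℝ) 1, γ t = x + ∫ r in (0 : ℝ)..t, v (γ r) r) :
    ∀ t ∈ Icc (0 : ℝ) 1, flow (cutoffField v m) 0 x t = γ t := by
  obtain ⟨M, L, hw⟩ := exists_isLipField_cutoffField hm hv m
  refine flow_unique hw hγ fun t ht => ?_
  rw [e t ht]
  congr 1
  refine intervalIntegral.integral_congr fun r hr => ?_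
  rw [uIcc_of_le ht.1] at hr
  have hr1 : r ∈ Icc (0 : ℝ) 1 := ⟨hr.1, hr.2.trans ht.2⟩
  refine (cutoffField_eq ((hb r hr1).trans ?_) hr1).symm
  have : (n : ℝ) ≤ m := by exact_mod_cast hnm
  linarith

lemma flow_cutoffField_solution (hm : Measurable (Function.uncurry v)) (hv : IsLocLipField v)
    {x : E} {n k : ℕ} (hx : ∀ t ∈ Icc (0 : ℝ) 1, ‖flow (cutoffField v n) 0 x t‖ ≤ 2 * k)
    (hkn : k ≤ n) {t : ℝ} (ht : t ∈ Icc (0 : ℝ) 1) :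
    flow (cutoffField v n) 0 x t = x + ∫ r in (0 : ℝ)..t, v (flow (cutoffField v n) 0 x r) r := by
  obtain ⟨M, L, hw⟩ := exists_isLipField_cutoffField hm hv n
  rw [flow_eq hw x ht.1]
  congr 1
  refine intervalIntegral.integral_congr fun r hr => ?_
  rw [uIcc_of_le ht.1] at hr
  have hr1 : r ∈ Icc (0 : ℝ) 1 := ⟨hr.1, hr.2.trans ht.2⟩
  refine cutoffField_eq ((hx r hr1).trans ?_) hr1
  have : (k : ℝ) ≤ n := by exact_mod_cast hkn
  linarith

lemma Confined.flow_eq (hm : Measurable (Function.uncurry v)) (hv : IsLocLipField v) {x : E}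
    {n m : ℕ} (hx : Confined v n x) (hnm : n ≤ m) {t : ℝ} (ht : t ∈ Icc (0 : ℝ) 1) :
    flow (cutoffField v m) 0 x t = flow (cutoffField v n) 0 x t := by
  obtain ⟨M, L, hw⟩ := exists_isLipField_cutoffField hm hv n
  exact flow_cutoffField_eq hm hv (continuous_flow hw 0 x) hnm hx
    (fun t ht => flow_cutoffField_solution hm hv hx le_rfl ht) t ht

/-- A trajectory that leaves the ball of radius `2q` has to cover the distance to its boundary while
the truncation of order `q` is not active. -/
lemma le_integral_norm_of_not_confined (hm : Measurable (Function.uncurry v)) (hv : IsLocLipField v)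
    {x : E} {q n : ℕ} (hqn : q ≤ n) (hx : ¬ Confined v q x) :
    2 * q - ‖x‖ ≤ ∫ s in (0 : ℝ)..1, ‖cutoffField v q (flow (cutoffField v n) 0 x s) s‖ := by
  obtain ⟨M, L, hw⟩ := exists_isLipField_cutoffField hm hv n
  obtain ⟨M', L', hw'⟩ := exists_isLipField_cutoffField hm hv q
  set γ := flow (cutoffField v n) 0 x with hγ
  have hγc : Continuous γ := continuous_flow hw 0 x
  have hqn' : (q : ℝ) ≤ n := by exact_mod_cast hqn
  let S : Set ℝ := Icc 0 1 ∩ {t | 2 * q ≤ ‖γ t‖}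
  have hS : S.Nonempty := by
    by_contra! hS
    have hb : ∀ t ∈ Icc (0 : ℝ) 1, ‖γ t‖ ≤ 2 * q := fun t ht => by
      by_contra! h
      have : t ∈ S := ⟨ht, h.le⟩
      simp [hS] at this
    refine hx fun t ht => ?_
    rw [flow_cutoffField_eq hm hv hγc le_rfl hb
      (fun t ht => flow_cutoffField_solution hm hv hb hqn ht) t ht]
    exact hb t ht
  have hSc : IsCompact S := isCompact_Icc.inter_right (isClosed_le continuous_const hγc.norm)
  obtain ⟨τ, ⟨hτ, hτq⟩, hmin⟩ := hSc.exists_isLeast hS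
  have hlt : ∀ s ∈ Ioo (0 : ℝ) τ, ‖γ s‖ ≤ 2 * q := fun s hs => by
    by_contra! h
    exact (hmin ⟨⟨hs.1.le, hs.2.le.trans hτ.2⟩, h.le⟩).not_gt hs.2
  have hi := hw.intervalIntegrable hγc.measurable 0 τ
  have hi' := fun a b => (hw'.intervalIntegrable hγc.measurable a b).norm
  have h1 : ‖γ τ - x‖ ≤ ∫ s in (0 : ℝ)..τ, ‖cutoffField v n (γ s) s‖ := by
    rw [hγ, MFG.flow_eq hw x hτ.1, add_sub_cancel_left]
    exact intervalIntegral.norm_integral_le_integral_norm hτ.1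
  have h2 : ∫ s in (0 : ℝ)..τ, ‖cutoffField v n (γ s) s‖ ≤
      ∫ s in (0 : ℝ)..τ, ‖cutoffField v q (γ s) s‖ := by
    refine intervalIntegral.integral_mono_on_of_le_Ioo hτ.1 hi.norm (hi' _ _) fun s hs => ?_
    have hs1 : s ∈ Icc (0 : ℝ) 1 := ⟨hs.1.le, hs.2.le.trans hτ.2⟩
    rw [cutoffField_eq (hlt s hs) hs1, cutoffField_eq ((hlt s hs).trans (by linarith)) hs1]
  have h3 : ∫ s in (0 : ℝ)..τ, ‖cutoffField v q (γ s) s‖ ≤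
      ∫ s in (0 : ℝ)..1, ‖cutoffField v q (γ s) s‖ :=
    intervalIntegral.integral_mono_interval le_rfl hτ.1 hτ.2 (ae_of_all _ fun _ => norm_nonneg _)
      (hi' _ _)
  have h4 : ‖γ τ‖ ≤ ‖γ τ - x‖ + ‖x‖ := by simpa using norm_add_le (γ τ - x) x
  have hτq' : 2 * (q : ℝ) ≤ ‖γ τ‖ := hτq
  linarith

end Confined

lemma norm_cutoffField_le {v : E → ℝ → E} {n : ℕ} {x : E} {t : ℝ} :
    ‖cutoffField v n x t‖ ≤ ‖v x t‖ := by
  refine (norm_indicator_le_norm_self _ _).trans ?_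
  rw [norm_smul, Real.norm_of_nonneg ballCutoff_nonneg]
  exact mul_le_of_le_one_left (norm_nonneg _) ballCutoff_le_one

lemma integral_zero_one_eq_time (f : ℝ → ℝ) : ∫ s in (0 : ℝ)..1, f s = ∫ s, f s ∂time := by
  rw [intervalIntegral.integral_of_le zero_le_one, ← integral_Icc_eq_integral_Ioc]

namespace HasMeanVelocity

variable {X A : Ω → ℝ → E} {v : E → ℝ → E}

/-- The truncated flows do not run away: in the limit their mean speed, measured inside a ball, is
that of the given trajectories, hence bounded by `∫ ‖v(X)‖` whatever the ball. -/
lemma sub_mul_measureReal_le (hX : HasMeanVelocity μ X A v) (hv : IsLocLipField v) (a q : ℕ)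
    (haq : a ≤ 2 * q) : ((2 * q - a : ℝ)) * μ.real {x | ¬ Confined v q (X x 0) ∧ ‖X x 0‖ ≤ a} ≤
      ∫ p, ‖v (X p.1 p.2) p.2‖ ∂(μ.prod time) := by
  have hm := hX.meas_v
  obtain ⟨M', L', hw'⟩ := exists_isLipField_cutoffField hm hv q
  have haq' : (a : ℝ) ≤ 2 * q := by exact_mod_cast haq
  have hX0 := hX.measurable_at 0
  -- the mean speed of the flow of order `n` inside the ball of radius `2q`
  have hmeas : ∀ {Z : Ω × ℝ → E}, Measurable Z →
      Integrable (fun p : Ω × ℝ => ‖cutoffField v q (Z p) p.2‖) (μ.prod time) := fun hZ =>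
    Integrable.mono' (integrable_const M')
      (hw'.meas.comp (hZ.prodMk measurable_snd)).norm.aestronglyMeasurable
      (ae_of_all _ fun p => by rw [norm_norm]; exact hw'.bound _ _)
  have hint : ∀ n, Integrable (fun p : Ω × ℝ =>
      ‖cutoffField v q (flow (cutoffField v n) 0 (X p.1 0) p.2) p.2‖) (μ.prod time) := fun n => by
    obtain ⟨M, L, hw⟩ := exists_isLipField_cutoffField hm hv n
    exact hmeas ((continuous_uncurry_flow hw 0).measurable.comp
      ((hX0.comp measurable_fst).prodMk measurable_snd))
  have hlow : ∀ n, q ≤ n → ((2 * q - a : ℝ)) *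
      μ.real {x | ¬ Confined v q (X x 0) ∧ ‖X x 0‖ ≤ a} ≤
      ∫ s, ∫ x, ‖cutoffField v q (flow (cutoffField v n) 0 (X x 0) s) s‖ ∂μ ∂time := by
    intro n hn
    have h1 := mul_meas_ge_le_integral_of_nonneg (μ := μ)
      (f := fun x => ∫ s, ‖cutoffField v q (flow (cutoffField v n) 0 (X x 0) s) s‖ ∂time)
      (ae_of_all _ fun x => integral_nonneg fun s => norm_nonneg _) (hint n).integral_prod_left
      (2 * q - a)
    rw [integral_integral_swap (by exact hint n)] at h1
    refine (mul_le_mul_of_nonneg_left (measureReal_mono fun x hx => ?_) (by linarith)).trans h1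
    have := le_integral_norm_of_not_confined hm hv hn hx.1
    rw [integral_zero_one_eq_time] at this
    exact (sub_le_sub_left hx.2 _).trans this
  have hlim : Tendsto (fun n => ∫ s, ∫ x, ‖cutoffField v q (flow (cutoffField v n) 0 (X x 0) s) s‖
      ∂μ ∂time) atTop (𝓝 (∫ s, ∫ x, ‖cutoffField v q (X x s) s‖ ∂μ ∂time)) := by
    refine tendsto_integral_of_dominated_convergence (fun _ => M')
      (fun n => (hint n).integral_prod_right.aestronglyMeasurable) (integrable_const _)
      (fun n => ae_of_all _ fun s => ?_) ?_
    · refine (norm_integral_le_of_norm_le_const (C := M') (ae_of_all _ fun x => ?_)).trans (by simp)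
      rw [norm_norm]
      exact hw'.bound _ _
    · refine (ae_restrict_iff' measurableSet_Icc).2 (ae_of_all _ fun s hs => ?_)
      exact hX.tendsto_integral_flow hv (ψ := fun y => ‖cutoffField v q y s‖) (l := L') (B := M')
        (fun x y => (abs_norm_sub_norm_le _ _).trans (hw'.lip x y s))
        (fun y => by rw [abs_norm]; exact hw'.bound y s) hs.1 hs.2
  have h2 := ge_of_tendsto hlim ((eventually_ge_atTop q).mono hlow)
  refine h2.trans ?_
  rw [integral_integral_swap (f := fun s x => ‖cutoffField v q (X x s) s‖)
    (by exact (hmeas (Z := fun p => X p.1 p.2) hX.meas_X).swap), ← integral_prod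
    (fun p : Ω × ℝ => ‖cutoffField v q (X p.1 p.2) p.2‖) (hmeas hX.meas_X)]
  exact integral_mono (hmeas hX.meas_X) hX.integrable_v.norm fun p => norm_cutoffField_le

/-- For almost every initial point the characteristic of the mean velocity field does not blow up
before time `1`. -/
lemma ae_exists_confined (hX : HasMeanVelocity μ X A v) (hv : IsLocLipField v) :
    ∀ᵐ x ∂μ, ∃ n, Confined v n (X x 0) := by
  set V := ∫ p, ‖v (X p.1 p.2) p.2‖ ∂(μ.prod time)
  have hball : ∀ a : ℕ, ∀ᵐ x ∂μ, ‖X x 0‖ ≤ a → ∃ n, Confined v n (X x 0) := by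
    intro a
    have h0 : μ.real {x | ¬ (‖X x 0‖ ≤ a → ∃ n, Confined v n (X x 0))} ≤ 0 := by
      have hlim : Tendsto (fun k : ℕ => V * (k : ℝ)⁻¹) atTop (𝓝 0) := by
        simpa using (tendsto_inv_atTop_nhds_zero_nat (𝕜 := ℝ)).const_mul V
      refine ge_of_tendsto hlim ((eventually_gt_atTop 0).mono fun k hk => ?_)
      have hk' : (0 : ℝ) < k := by exact_mod_cast hk
      have h1 := hX.sub_mul_measureReal_le hv a (a + k) (by omega)
      rw [← div_eq_mul_inv, le_div_iff₀ hk', mul_comm]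
      refine le_trans ?_ h1
      refine mul_le_mul ?_ (measureReal_mono fun x hx => ?_) measureReal_nonneg ?_
      · push_cast
        have : (0 : ℝ) ≤ a := Nat.cast_nonneg a
        linarith
      · simp only [mem_ofPred_eq, Classical.not_imp, not_exists] at hx
        exact ⟨hx.2 _, hx.1⟩
      · push_cast
        have : (0 : ℝ) ≤ a := Nat.cast_nonneg a
        linarith
    rw [ae_iff]
    exact (measureReal_eq_zero_iff).1 (le_antisymm h0 measureReal_nonneg)
  filter_upwards [ae_all_iff.2 hball] with x hx
  exact hx ⌈‖X x 0‖⌉₊ (Nat.le_ceil _)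

/-- If the truncated flows are eventually equal to `Y` at time `T`, then `Y_T` and `X_T` have the
same law. -/
lemma map_eq_of_eventually_flow_eq (hX : HasMeanVelocity μ X A v) (hv : IsLocLipField v) {T : ℝ}
    (hT : T ∈ Icc (0 : ℝ) 1) {Y : Ω → E} (hYm : AEMeasurable Y μ)
    (hY : ∀ᵐ x ∂μ, ∀ᶠ n in atTop, flow (cutoffField v n) 0 (X x 0) T = Y x) :
    μ.map Y = μ.map (fun x => X x T) := by
  have hXT := hX.measurable_at T
  let P : ProbabilityMeasure E := ⟨μ.map Y, Measure.isProbabilityMeasure_map hYm⟩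
  let Q : ProbabilityMeasure E :=
    ⟨μ.map (fun x => X x T), Measure.isProbabilityMeasure_map hXT.aemeasurable⟩
  have h : Tendsto (fun _ : ℕ => P) atTop (𝓝 Q) := by
    rw [tendsto_iff_forall_lipschitz_integral_tendsto]
    intro f ⟨B, hB⟩ ⟨l, hl⟩
    have hfc := hl.continuous
    have h0 : ∀ y, |f y| ≤ B + |f 0| := fun y => by
      have h1 := hB y 0
      rw [Real.dist_eq] at h1
      have h2 : |f y| ≤ |f y - f 0| + |f 0| := by simpa using abs_add_le (f y - f 0) (f 0)
      linarith
    have e1 : ∫ y, f y ∂(P : Measure E) = ∫ x, f (Y x) ∂μ :=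
      integral_map hYm hfc.aestronglyMeasurable
    have e2 : ∫ y, f y ∂(Q : Measure E) = ∫ x, f (X x T) ∂μ :=
      integral_map hXT.aemeasurable hfc.aestronglyMeasurable
    have l1 := hX.tendsto_integral_flow hv (ψ := f) (l := l) (B := B + |f 0|)
      (fun x y => by
        have := hl.dist_le_mul x y
        rwa [Real.dist_eq, dist_eq_norm] at this) h0 hT.1 hT.2
    have l2 : Tendsto (fun n => ∫ x, f (flow (cutoffField v n) 0 (X x 0) T) ∂μ) atTop
        (𝓝 (∫ x, f (Y x) ∂μ)) := by
      refine tendsto_integral_of_dominated_convergence (fun _ => B + |f 0|) (fun n => ?_)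
        (integrable_const _) (fun n => ae_of_all _ fun x => h0 _) ?_
      · obtain ⟨M, L, hw⟩ := exists_isLipField_cutoffField hX.meas_v hv n
        have := (continuous_uncurry_flow hw 0).measurable.comp
          ((hX.measurable_at 0).prodMk (measurable_const (a := T)))
        exact (hfc.measurable.comp this).aestronglyMeasurable
      · filter_upwards [hY] with x hx
        exact tendsto_const_nhds.congr' (hx.mono fun n hn => by beta_reduce; rw [hn])
    rw [e1, e2, tendsto_nhds_unique l1 l2]
    exact tendsto_const_nhds
  have := tendsto_nhds_unique h tendsto_const_nhds
  exact congrArg Subtype.val this.symm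

end HasMeanVelocity

end Euclidean

/-! ### Absolutely continuous trajectories -/

variable {d : ℕ}

lemma intervalIntegrable_of_memLp_time {F : Type*} [NormedAddCommGroup F] {m : ℝ → F}
    (hm : MemLp m 2 time) : IntervalIntegrable m volume 0 1 := by
  rw [intervalIntegrable_iff_integrableOn_Icc_of_le zero_le_one]
  exact hm.integrable (by norm_num)

lemma absolutelyContinuousOnInterval_coord {γ : ℝ → Sp d} (hγ : IsAC2 edist γ) (i : Fin d) :
    AbsolutelyContinuousOnInterval (fun t => γ t i) 0 1 := by
  obtain ⟨m, hm, h⟩ := hγ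
  have hmi := intervalIntegrable_of_memLp_time hm
  have hM := hmi.absolutelyContinuousOnInterval_intervalIntegral (c := 0) (by simp)
  rw [absolutelyContinuousOnInterval_iff] at hM ⊢
  have hle : ∀ s t, s ∈ Icc (0 : ℝ) 1 → t ∈ Icc (0 : ℝ) 1 → s ≤ t →
      dist (γ s i) (γ t i) ≤ dist (∫ r in (0 : ℝ)..s, m r) (∫ r in (0 : ℝ)..t, m r) := by
    intro s t hs ht hst
    have h1 : IntervalIntegrable m volume 0 s := hmi.mono_set (by
      rw [uIcc_of_le hs.1, uIcc_of_le zero_le_one]; exact Icc_subset_Icc_right hs.2)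
    have h2 : IntervalIntegrable m volume 0 t := hmi.mono_set (by
      rw [uIcc_of_le ht.1, uIcc_of_le zero_le_one]; exact Icc_subset_Icc_right ht.2)
    rw [dist_comm (∫ r in (0 : ℝ)..s, m r), Real.dist_eq (∫ r in (0 : ℝ)..t, m r),
      intervalIntegral.integral_interval_sub_left h2 h1]
    have h3 : dist (γ s i) (γ t i) ≤ dist (γ s) (γ t) := by
      rw [dist_eq_norm, dist_eq_norm, ← PiLp.sub_apply]
      exact PiLp.norm_apply_le _ i
    have h4 := h s t hs.1 hst ht.2
    rw [edist_dist] at h4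
    rcases le_or_gt 0 (∫ r in s..t, m r) with h0 | h0
    · rw [ENNReal.ofReal_le_ofReal_iff h0] at h4
      exact h3.trans (h4.trans (le_abs_self _))
    · rw [ENNReal.ofReal_of_nonpos h0.le, nonpos_iff_eq_zero, ENNReal.ofReal_eq_zero] at h4
      exact h3.trans (h4.trans (abs_nonneg _))
  have hle' : ∀ s t, s ∈ uIcc (0 : ℝ) 1 → t ∈ uIcc (0 : ℝ) 1 →
      dist (γ s i) (γ t i) ≤ dist (∫ r in (0 : ℝ)..s, m r) (∫ r in (0 : ℝ)..t, m r) := by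
    intro s t hs ht
    rw [uIcc_of_le zero_le_one] at hs ht
    rcases le_total s t with hst | hst
    · exact hle s t hs ht hst
    · rw [dist_comm, dist_comm (∫ r in (0 : ℝ)..s, m r)]
      exact hle t s ht hs hst
  intro ε hε
  obtain ⟨δ, hδ, H⟩ := hM ε hε
  refine ⟨δ, hδ, fun I hI hIδ => lt_of_le_of_lt (Finset.sum_le_sum fun k hk => ?_) (H I hI hIδ)⟩
  exact hle' _ _ (hI.1 k hk).1 (hI.1 k hk).2

/-- The fundamental theorem of calculus for curves in `AC²(0,1; ℝ^d)`. -/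
lemma IsAC2.integral_deriv {γ : ℝ → Sp d} (hγ : IsAC2 edist γ) :
    IntervalIntegrable (deriv γ) volume 0 1 ∧
      ∀ t ∈ Icc (0 : ℝ) 1, γ t = γ 0 + ∫ r in (0 : ℝ)..t, deriv γ r := by
  have hac := absolutelyContinuousOnInterval_coord hγ
  have hd : ∀ᵐ t, t ∈ Icc (0 : ℝ) 1 → ∀ i, deriv γ t i = deriv (fun s => γ s i) t := by
    filter_upwards [ae_all_iff.2 fun i => (hac i).ae_differentiableAt] with t ht htI i
    have h1 : DifferentiableAt ℝ γ t := by
      rw [differentiableAt_euclidean]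
      intro j
      exact ht j (by rwa [uIcc_of_le zero_le_one])
    exact ((EuclideanSpace.proj (𝕜 := ℝ) i).hasFDerivAt.comp_hasDerivAt t h1.hasDerivAt).deriv.symm
  have hcoord : ∀ i, IntegrableOn (fun t => deriv γ t i) (Icc (0 : ℝ) 1) := fun i => by
    have h1 := (intervalIntegrable_iff_integrableOn_Icc_of_le zero_le_one).1
      (hac i).intervalIntegrable_deriv
    refine h1.congr ((ae_restrict_iff' measurableSet_Icc).2 ?_)
    filter_upwards [hd] with t ht htI using (ht htI i).symm
  have hint : IntervalIntegrable (deriv γ) volume 0 1 := by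
    rw [intervalIntegrable_iff_integrableOn_Icc_of_le zero_le_one]
    exact integrable_piLp_iff.2 hcoord
  refine ⟨hint, fun t ht => ?_⟩
  have hsub : uIcc (0 : ℝ) t ⊆ uIcc 0 1 := by
    rw [uIcc_of_le ht.1, uIcc_of_le zero_le_one]; exact Icc_subset_Icc_right ht.2
  ext i
  have h1 := ((hac i).mono hsub).integral_deriv_eq_sub
  have h2 : (∫ r in (0 : ℝ)..t, deriv γ r) i = ∫ r in (0 : ℝ)..t, deriv γ r i :=
    ((EuclideanSpace.proj (𝕜 := ℝ) i).intervalIntegral_comp_comm (hint.mono_set hsub)).symm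
  have h3 : ∫ r in (0 : ℝ)..t, deriv γ r i = ∫ r in (0 : ℝ)..t, deriv (fun s => γ s i) r := by
    refine intervalIntegral.integral_congr_ae ?_
    filter_upwards [hd] with r hr hrI
    rw [uIoc_of_le ht.1] at hrI
    exact hr ⟨hrI.1.le, hrI.2.trans ht.2⟩ i
  rw [PiLp.add_apply, h2, h3, h1]
  ring

/-! ### A jointly measurable version of a family of trajectories -/

variable {μ : Measure (Sp d)} [IsProbabilityMeasure μ] {X : Sp d → ℝ → Sp d}

/-- The family of trajectories that start from the identity and have velocities `A`. -/
def primitive (A : Sp d → ℝ → Sp d) (x : Sp d) (t : ℝ) : Sp d :=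
  x + ∫ r, (Ioc (0 : ℝ) t).indicator (A x) r

lemma primitive_eq (A : Sp d → ℝ → Sp d) (x : Sp d) {t : ℝ} (ht : 0 ≤ t) :
    primitive A x t = x + ∫ r in (0 : ℝ)..t, A x r := by
  rw [primitive, integral_indicator measurableSet_Ioc, intervalIntegral.integral_of_le ht]

lemma primitive_zero (A : Sp d → ℝ → Sp d) (x : Sp d) : primitive A x 0 = x := by
  simp [primitive]

lemma measurable_primitive {A : Sp d → ℝ → Sp d} (hA : Measurable (Function.uncurry A)) :
    Measurable (Function.uncurry (primitive A)) := by
  have hs : MeasurableSet {q : (Sp d × ℝ) × ℝ | 0 < q.2 ∧ q.2 ≤ q.1.2} :=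
    (measurableSet_lt measurable_const measurable_snd).inter
      (measurableSet_le measurable_snd (measurable_snd.comp measurable_fst))
  have h1 : Measurable fun q : (Sp d × ℝ) × ℝ => A q.1.1 q.2 :=
    hA.comp ((measurable_fst.comp measurable_fst).prodMk measurable_snd)
  have h2 := (h1.indicator hs).stronglyMeasurable.integral_prod_right' (ν := volume)
  exact measurable_fst.add h2.measurable

/-- A map in `C_X` is, up to null sets, the primitive of a Borel field of velocities. -/
lemma MemCX.exists_primitive (hX : MemCX μ X) : ∃ A : Sp d → ℝ → Sp d,
    Measurable (Function.uncurry A) ∧ MemLp (fun p : Sp d × ℝ => A p.1 p.2) 2 (μ.prod time) ∧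
    (∀ᵐ x ∂μ, ∀ t ∈ Icc (0 : ℝ) 1, X x t = primitive A x t) ∧
    ∀ᵐ p ∂(μ.prod time), dt X p.1 p.2 = A p.1 p.2 := by
  have hs := hX.memLp_dt.1
  let A : Sp d → ℝ → Sp d := fun x t => hs.mk _ (x, t)
  have hAm : Measurable (Function.uncurry A) := hs.stronglyMeasurable_mk.measurable
  have hae : ∀ᵐ p ∂(μ.prod time), dt X p.1 p.2 = A p.1 p.2 := hs.ae_eq_mk
  refine ⟨A, hAm, (memLp_congr_ae hae).1 hX.memLp_dt, ?_, hae⟩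
  filter_upwards [hX.ac, hX.start, Measure.ae_ae_of_ae_prod hae] with x hac h0 hx t ht
  rw [hac.integral_deriv.2 t ht, h0, primitive_eq A x ht.1]
  congr 1
  refine intervalIntegral.integral_congr_ae ?_
  rw [ae_restrict_iff' measurableSet_Icc] at hx
  filter_upwards [hx] with r hr hrI
  rw [uIoc_of_le ht.1] at hrI
  exact hr ⟨hrI.1.le, hrI.2.trans ht.2⟩

lemma ae_prod_time_of_forall {p : Sp d → ℝ → Prop}
    (h : ∀ᵐ x ∂μ, ∀ t ∈ Icc (0 : ℝ) 1, p x t) : ∀ᵐ q ∂(μ.prod time), p q.1 q.2 := by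
  have h1 := Measure.quasiMeasurePreserving_fst (μ := μ) (ν := time).ae h
  have h2 := Measure.quasiMeasurePreserving_snd (μ := μ) (ν := time).ae
    (ae_restrict_mem measurableSet_Icc)
  filter_upwards [h1, h2] with q hq1 hq2 using hq1 _ hq2

/-! ### The flow-matching regression as an orthogonal projection -/

section Regression

variable {Ω : Type*} [MeasurableSpace Ω] {P : Measure Ω} {F : Type*} [MeasurableSpace F]
  {E : Type*} [NormedAddCommGroup E] [InnerProductSpace ℝ E] [FiniteDimensional ℝ E]
  [MeasurableSpace E] [BorelSpace E]

lemma lintegral_enorm_sq_eq {f : Ω → E} : ∫⁻ p, ‖f p‖ₑ ^ 2 ∂P = eLpNorm f 2 P ^ 2 := by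
  have := eLpNorm_nnreal_pow_eq_lintegral (μ := P) (f := f) (p := 2) (by norm_num)
  simpa using this.symm

lemma lintegral_enorm_sq_le_iff {f g : Ω → E} :
    ∫⁻ p, ‖f p‖ₑ ^ 2 ∂P ≤ ∫⁻ p, ‖g p‖ₑ ^ 2 ∂P ↔ eLpNorm f 2 P ≤ eLpNorm g 2 P := by
  rw [lintegral_enorm_sq_eq, lintegral_enorm_sq_eq, ENNReal.pow_le_pow_left_iff (by norm_num)]

/-- Among all functions of `Φ`, some `v ∘ Φ` is closest to `A` in `L²`. -/
lemma exists_forall_eLpNorm_comp_sub_le {Φ : Ω → F} (hΦ : Measurable Φ) {A : Ω → E}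
    (hA : MemLp A 2 P) : ∃ v : F → E, Measurable v ∧ ∀ w : F → E, Measurable w →
      eLpNorm (fun p => v (Φ p) - A p) 2 P ≤ eLpNorm (fun p => w (Φ p) - A p) 2 P := by
  have hmp : MeasurePreserving Φ P (P.map Φ) := ⟨hΦ, rfl⟩
  let T := Lp.compMeasurePreservingₗᵢ ℝ (E := E) (p := 2) Φ hmp
  have hK : IsComplete
      ((LinearMap.range T.toLinearMap : Submodule ℝ (Lp E 2 P)) : Set (Lp E 2 P)) := by
    rw [LinearMap.coe_range]
    exact T.isometry.isUniformInducing.isComplete_range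
  obtain ⟨b, hbK, hb⟩ := Submodule.exists_norm_eq_iInf_of_complete_subspace _ hK (hA.toLp A)
  obtain ⟨g, rfl⟩ := hbK
  refine ⟨g, (Lp.stronglyMeasurable g).measurable, fun w hw => ?_⟩
  by_cases hfin : eLpNorm (fun p => w (Φ p) - A p) 2 P = ⊤
  · rw [hfin]; exact le_top
  have hwm : AEStronglyMeasurable (fun p => w (Φ p)) P := (hw.comp hΦ).aestronglyMeasurable
  have h1 : MemLp (fun p => w (Φ p) - A p) 2 P := ⟨hwm.sub hA.1, lt_top_iff_ne_top.2 hfin⟩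
  have h2 : MemLp (fun p => w (Φ p)) 2 P := by
    refine (h1.add hA).ae_eq (ae_of_all _ fun p => ?_)
    simp
  have h3 : MemLp w 2 (P.map Φ) := (memLp_map_measure_iff hw.aestronglyMeasurable
    hΦ.aemeasurable).2 h2
  have hle : ‖hA.toLp A - T g‖ ≤ ‖hA.toLp A - T (h3.toLp w)‖ := by
    change ‖hA.toLp A - T.toLinearMap g‖ ≤ _
    rw [hb]
    exact ciInf_le ⟨0, by rintro _ ⟨y, rfl⟩; exact norm_nonneg _⟩
      (⟨T (h3.toLp w), LinearMap.mem_range_self T.toLinearMap _⟩ :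
        (LinearMap.range T.toLinearMap : Submodule ℝ (Lp E 2 P)))
  have key : ∀ (u : Lp E 2 (P.map Φ)) (f : F → E), u =ᵐ[P.map Φ] f →
      eLpNorm (fun p => f (Φ p) - A p) 2 P = ‖hA.toLp A - T u‖ₑ := by
    intro u f huf
    rw [← enorm_neg, neg_sub, Lp.enorm_def]
    refine eLpNorm_congr_ae ?_
    have e1 : (T u : Ω → E) =ᵐ[P] u ∘ Φ := Lp.coeFn_compMeasurePreserving u hmp
    have e2 := hmp.quasiMeasurePreserving.ae_eq_comp huf
    filter_upwards [Lp.coeFn_sub (T u) (hA.toLp A), e1, e2, hA.coeFn_toLp] with p q1 q2 q3 q4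
    rw [q1, Pi.sub_apply, q2, q3, q4, Function.comp_apply]
  rw [key g g EventuallyEq.rfl, key _ w h3.coeFn_toLp]
  exact enorm_le_iff_norm_le.2 hle

/-- The residual of a best approximation is orthogonal to all square-integrable functions of `Φ`. -/
lemma integral_inner_eq_zero_of_forall_eLpNorm_le {Φ : Ω → F} {A : Ω → E}
    (hA : MemLp A 2 P) {v : F → E} (hv : Measurable v) (hvΦ : MemLp (fun p => v (Φ p)) 2 P)
    (hmin : ∀ w : F → E, Measurable w →
      eLpNorm (fun p => v (Φ p) - A p) 2 P ≤ eLpNorm (fun p => w (Φ p) - A p) 2 P)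
    {φ : F → E} (hφ : Measurable φ) (hφΦ : MemLp (fun p => φ (Φ p)) 2 P) :
    ∫ p, ⟪φ (Φ p), A p - v (Φ p)⟫ ∂P = 0 := by
  set r : Lp E 2 P := (hA.sub hvΦ).toLp _ with hr
  set f : Lp E 2 P := hφΦ.toLp _ with hf
  have h1 : ∀ c : ℝ, ‖r‖ ≤ ‖r - c • f‖ := fun c => by
    have h2 := hmin (fun y => v y + c • φ y) (hv.add (hφ.const_smul c))
    have e1 : eLpNorm (fun p => v (Φ p) - A p) 2 P = ‖r‖ₑ := by
      rw [Lp.enorm_def, ← eLpNorm_neg]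
      refine eLpNorm_congr_ae ?_
      filter_upwards [(hA.sub hvΦ).coeFn_toLp] with p hp
      rw [hp]; simp
    have e2 : eLpNorm (fun p => v (Φ p) + c • φ (Φ p) - A p) 2 P = ‖r - c • f‖ₑ := by
      rw [Lp.enorm_def, ← eLpNorm_neg]
      refine eLpNorm_congr_ae ?_
      filter_upwards [(hA.sub hvΦ).coeFn_toLp, hφΦ.coeFn_toLp, Lp.coeFn_sub r (c • f),
        Lp.coeFn_smul c f] with p q1 q2 q3 q4
      rw [q3, Pi.sub_apply, q4, Pi.smul_apply, q1, q2]
      simp only [Pi.neg_apply, Pi.sub_apply]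
      abel
    rw [e1, e2] at h2
    exact enorm_le_iff_norm_le.1 h2
  -- the quadratic polynomial `c ↦ ‖r - c f‖²` has its minimum at `0`
  have h3 : ⟪f, r⟫ = 0 := by
    have h4 : ∀ c : ℝ, 0 ≤ c ^ 2 * ‖f‖ ^ 2 - 2 * c * ⟪f, r⟫ := fun c => by
      have := pow_le_pow_left₀ (norm_nonneg _) (h1 c) 2
      rw [norm_sub_sq_real, inner_smul_right, norm_smul, mul_pow, Real.norm_eq_abs, sq_abs,
        real_inner_comm] at this
      linarith
    by_contra h0
    have h5 := h4 (⟪f, r⟫ / (‖f‖ ^ 2 + 1))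
    have h6 : 0 < ‖f‖ ^ 2 + 1 := by positivity
    have h7 : 0 < ⟪f, r⟫ ^ 2 := by positivity
    have h8 : (⟪f, r⟫ / (‖f‖ ^ 2 + 1)) ^ 2 * ‖f‖ ^ 2 - 2 * (⟪f, r⟫ / (‖f‖ ^ 2 + 1)) * ⟪f, r⟫ =
        -(⟪f, r⟫ ^ 2 * (‖f‖ ^ 2 + 2)) / (‖f‖ ^ 2 + 1) ^ 2 := by
      field_simp
      ring
    rw [h8, div_nonneg_iff] at h5
    rcases h5 with h5 | h5
    · nlinarith [h5.1, sq_nonneg ‖f‖, mul_pos h7 h6]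
    · nlinarith [h5.2, pow_pos h6 2]
  rw [L2.inner_def] at h3
  rw [← h3]
  refine integral_congr_ae ?_
  filter_upwards [(hA.sub hvΦ).coeFn_toLp, hφΦ.coeFn_toLp] with p q1 q2
  rw [q1, q2]
  rfl

end Regression

/-! ### Minkowski's integral inequality -/

lemma sq_rpow_half (a : ℝ≥0∞) : (a ^ 2) ^ (1 / 2 : ℝ) = a := by
  rw [← ENNReal.rpow_natCast, ← ENNReal.rpow_mul]
  norm_num

lemma rpow_half_sq (a : ℝ≥0∞) : (a ^ (1 / 2 : ℝ)) ^ 2 = a := by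
  rw [← ENNReal.rpow_natCast, ← ENNReal.rpow_mul]
  norm_num

lemma lintegral_mul_le_sq {α : Type*} [MeasurableSpace α] {μ : Measure α} {f g : α → ℝ≥0∞}
    (hf : Measurable f) (hg : Measurable g) : ∫⁻ x, f x * g x ∂μ ≤
      (∫⁻ x, f x ^ 2 ∂μ) ^ (1 / 2 : ℝ) * (∫⁻ x, g x ^ 2 ∂μ) ^ (1 / 2 : ℝ) := by
  simpa using ENNReal.lintegral_mul_le_Lp_mul_Lq μ (p := 2) (q := 2)
    (by constructor <;> norm_num) hf.aemeasurable hg.aemeasurable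

/-- Minkowski's integral inequality in `L²`, for a second measure of mass at most `1`. -/
lemma lintegral_sq_lintegral_le {α β : Type*} [MeasurableSpace α] [MeasurableSpace β]
    {μ : Measure α} {ν : Measure β} [SFinite μ] [SFinite ν] (hν : ν univ ≤ 1)
    {f : α → β → ℝ≥0∞} (hf : Measurable fun p : α × β => f p.1 p.2)
    (hfin : ∫⁻ p, f p.1 p.2 ^ 2 ∂(μ.prod ν) ≠ ⊤) :
    (∫⁻ x, (∫⁻ r, f x r ∂ν) ^ 2 ∂μ) ^ (1 / 2 : ℝ) ≤
      ∫⁻ r, (∫⁻ x, f x r ^ 2 ∂μ) ^ (1 / 2 : ℝ) ∂ν := by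
  have hfl : ∀ x, Measurable (f x) := fun x => hf.comp measurable_prodMk_left
  have hfr : ∀ r, Measurable fun x => f x r := fun r => hf.comp measurable_prodMk_right
  let g : α → ℝ≥0∞ := fun x => ∫⁻ r, f x r ∂ν
  have hg : Measurable g := hf.lintegral_prod_right'
  set N : ℝ≥0∞ := (∫⁻ x, g x ^ 2 ∂μ) ^ (1 / 2 : ℝ) with hN
  have hN2 : N ^ 2 = ∫⁻ x, g x ^ 2 ∂μ := rpow_half_sq _
  have hNfin : N ≠ ⊤ := by
    have h1 : ∀ x, g x ^ 2 ≤ ∫⁻ r, f x r ^ 2 ∂ν := fun x => by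
      have h2 := lintegral_mul_le_sq (μ := ν) (hfl x) (measurable_const (a := (1 : ℝ≥0∞)))
      simp only [mul_one, one_pow, lintegral_const, one_mul] at h2
      have h3 := h2.trans (mul_le_of_le_one_right' (ENNReal.rpow_le_one hν (by norm_num)))
      calc g x ^ 2 ≤ ((∫⁻ r, f x r ^ 2 ∂ν) ^ (1 / 2 : ℝ)) ^ 2 := by gcongr
        _ = _ := rpow_half_sq _
    intro h
    rw [h] at hN2
    refine hfin (top_unique ?_)
    rw [lintegral_prod _ (hf.pow_const 2).aemeasurable]
    calc (⊤ : ℝ≥0∞) = ∫⁻ x, g x ^ 2 ∂μ := by rw [← hN2]; simp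
      _ ≤ _ := lintegral_mono h1
  rcases eq_or_ne N 0 with h0 | h0
  · rw [h0]; exact zero_le
  -- `N² = ∫∫ g f`, estimated by the Cauchy-Schwarz inequality in the first variable
  have h6 : N * N ≤ N * ∫⁻ r, (∫⁻ x, f x r ^ 2 ∂μ) ^ (1 / 2 : ℝ) ∂ν := by
    calc N * N = ∫⁻ x, ∫⁻ r, g x * f x r ∂ν ∂μ := by
          rw [← sq, hN2]
          refine lintegral_congr fun x => ?_
          rw [lintegral_const_mul _ (hfl x), sq]
      _ = ∫⁻ r, ∫⁻ x, g x * f x r ∂μ ∂ν :=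
          lintegral_lintegral_swap ((hg.comp measurable_fst).mul hf).aemeasurable
      _ ≤ ∫⁻ r, N * (∫⁻ x, f x r ^ 2 ∂μ) ^ (1 / 2 : ℝ) ∂ν :=
          lintegral_mono fun r => lintegral_mul_le_sq hg (hfr r)
      _ = _ := lintegral_const_mul' _ _ hNfin
  exact (ENNReal.mul_le_mul_iff_right h0 hNfin).1 h6

lemma lt_top_of_sq_lt_top {a : ℝ≥0∞} (h : a ^ 2 < ⊤) : a < ⊤ := by
  rw [lt_top_iff_ne_top]
  rintro rfl
  simp at h

lemma integrable_inner_of_memLp {Ω : Type*} [MeasurableSpace Ω] {P : Measure Ω} {f g : Ω → Sp d}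
    (hf : MemLp f 2 P) (hg : MemLp g 2 P) : Integrable (fun p => ⟪f p, g p⟫) P :=
  Integrable.mono' (hf.norm.integrable_mul hg.norm) (AEStronglyMeasurable.inner (𝕜 := ℝ) hf.1 hg.1)
    (ae_of_all _ fun _ => norm_inner_le_norm _ _)

/-! ### Velocities of a family of trajectories -/

/-- `A` is a Borel field of velocities of the trajectories `X`: up to null sets, `X` is the
primitive of `A`, and `A` is the time derivative of `X`. -/
structure IsVelocity (μ : Measure (Sp d)) (X A : Sp d → ℝ → Sp d) : Prop where
  meas : Measurable (Function.uncurry A)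
  memLp : MemLp (fun p : Sp d × ℝ => A p.1 p.2) 2 (μ.prod time)
  eq_primitive : ∀ᵐ x ∂μ, ∀ t ∈ Icc (0 : ℝ) 1, X x t = primitive A x t
  dt_eq : ∀ᵐ p ∂(μ.prod time), dt X p.1 p.2 = A p.1 p.2

namespace IsVelocity

variable {A : Sp d → ℝ → Sp d}

lemma meas_primitive (hA : IsVelocity μ X A) :
    Measurable fun p : Sp d × ℝ => primitive A p.1 p.2 := measurable_primitive hA.meas

lemma ae_eq_at (hA : IsVelocity μ X A) {t : ℝ} (ht : t ∈ Icc (0 : ℝ) 1) :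
    (fun x => X x t) =ᵐ[μ] fun x => primitive A x t := by
  filter_upwards [hA.eq_primitive] with x hx using hx t ht

lemma ae_eq_prod (hA : IsVelocity μ X A) :
    ∀ᵐ p ∂(μ.prod time), X p.1 p.2 = primitive A p.1 p.2 := ae_prod_time_of_forall hA.eq_primitive

lemma measurable_at (hA : IsVelocity μ X A) (t : ℝ) : Measurable fun x => primitive A x t :=
  hA.meas_primitive.comp (measurable_id.prodMk measurable_const)

/-! ### Solutions of the flow-matching regression -/

lemma fmLoss_eq (hA : IsVelocity μ X A) {v : Sp d → ℝ → Sp d}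
    (hv : Measurable (Function.uncurry v)) : fmLoss μ X v =
      ∫⁻ p, ‖Function.uncurry v (primitive A p.1 p.2, p.2) - A p.1 p.2‖ₑ ^ 2 ∂(μ.prod time) := by
  have hm : Measurable fun p : Sp d × ℝ =>
      ‖Function.uncurry v (primitive A p.1 p.2, p.2) - A p.1 p.2‖ₑ ^ 2 :=
    ((hv.comp (hA.meas_primitive.prodMk measurable_snd)).sub hA.meas).enorm.pow_const 2
  rw [fmLoss, lintegral_prod_symm _ hm.aemeasurable]
  have h1 := Measure.ae_ae_of_ae_prod ((Measure.measurePreserving_swap (μ := time)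
    (ν := μ)).quasiMeasurePreserving.ae (hA.ae_eq_prod.and hA.dt_eq))
  refine lintegral_congr_ae ?_
  filter_upwards [h1] with t ht
  refine lintegral_congr_ae ?_
  filter_upwards [ht] with x hx
  simp only [Prod.fst_swap, Prod.snd_swap] at hx
  rw [hx.1, hx.2, Function.uncurry_apply_pair]

lemma isFlowMatching_iff (hA : IsVelocity μ X A) {v : Sp d → ℝ → Sp d} : IsFlowMatching μ X v ↔
    Measurable (Function.uncurry v) ∧ ∀ w : Sp d × ℝ → Sp d, Measurable w →
      eLpNorm (fun p : Sp d × ℝ => Function.uncurry v (primitive A p.1 p.2, p.2) - A p.1 p.2) 2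
        (μ.prod time) ≤
      eLpNorm (fun p : Sp d × ℝ => w (primitive A p.1 p.2, p.2) - A p.1 p.2) 2 (μ.prod time) := by
  refine and_congr_right fun hv => ⟨fun h w hw => ?_, fun h w hw => ?_⟩
  · have h1 := h (Function.curry w) (by simpa using hw)
    rw [hA.fmLoss_eq hv, hA.fmLoss_eq (by simpa using hw), lintegral_enorm_sq_le_iff,
      Function.uncurry_curry] at h1
    exact h1
  · rw [hA.fmLoss_eq hv, hA.fmLoss_eq hw, lintegral_enorm_sq_le_iff]
    exact h _ hw

lemma exists_isFlowMatching (hA : IsVelocity μ X A) :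
    ∃ v : Sp d → ℝ → Sp d, IsFlowMatching μ X v := by
  obtain ⟨v, hv, h⟩ := exists_forall_eLpNorm_comp_sub_le
    (hA.meas_primitive.prodMk measurable_snd) hA.memLp
  refine ⟨Function.curry v, hA.isFlowMatching_iff.2 ?_⟩
  rw [Function.uncurry_curry]
  exact ⟨hv, h⟩

variable {v w : Sp d → ℝ → Sp d}

lemma memLp_isFlowMatching (hA : IsVelocity μ X A) (hv : IsFlowMatching μ X v) :
    MemLp (fun p : Sp d × ℝ => v (primitive A p.1 p.2) p.2) 2 (μ.prod time) := by
  obtain ⟨hm, h⟩ := hA.isFlowMatching_iff.1 hv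
  have h0 := h 0 measurable_zero
  have h1 : eLpNorm (fun p : Sp d × ℝ => (0 : Sp d × ℝ → Sp d) (primitive A p.1 p.2, p.2) -
      A p.1 p.2) 2 (μ.prod time) < ⊤ := by
    simp only [Pi.zero_apply, zero_sub]
    exact hA.memLp.neg.2
  have hvm := hm.comp (hA.meas_primitive.prodMk measurable_snd)
  have h2 : MemLp (fun p : Sp d × ℝ => Function.uncurry v (primitive A p.1 p.2, p.2) - A p.1 p.2) 2
      (μ.prod time) := ⟨(hvm.sub hA.meas).aestronglyMeasurable, h0.trans_lt h1⟩
  refine (h2.add hA.memLp).ae_eq (ae_of_all _ fun p => ?_)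
  exact sub_add_cancel _ _

/-- The normal equations of the regression. -/
lemma integral_inner_isFlowMatching (hA : IsVelocity μ X A) (hv : IsFlowMatching μ X v)
    {φ : Sp d → ℝ → Sp d} (hφ : Measurable (Function.uncurry φ))
    (hφ2 : MemLp (fun p : Sp d × ℝ => φ (primitive A p.1 p.2) p.2) 2 (μ.prod time)) :
    ∫ p, ⟪φ (primitive A p.1 p.2) p.2, A p.1 p.2 - v (primitive A p.1 p.2) p.2⟫ ∂(μ.prod time) =
      0 := by
  obtain ⟨hm, h⟩ := hA.isFlowMatching_iff.1 hv
  exact integral_inner_eq_zero_of_forall_eLpNorm_le (P := μ.prod time)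
    (Φ := fun p : Sp d × ℝ => (primitive A p.1 p.2, p.2))
    hA.memLp hm (hA.memLp_isFlowMatching hv) h hφ hφ2

lemma hasMeanVelocity (hA : IsVelocity μ X A) (hv : IsFlowMatching μ X v) :
    HasMeanVelocity μ (primitive A) A v where
  meas_X := hA.meas_primitive
  meas_v := hv.1
  memLp_A := hA.memLp
  integrable_v := (hA.memLp_isFlowMatching hv).integrable (by norm_num)
  traj := ae_of_all _ fun x t ht => by rw [primitive_zero, primitive_eq A x ht.1]
  orth := fun φ hφ ⟨C, hC⟩ => hA.integral_inner_isFlowMatching hv hφ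
    (MemLp.of_bound (hφ.comp (hA.meas_primitive.prodMk measurable_snd)).aestronglyMeasurable C
      (ae_of_all _ fun p => hC _ _))

lemma integral_norm_sq_isFlowMatching (hA : IsVelocity μ X A) (hv : IsFlowMatching μ X v) :
    ∫ p, ‖v (primitive A p.1 p.2) p.2‖ ^ 2 ∂(μ.prod time) ≤
      ∫ p, ‖A p.1 p.2‖ ^ 2 ∂(μ.prod time) := by
  have hv2 := hA.memLp_isFlowMatching hv
  have h1 := hA.integral_inner_isFlowMatching hv hv.1 hv2
  have h2 : Integrable (fun p : Sp d × ℝ => ⟪v (primitive A p.1 p.2) p.2,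
      A p.1 p.2 - v (primitive A p.1 p.2) p.2⟫) (μ.prod time) := integrable_inner_of_memLp hv2
        (hA.memLp.sub hv2)
  have h3 := hv2.integrable_norm_pow (p := 2) (by norm_num)
  have h4 := hA.memLp.integrable_norm_pow (p := 2) (by norm_num)
  -- integrate the inequality `‖v‖² + 2⟨v, A - v⟩ ≤ ‖A‖²`
  have h5 : ∫ p, (‖v (primitive A p.1 p.2) p.2‖ ^ 2 + 2 * ⟪v (primitive A p.1 p.2) p.2,
      A p.1 p.2 - v (primitive A p.1 p.2) p.2⟫) ∂(μ.prod time) ≤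
      ∫ p, ‖A p.1 p.2‖ ^ 2 ∂(μ.prod time) := by
    refine integral_mono (h3.add (h2.const_mul 2)) h4 fun p => ?_
    have : A p.1 p.2 = v (primitive A p.1 p.2) p.2 +
      (A p.1 p.2 - v (primitive A p.1 p.2) p.2) := by abel
    beta_reduce
    conv_rhs => rw [this, norm_add_sq_real]
    exact le_add_of_nonneg_right (sq_nonneg _)
  rw [integral_add h3 (h2.const_mul 2), integral_const_mul, h1] at h5
  linarith

lemma ae_eq_of_isFlowMatching (hA : IsVelocity μ X A) (hv : IsFlowMatching μ X v)
    (hw : IsFlowMatching μ X w) :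
    ∀ᵐ t ∂time, ∀ᵐ y ∂(μ.map (fun x => X x t)), v y t = w y t := by
  have hv2 := hA.memLp_isFlowMatching hv
  have hw2 := hA.memLp_isFlowMatching hw
  have hφ : Measurable (Function.uncurry fun y t => v y t - w y t) := hv.1.sub hw.1
  have h1 := hA.integral_inner_isFlowMatching hv hφ (hv2.sub hw2)
  have h2 := hA.integral_inner_isFlowMatching hw hφ (hv2.sub hw2)
  -- the difference of the two normal equations, tested with the difference of the solutions
  have h3 : ∫ p, ‖v (primitive A p.1 p.2) p.2 - w (primitive A p.1 p.2) p.2‖ ^ 2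
      ∂(μ.prod time) = 0 := by
    have h4 := integrable_inner_of_memLp (hv2.sub hw2) (hA.memLp.sub hv2)
    have h5 := integrable_inner_of_memLp (hv2.sub hw2) (hA.memLp.sub hw2)
    rw [← sub_self (0 : ℝ)]
    nth_rewrite 1 [← h2]
    rw [← h1, ← integral_sub (by exact h5) (by exact h4)]
    refine integral_congr_ae (ae_of_all _ fun p => ?_)
    beta_reduce
    rw [← inner_sub_right, sub_sub_sub_cancel_left, real_inner_self_eq_norm_sq]
  rw [integral_eq_zero_iff_of_nonneg (fun p => sq_nonneg _)
    (by exact (hv2.sub hw2).integrable_norm_pow (p := 2) (by norm_num))] at h3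
  have h6 := Measure.ae_ae_of_ae_prod ((Measure.measurePreserving_swap (μ := time)
    (ν := μ)).quasiMeasurePreserving.ae h3)
  filter_upwards [h6, ae_restrict_mem measurableSet_Icc] with t ht htI
  rw [Measure.map_congr (hA.ae_eq_at htI)]
  have hvt : Measurable fun y => v y t := hv.1.comp (measurable_id.prodMk measurable_const)
  have hwt : Measurable fun y => w y t := hw.1.comp (measurable_id.prodMk measurable_const)
  rw [ae_map_iff (hA.measurable_at t).aemeasurable (measurableSet_eq_fun hvt hwt)]
  filter_upwards [ht] with x hx
  simpa [sub_eq_zero] using hx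

/-! ### The curve of laws is absolutely continuous -/

lemma eLpNorm_integral_le (hA : IsVelocity μ X A) {s t : ℝ} (hs : 0 ≤ s) (hst : s ≤ t)
    (ht : t ≤ 1) : eLpNorm (fun x => ∫ r in s..t, A x r) 2 μ ≤
      ∫⁻ r in Ioc s t, eLpNorm (fun x => A x r) 2 μ := by
  set τ : Measure ℝ := volume.restrict (Ioc s t) with hτ
  have hf : Measurable fun p : Sp d × ℝ => ‖A p.1 p.2‖ₑ := hA.meas.enorm
  have hτP : μ.prod τ ≤ μ.prod time := by
    rw [hτ, prod_time_restrict hs ht]; exact Measure.restrict_le_self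
  have hτ1 : τ univ ≤ 1 := by
    rw [hτ, Measure.restrict_apply_univ, Real.volume_Ioc]
    exact ENNReal.ofReal_le_one.2 (by linarith)
  have hfin : ∫⁻ p, ‖A p.1 p.2‖ₑ ^ 2 ∂(μ.prod τ) ≠ ⊤ := by
    refine ((lintegral_mono' hτP le_rfl).trans_lt ?_).ne
    rw [lintegral_enorm_sq_eq (f := fun p : Sp d × ℝ => A p.1 p.2)]
    exact ENNReal.pow_lt_top hA.memLp.2
  have hN : ∀ {f : Sp d → Sp d}, (∫⁻ x, ‖f x‖ₑ ^ 2 ∂μ) ^ (1 / 2 : ℝ) = eLpNorm f 2 μ := by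
    intro f
    rw [lintegral_enorm_sq_eq]
    exact sq_rpow_half _
  have h1 := lintegral_sq_lintegral_le (f := fun x r => ‖A x r‖ₑ) hτ1 hf hfin
  simp only [hN] at h1
  refine le_trans ?_ h1
  rw [← hN]
  refine ENNReal.rpow_le_rpow (lintegral_mono fun x => ?_) (by norm_num)
  gcongr
  rw [intervalIntegral.integral_of_le hst]
  exact enorm_integral_le_lintegral_enorm _

lemma measurable_eLpNorm_at (hA : IsVelocity μ X A) :
    Measurable fun r => eLpNorm (fun x => A x r) 2 μ := by
  have h1 : Measurable fun r => ∫⁻ x, ‖A x r‖ₑ ^ 2 ∂μ :=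
    (hA.meas.enorm.pow_const 2).lintegral_prod_left'
  convert! h1.pow_const (1 / 2 : ℝ) using 2 with r
  rw [lintegral_enorm_sq_eq, ← ENNReal.rpow_natCast, ← ENNReal.rpow_mul]
  norm_num

lemma lintegral_eLpNorm_sq_lt_top (hA : IsVelocity μ X A) :
    ∫⁻ r, eLpNorm (fun x => A x r) 2 μ ^ 2 ∂time < ⊤ := by
  simp only [← lintegral_enorm_sq_eq]
  rw [← lintegral_prod_symm (fun p : Sp d × ℝ => ‖A p.1 p.2‖ₑ ^ 2)
    (hA.meas.enorm.pow_const 2).aemeasurable,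
    lintegral_enorm_sq_eq (f := fun p : Sp d × ℝ => A p.1 p.2)]
  exact ENNReal.pow_lt_top hA.memLp.2

lemma memLp_eLpNorm_at (hA : IsVelocity μ X A) :
    MemLp (fun r => (eLpNorm (fun x => A x r) 2 μ).toReal) 2 time := by
  refine ⟨hA.measurable_eLpNorm_at.ennreal_toReal.aestronglyMeasurable, ?_⟩
  refine lt_top_of_sq_lt_top ?_
  rw [← lintegral_enorm_sq_eq]
  refine lt_of_le_of_lt (lintegral_mono fun r => ?_) hA.lintegral_eLpNorm_sq_lt_top
  gcongr
  rw [Real.enorm_of_nonneg ENNReal.toReal_nonneg]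
  exact ENNReal.ofReal_toReal_le

lemma eLpNorm_integral_le_ofReal (hA : IsVelocity μ X A) {s t : ℝ} (hs : 0 ≤ s) (hst : s ≤ t)
    (ht : t ≤ 1) : eLpNorm (fun x => ∫ r in s..t, A x r) 2 μ ≤
      ENNReal.ofReal (∫ r in s..t, (eLpNorm (fun x => A x r) 2 μ).toReal) := by
  refine (hA.eLpNorm_integral_le hs hst ht).trans (le_of_eq ?_)
  have hi := intervalIntegrable_of_time (hA.memLp_eLpNorm_at.integrable (by norm_num)) hs hst ht
  rw [intervalIntegral.integral_of_le hst,
    ofReal_integral_eq_lintegral_ofReal hi.1 (ae_of_all _ fun _ => ENNReal.toReal_nonneg)]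
  have h1 : ∀ᵐ r ∂time, eLpNorm (fun x => A x r) 2 μ ^ 2 < ⊤ :=
    ae_lt_top (hA.measurable_eLpNorm_at.pow_const 2) hA.lintegral_eLpNorm_sq_lt_top.ne
  have h2 := ae_restrict_of_ae (s := Ioc s t) h1
  rw [time_restrict_Ioc hs ht] at h2
  refine lintegral_congr_ae ?_
  filter_upwards [h2] with r hr
  rw [ENNReal.ofReal_toReal]
  intro h
  simp [h] at hr

lemma memLp_primitive (hA : IsVelocity μ X A) (hμ : MemP2 μ) {t : ℝ} (ht : t ∈ Icc (0 : ℝ) 1) :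
    MemLp (fun x => primitive A x t) 2 μ := by
  have h1 : MemLp (fun x : Sp d => x) 2 μ := by
    refine ⟨measurable_id.aestronglyMeasurable, ?_⟩
    refine lt_top_of_sq_lt_top ?_
    rw [← lintegral_enorm_sq_eq]
    exact hμ.2
  have h2 : MemLp (fun x => ∫ r in (0 : ℝ)..t, A x r) 2 μ := by
    refine ⟨?_, (hA.eLpNorm_integral_le_ofReal le_rfl ht.1 ht.2).trans_lt ENNReal.ofReal_lt_top⟩
    have h3 := (hA.measurable_at t).sub measurable_id
    have h4 : (fun x => primitive A x t) - id = fun x => ∫ r in (0 : ℝ)..t, A x r := by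
      ext1 x
      simp [primitive_eq A x ht.1]
    rw [h4] at h3
    exact h3.aestronglyMeasurable
  exact (h1.add h2).ae_eq (ae_of_all _ fun x => (primitive_eq A x ht.1).symm)

lemma memCrho (hA : IsVelocity μ X A) (hμ : MemP2 μ) :
    MemCrho (fun t => μ.map (fun x => X x t)) := by
  have hae : ∀ t ∈ Icc (0 : ℝ) 1, μ.map (fun x => X x t) = μ.map (fun x => primitive A x t) :=
    fun t ht => Measure.map_congr (hA.ae_eq_at ht)
  have hm := hA.measurable_at
  refine ⟨fun t ht => ?_, _, hA.memLp_eLpNorm_at, fun s t hs hst ht => ?_⟩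
  · beta_reduce
    rw [hae t ht]
    refine ⟨Measure.isProbabilityMeasure_map (hm t).aemeasurable, ?_⟩
    rw [lintegral_map (f := fun y : Sp d => ‖y‖ₑ ^ 2) (measurable_id.enorm.pow_const 2) (hm t)]
    rw [lintegral_enorm_sq_eq]
    exact ENNReal.pow_lt_top (hA.memLp_primitive hμ ht).2
  · beta_reduce
    have hsI : s ∈ Icc (0 : ℝ) 1 := ⟨hs, hst.trans ht⟩
    have htI : t ∈ Icc (0 : ℝ) 1 := ⟨hs.trans hst, ht⟩
    rw [hae s hsI, hae t htI]
    refine le_trans ?_ (hA.eLpNorm_integral_le_ofReal hs hst ht)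
    -- the coupling given by the trajectories
    let π : Measure (Sp d × Sp d) := μ.map fun x => (primitive A x s, primitive A x t)
    have hπm : Measurable fun x => (primitive A x s, primitive A x t) := (hm s).prodMk (hm t)
    have hπ : IsCoupling (μ.map fun x => primitive A x s) (μ.map fun x => primitive A x t) π :=
      ⟨by rw [Measure.map_map measurable_fst hπm]; rfl,
        by rw [Measure.map_map measurable_snd hπm]; rfl⟩
    have h1 : ∫⁻ p, edist p.1 p.2 ^ 2 ∂π = eLpNorm (fun x => ∫ r in s..t, A x r) 2 μ ^ 2 := by
      rw [lintegral_map (measurable_edist.pow_const 2) hπm, ← lintegral_enorm_sq_eq]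
      refine lintegral_congr_ae ?_
      filter_upwards [hA.memLp.integrable (by norm_num) |>.prod_right_ae] with x hx
      have e : primitive A x t = primitive A x s + ∫ r in s..t, A x r := by
        rw [primitive_eq A x hs, primitive_eq A x (hs.trans hst), add_assoc,
          intervalIntegral.integral_add_adjacent_intervals
            (intervalIntegrable_of_time hx le_rfl hs (hst.trans ht))
            (intervalIntegrable_of_time hx hs hst ht)]
      rw [edist_comm, edist_eq_enorm_sub, e, add_sub_cancel_left]
    refine (ENNReal.rpow_le_rpow (iInf₂_le π hπ) (by norm_num)).trans (le_of_eq ?_)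
    rw [h1, ← ENNReal.rpow_natCast, ← ENNReal.rpow_mul]
    norm_num

end IsVelocity

lemma MemCX.exists_isVelocity (hX : MemCX μ X) : ∃ A, IsVelocity μ X A := by
  obtain ⟨A, h1, h2, h3, h4⟩ := hX.exists_primitive
  exact ⟨A, h1, h2, h3, h4⟩

variable {Y A v : Sp d → ℝ → Sp d}

/-! ### Characteristics of the flow-matching velocity -/

lemma MemCv.isLocLipField (hv : MemCv v) : IsLocLipField v := fun R => by
  obtain ⟨C, L, h⟩ := hv _ (isCompact_closedBall 0 R)
  simp only [mem_closedBall_zero_iff] at h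
  exact ⟨C, L, fun t ht => ⟨(h t ht).1, fun x y hx hy => (h t ht).2 x hx y hy⟩⟩

/-- The trajectories `Y` are the characteristics of `v`: almost every one of them is the limit, in
fact the eventual value, of the truncated flows. -/
def IsCharacteristic (μ : Measure (Sp d)) (v Y : Sp d → ℝ → Sp d) : Prop :=
  ∀ᵐ x ∂μ, ∀ᶠ n in atTop, ∀ t ∈ Icc (0 : ℝ) 1, flow (cutoffField v n) 0 x t = Y x t

/-- Every pair in `C_{(X,v)}` consists of characteristics: a trajectory in `AC²(0,1)` is bounded,
and solutions of the equation truncated outside a large ball are unique. -/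
lemma MemCXv.isCharacteristic (hY : MemCXv μ Y v) (hm : Measurable (Function.uncurry v))
    (hv : IsLocLipField v) : IsCharacteristic μ v Y := by
  filter_upwards [hY.1.ac, hY.1.start, hY.2] with x hac h0 hdt
  obtain ⟨hi, he⟩ := hac.integral_deriv
  have hc : ContinuousOn (Y x) (Icc 0 1) := by
    have := intervalIntegral.continuousOn_primitive_interval' hi left_mem_uIcc
    rw [uIcc_of_le zero_le_one] at this
    exact (continuousOn_const.add this).congr he
  let γ : ℝ → Sp d := IccExtend zero_le_one (domRestrict (Icc (0 : ℝ) 1) (Y x))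
  have hγc : Continuous γ := (continuousOn_iff_continuous_domRestrict.1 hc).Icc_extend'
  have hγ : ∀ t ∈ Icc (0 : ℝ) 1, γ t = Y x t := fun t ht => IccExtend_of_mem _ _ ht
  obtain ⟨B, hB⟩ := isCompact_Icc.exists_bound_of_continuousOn hc
  have hb : ∀ t ∈ Icc (0 : ℝ) 1, ‖γ t‖ ≤ 2 * (⌈B⌉₊ : ℕ) := fun t ht => by
    rw [hγ t ht]
    have := (hB t ht).trans (Nat.le_ceil B)
    have h2 : (0 : ℝ) ≤ ⌈B⌉₊ := Nat.cast_nonneg _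
    linarith
  have heq : ∀ t ∈ Icc (0 : ℝ) 1, γ t = x + ∫ r in (0 : ℝ)..t, v (γ r) r := fun t ht => by
    rw [hγ t ht, he t ht, h0]
    congr 1
    refine intervalIntegral.integral_congr_ae ?_
    rw [ae_restrict_iff' measurableSet_Icc] at hdt
    filter_upwards [hdt] with r hr hrI
    rw [uIoc_of_le ht.1] at hrI
    have hr1 : r ∈ Icc (0 : ℝ) 1 := ⟨hrI.1.le, hrI.2.trans ht.2⟩
    rw [hγ r hr1]
    exact hr hr1
  filter_upwards [eventually_ge_atTop ⌈B⌉₊] with n hn t ht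
  rw [flow_cutoffField_eq hm hv hγc hn hb heq t ht, hγ t ht]

namespace IsCharacteristic

lemma aemeasurable_prod (hY : IsCharacteristic μ v Y) (hm : Measurable (Function.uncurry v))
    (hv : IsLocLipField v) : AEMeasurable (fun p : Sp d × ℝ => Y p.1 p.2) (μ.prod time) := by
  refine aemeasurable_of_tendsto_metrizable_ae atTop
    (f := fun n p => flow (cutoffField v n) 0 p.1 p.2) (fun n => ?_) ?_
  · obtain ⟨M, L, hw⟩ := exists_isLipField_cutoffField hm hv n
    exact (continuous_uncurry_flow hw 0).measurable.aemeasurable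
  · refine ae_prod_time_of_forall
      (p := fun x t => Tendsto (fun n => flow (cutoffField v n) 0 x t) atTop (𝓝 (Y x t))) ?_
    filter_upwards [hY] with x hx t ht
    exact tendsto_const_nhds.congr' (hx.mono fun n hn => (hn t ht).symm)

lemma aemeasurable_at (hY : IsCharacteristic μ v Y) (hm : Measurable (Function.uncurry v))
    (hv : IsLocLipField v) {t : ℝ} (ht : t ∈ Icc (0 : ℝ) 1) : AEMeasurable (fun x => Y x t) μ := by
  refine aemeasurable_of_tendsto_metrizable_ae atTop
    (f := fun n x => flow (cutoffField v n) 0 x t) (fun n => ?_) ?_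
  · obtain ⟨M, L, hw⟩ := exists_isLipField_cutoffField hm hv n
    exact ((continuous_uncurry_flow hw 0).measurable.comp
      (measurable_id.prodMk measurable_const)).aemeasurable
  · filter_upwards [hY] with x hx
    exact tendsto_const_nhds.congr' (hx.mono fun n hn => (hn t ht).symm)

/-- The characteristics of the flow-matching velocity have the same laws as the trajectories it was
fitted to. -/
lemma map_eq (hY : IsCharacteristic μ v Y) (hA : IsVelocity μ X A) (hv : IsFlowMatching μ X v)
    (hl : IsLocLipField v) {t : ℝ} (ht : t ∈ Icc (0 : ℝ) 1) :
    μ.map (fun x => Y x t) = μ.map (fun x => primitive A x t) := by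
  refine (hA.hasMeanVelocity hv).map_eq_of_eventually_flow_eq hl ht
    (hY.aemeasurable_at hv.1 hl ht) ?_
  filter_upwards [hY] with x hx
  filter_upwards [hx] with n hn
  rw [primitive_zero]
  exact hn t ht

lemma lintegral_eq (hY : IsCharacteristic μ v Y) (hA : IsVelocity μ X A)
    (hv : IsFlowMatching μ X v) (hl : IsLocLipField v) {f : Sp d × ℝ → ℝ≥0∞} (hf : Measurable f) :
    ∫⁻ p, f (Y p.1 p.2, p.2) ∂(μ.prod time) =
      ∫⁻ p, f (primitive A p.1 p.2, p.2) ∂(μ.prod time) := by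
  have h1 : AEMeasurable (fun p : Sp d × ℝ => f (Y p.1 p.2, p.2)) (μ.prod time) :=
    hf.comp_aemeasurable ((hY.aemeasurable_prod hv.1 hl).prodMk measurable_snd.aemeasurable)
  have h2 : Measurable fun p : Sp d × ℝ => f (primitive A p.1 p.2, p.2) :=
    hf.comp (hA.meas_primitive.prodMk measurable_snd)
  rw [lintegral_prod_symm _ h1, lintegral_prod_symm _ h2.aemeasurable]
  refine lintegral_congr_ae ?_
  filter_upwards [ae_restrict_mem measurableSet_Icc] with t ht
  have hft : Measurable fun y => f (y, t) := hf.comp (measurable_id.prodMk measurable_const)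
  rw [← lintegral_map' hft.aemeasurable (hY.aemeasurable_at hv.1 hl ht), hY.map_eq hA hv hl ht,
    lintegral_map hft (hA.measurable_at t)]

end IsCharacteristic

open Classical in
/-- The solution of `γ' = v(γ, ·)` started at `x`, where it exists up to time `1`, and the constant `x`
elsewhere. -/
def characteristic (v : Sp d → ℝ → Sp d) (x : Sp d) : ℝ → Sp d :=
  if h : ∃ n, Confined v n x then flow (cutoffField v (Nat.find h)) 0 x else fun _ => x

lemma exists_characteristic_eq {x : Sp d} (h : ∃ n, Confined v n x) :
    ∃ n, Confined v n x ∧ characteristic v x = flow (cutoffField v n) 0 x := by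
  classical
  refine ⟨Nat.find h, Nat.find_spec h, ?_⟩
  rw [characteristic, dif_pos h]

/-- Almost every characteristic of a flow-matching velocity in `C_v` exists up to time `1`, and
together they form a pair in `C_{(X,v)}`. -/
lemma memCXv_characteristic (hX : MemCX μ X) (hA : IsVelocity μ X A) (hv : IsFlowMatching μ X v)
    (hl : IsLocLipField v) : MemCXv μ (characteristic v) v := by
  have hconf : ∀ᵐ x ∂μ, ∃ n, Confined v n x := by
    simpa [primitive_zero] using (hA.hasMeanVelocity hv).ae_exists_confined hl
  have hch : IsCharacteristic μ v (characteristic v) := by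
    filter_upwards [hconf] with x hx
    obtain ⟨n, hn, hx⟩ := exists_characteristic_eq hx
    filter_upwards [eventually_ge_atTop n] with m hm t ht
    rw [hx, hn.flow_eq hv.1 hl hm ht]
  -- every truncated flow solves its equation almost everywhere in space and time
  have hode : ∀ᵐ p ∂(μ.prod time), ∀ n, deriv (flow (cutoffField v n) 0 p.1) p.2 =
      cutoffField v n (flow (cutoffField v n) 0 p.1 p.2) p.2 := by
    refine ae_all_iff.2 fun n => ?_
    obtain ⟨M, L, hw⟩ := exists_isLipField_cutoffField hv.1 hl n
    have hfc := continuous_uncurry_flow hw 0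
    have hms : MeasurableSet {p : Sp d × ℝ | deriv (flow (cutoffField v n) 0 p.1) p.2 =
        cutoffField v n (flow (cutoffField v n) 0 p.1 p.2) p.2} := measurableSet_eq_fun
      (measurable_deriv_with_param (f := fun x t => flow (cutoffField v n) 0 x t) hfc)
      (hw.meas.comp (hfc.measurable.prodMk measurable_snd))
    refine (Measure.ae_prod_iff_ae_ae hms).2 (ae_of_all _ fun x => ?_)
    filter_upwards [ae_hasDerivAt_flow hw 0 1 x] with t ht using ht.deriv
  have hdt : ∀ᵐ p ∂(μ.prod time), dt (characteristic v) p.1 p.2 =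
      v (characteristic v p.1 p.2) p.2 := by
    have h1 := Measure.quasiMeasurePreserving_fst (μ := μ) (ν := time).ae hconf
    have h2 := Measure.quasiMeasurePreserving_snd (μ := μ) (ν := time).ae
      (ae_restrict_mem measurableSet_Icc)
    filter_upwards [hode, h1, h2] with p hp hp1 hp2
    obtain ⟨n, hn, hx⟩ := exists_characteristic_eq hp1
    rw [dt, hx, hp n, cutoffField_eq (hn _ hp2) hp2]
  have hYm := hch.aemeasurable_prod hv.1 hl
  have hvYm : AEMeasurable (fun p : Sp d × ℝ => v (characteristic v p.1 p.2) p.2) (μ.prod time) :=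
    hv.1.comp_aemeasurable (hYm.prodMk measurable_snd.aemeasurable)
  refine ⟨⟨⟨hYm.aestronglyMeasurable, ?_⟩, ?_, ?_, ?_⟩, Measure.ae_ae_of_ae_prod hdt⟩
  · refine lt_top_of_sq_lt_top ?_
    rw [← lintegral_enorm_sq_eq, hch.lintegral_eq hA hv hl (f := fun p => ‖p.1‖ₑ ^ 2)
      (measurable_fst.enorm.pow_const 2),
      lintegral_enorm_sq_eq (f := fun p : Sp d × ℝ => primitive A p.1 p.2)]
    exact ENNReal.pow_lt_top ((memLp_congr_ae hA.ae_eq_prod).1 hX.memLp).2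
  · filter_upwards [hconf] with x hx
    obtain ⟨n, -, hx⟩ := exists_characteristic_eq hx
    obtain ⟨M, L, hw⟩ := exists_isLipField_cutoffField hv.1 hl n
    refine ⟨fun _ => M, memLp_const M, fun s t hs hst ht => ?_⟩
    rw [hx, edist_dist, dist_eq_norm, norm_sub_rev]
    refine ENNReal.ofReal_le_ofReal ((norm_flow_sub_le hw x hs (hs.trans hst)).trans (le_of_eq ?_))
    rw [abs_of_nonneg (sub_nonneg.2 hst), intervalIntegral.integral_const, smul_eq_mul, mul_comm]
  · refine MemLp.ae_eq (f := fun p : Sp d × ℝ => v (characteristic v p.1 p.2) p.2)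
      (hdt.mono fun p hp => hp.symm) ⟨hvYm.aestronglyMeasurable, lt_top_of_sq_lt_top ?_⟩
    rw [← lintegral_enorm_sq_eq, hch.lintegral_eq hA hv hl (f := fun p => ‖v p.1 p.2‖ₑ ^ 2)
      (hv.1.enorm.pow_const 2),
      lintegral_enorm_sq_eq (f := fun p : Sp d × ℝ => v (primitive A p.1 p.2) p.2)]
    exact ENNReal.pow_lt_top (hA.memLp_isFlowMatching hv).2
  · filter_upwards [hconf] with x hx
    obtain ⟨n, -, hx⟩ := exists_characteristic_eq hx
    obtain ⟨M, L, hw⟩ := exists_isLipField_cutoffField hv.1 hl n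
    rw [hx, flow_of_le hw x le_rfl]

/-! ### Comparison of costs -/

lemma extIntegral_congr {α : Type*} [MeasurableSpace α] {m : Measure α} {f g : α → ℝ}
    (h : f =ᵐ[m] g) : extIntegral m f = extIntegral m g := by
  rw [extIntegral, extIntegral, lintegral_congr_ae (h.mono fun a ha => by rw [ha]),
    lintegral_congr_ae (h.mono fun a (ha : f a = g a) => by simp only [ha] :
      (fun a => ENNReal.ofReal (-f a)) =ᵐ[m] fun a => ENNReal.ofReal (-g a))]

/-- Adding integrable nonnegative functions to `f₁` and `f₂`, whose positive and negative parts have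
the same integrals. Infinite values are allowed for these. -/
lemma extIntegral_add_le {α : Type*} [MeasurableSpace α] {m : Measure α} {k₁ k₂ f₁ f₂ : α → ℝ}
    (hk₁m : AEMeasurable k₁ m) (hk₂m : AEMeasurable k₂ m) (hf₁m : AEMeasurable f₁ m)
    (hf₂m : AEMeasurable f₂ m) (hk₁ : ∀ a, 0 ≤ k₁ a) (hk₂ : ∀ a, 0 ≤ k₂ a)
    (hk : ∫⁻ a, ENNReal.ofReal (k₁ a) ∂m ≤ ∫⁻ a, ENNReal.ofReal (k₂ a) ∂m)
    (hfin : ∫⁻ a, ENNReal.ofReal (k₂ a) ∂m ≠ ⊤)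
    (hp : ∫⁻ a, ENNReal.ofReal (f₁ a) ∂m = ∫⁻ a, ENNReal.ofReal (f₂ a) ∂m)
    (hn : ∫⁻ a, ENNReal.ofReal (-f₁ a) ∂m = ∫⁻ a, ENNReal.ofReal (-f₂ a) ∂m) :
    extIntegral m (fun a => k₁ a + f₁ a) ≤ extIntegral m (fun a => k₂ a + f₂ a) := by
  -- `(k + f)⁺ + f⁻ = (k + f)⁻ + k + f⁺`, integrated
  have key : ∀ {k f : α → ℝ}, AEMeasurable k m → AEMeasurable f m → (∀ a, 0 ≤ k a) →
      (∫⁻ a, ENNReal.ofReal (k a + f a) ∂m) + ∫⁻ a, ENNReal.ofReal (-f a) ∂m =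
        (∫⁻ a, ENNReal.ofReal (-(k a + f a)) ∂m) + ((∫⁻ a, ENNReal.ofReal (k a) ∂m) +
          ∫⁻ a, ENNReal.ofReal (f a) ∂m) ∧
      (∫⁻ a, ENNReal.ofReal (-(k a + f a)) ∂m) ≤ ∫⁻ a, ENNReal.ofReal (-f a) ∂m ∧
      (∫⁻ a, ENNReal.ofReal (-f a) ∂m) ≤ (∫⁻ a, ENNReal.ofReal (-(k a + f a)) ∂m) +
        ∫⁻ a, ENNReal.ofReal (k a) ∂m ∧
      (∫⁻ a, ENNReal.ofReal (f a) ∂m) ≤ ∫⁻ a, ENNReal.ofReal (k a + f a) ∂m := by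
    intro k f hkm hfm hk0
    refine ⟨?_, ?_, ?_, ?_⟩
    · have h1 : AEMeasurable (fun a => ENNReal.ofReal (k a + f a)) m :=
        (hkm.add hfm).ennreal_ofReal
      have h2 : AEMeasurable (fun a => ENNReal.ofReal (-(k a + f a))) m :=
        (hkm.add hfm).neg.ennreal_ofReal
      rw [← lintegral_add_left' h1, ← lintegral_add_left' hkm.ennreal_ofReal,
        ← lintegral_add_left' h2]
      refine lintegral_congr fun a => ?_
      have h0 := hk0 a
      rcases le_total 0 (f a) with hf | hf
      · rw [ENNReal.ofReal_of_nonpos (by linarith : -f a ≤ 0),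
          ENNReal.ofReal_of_nonpos (by linarith : -(k a + f a) ≤ 0), ENNReal.ofReal_add h0 hf,
          add_zero, zero_add]
      · rw [ENNReal.ofReal_of_nonpos hf, add_zero]
        rcases le_total 0 (k a + f a) with h | h
        · rw [ENNReal.ofReal_of_nonpos (by linarith : -(k a + f a) ≤ 0), zero_add,
            ← ENNReal.ofReal_add h (by linarith)]
          congr 1
          ring
        · rw [ENNReal.ofReal_of_nonpos h, zero_add, ← ENNReal.ofReal_add (by linarith) h0]
          congr 1
          ring
    · exact lintegral_mono fun a => ENNReal.ofReal_le_ofReal (by linarith [hk0 a])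
    · rw [← lintegral_add_right' _ hkm.ennreal_ofReal]
      refine lintegral_mono fun a => ?_
      rw [← ENNReal.ofReal_toReal
        (ENNReal.add_ne_top.2 ⟨ENNReal.ofReal_ne_top, ENNReal.ofReal_ne_top⟩)]
      refine ENNReal.ofReal_le_ofReal ?_
      rw [ENNReal.toReal_add ENNReal.ofReal_ne_top ENNReal.ofReal_ne_top,
        ENNReal.toReal_ofReal (hk0 a), ENNReal.toReal_ofReal']
      linarith [le_max_left (-(k a + f a)) 0]
    · exact lintegral_mono fun a => ENNReal.ofReal_le_ofReal (by linarith [hk0 a])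
  obtain ⟨e₁, b₁, c₁, d₁⟩ := key hk₁m hf₁m hk₁
  obtain ⟨e₂, b₂, c₂, d₂⟩ := key hk₂m hf₂m hk₂
  rw [hp, hn] at e₁
  rw [hn] at b₁ c₁
  rw [hp] at d₁
  simp only [extIntegral]
  generalize (∫⁻ a, ENNReal.ofReal (k₁ a + f₁ a) ∂m) = P₁ at *
  generalize (∫⁻ a, ENNReal.ofReal (k₂ a + f₂ a) ∂m) = P₂ at *
  generalize (∫⁻ a, ENNReal.ofReal (-(k₁ a + f₁ a)) ∂m) = N₁ at *
  generalize (∫⁻ a, ENNReal.ofReal (-(k₂ a + f₂ a)) ∂m) = N₂ at *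
  generalize (∫⁻ a, ENNReal.ofReal (k₁ a) ∂m) = κ₁ at *
  generalize (∫⁻ a, ENNReal.ofReal (k₂ a) ∂m) = κ₂ at *
  generalize (∫⁻ a, ENNReal.ofReal (f₂ a) ∂m) = p at *
  generalize (∫⁻ a, ENNReal.ofReal (-f₂ a) ∂m) = n at *
  have hκ₁ : κ₁ ≠ ⊤ := (hk.trans_lt (lt_top_iff_ne_top.2 hfin)).ne
  -- if the common negative part is infinite, the left side is `-∞`
  by_cases hnt : n = ⊤
  · rw [hnt, top_le_iff, ENNReal.add_eq_top] at c₁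
    rw [c₁.resolve_right hκ₁]
    simp
  have hN₁ : N₁ ≠ ⊤ := (b₁.trans_lt (lt_top_iff_ne_top.2 hnt)).ne
  have hN₂ : N₂ ≠ ⊤ := (b₂.trans_lt (lt_top_iff_ne_top.2 hnt)).ne
  -- if only the common positive part is infinite, the right side is `∞`
  by_cases hpt : p = ⊤
  · rw [hpt, top_le_iff] at d₂
    rw [d₂]
    lift N₂ to NNReal using hN₂
    simp
  have hP : ∀ {P N κ : ℝ≥0∞}, P + n = N + (κ + p) → N ≠ ⊤ → κ ≠ ⊤ → P ≠ ⊤ := by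
    rintro P N κ h h1 h2 rfl
    rw [top_add, eq_comm, ENNReal.add_eq_top, ENNReal.add_eq_top] at h
    tauto
  have hP₁ := hP e₁ hN₁ hκ₁
  have hP₂ := hP e₂ hN₂ hfin
  lift N₁ to NNReal using hN₁
  lift N₂ to NNReal using hN₂
  lift P₁ to NNReal using hP₁
  lift P₂ to NNReal using hP₂
  lift κ₁ to NNReal using hκ₁
  lift κ₂ to NNReal using hfin
  lift p to NNReal using hpt
  lift n to NNReal using hnt
  norm_cast at e₁ e₂ hk
  have e₁' : (P₁ : ℝ) + n = N₁ + (κ₁ + p) := by exact_mod_cast e₁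
  have e₂' : (P₂ : ℝ) + n = N₂ + (κ₂ + p) := by exact_mod_cast e₂
  have hk' : (κ₁ : ℝ) ≤ κ₂ := by exact_mod_cast hk
  have hfinal : (P₁ : ℝ) - N₁ ≤ P₂ - N₂ := by linarith
  change ((P₁ : ℝ) : EReal) - ((N₁ : ℝ) : EReal) ≤ ((P₂ : ℝ) : EReal) - ((N₂ : ℝ) : EReal)
  exact_mod_cast hfinal

/-- Two functions on a product that agree almost everywhere in the second variable, for almost every
value of the first, agree almost everywhere. -/
lemma ae_eq_prod_of_ae_ae {f g : Sp d × ℝ → Sp d} (hf : AEMeasurable f (μ.prod time))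
    (hg : AEMeasurable g (μ.prod time)) (h : ∀ᵐ x ∂μ, ∀ᵐ t ∂time, f (x, t) = g (x, t)) :
    f =ᵐ[μ.prod time] g := by
  refine hf.ae_eq_mk.trans (EventuallyEq.trans ?_ hg.ae_eq_mk.symm)
  refine (Measure.ae_prod_iff_ae_ae (measurableSet_eq_fun hf.measurable_mk hg.measurable_mk)).2 ?_
  filter_upwards [h, Measure.ae_ae_of_ae_prod hf.ae_eq_mk, Measure.ae_ae_of_ae_prod hg.ae_eq_mk]
    with x h1 h2 h3
  filter_upwards [h1, h2, h3] with t k1 k2 k3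
  rw [← k2, ← k3, k1]

/-- Replacing the trajectories by the characteristics of their mean velocity does not change the
laws, hence not the coupling terms, and lowers the kinetic energy. -/
lemma cost_le (hA : IsVelocity μ X A) (hv : IsFlowMatching μ X v) (hl : IsLocLipField v)
    (hY : MemCXv μ Y v) {F G : Measure (Sp d) → Sp d → ℝ} {ρ : ℝ → Measure (Sp d)}
    (hF : Measurable fun p : Sp d × Icc (0 : ℝ) 1 => F (ρ p.2) p.1) (hG : Measurable (G (ρ 1))) :
    cost μ F G Y ρ ≤ cost μ F G X ρ := by
  have hch := hY.isCharacteristic hv.1 hl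
  have hYm := hch.aemeasurable_prod hv.1 hl
  have hXm := hA.meas_primitive
  have hYp : AEMeasurable (fun p : Sp d × ℝ => (Y p.1 p.2, p.2)) (μ.prod time) :=
    hYm.prodMk measurable_snd.aemeasurable
  have hXp : Measurable fun p : Sp d × ℝ => (primitive A p.1 p.2, p.2) :=
    hXm.prodMk measurable_snd
  have hdtY : ∀ᵐ p ∂(μ.prod time), dt Y p.1 p.2 = v (Y p.1 p.2) p.2 :=
    ae_eq_prod_of_ae_ae (f := fun p => dt Y p.1 p.2) (g := fun p => v (Y p.1 p.2) p.2)
      hY.1.memLp_dt.1.aemeasurable (hv.1.comp_aemeasurable hYp) hY.2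
  refine add_le_add ?_ (le_of_eq ?_)
  · -- the coupling term is Borel for times in `[0,1]`; it is extended to all times
    let f : Sp d × ℝ → ℝ := fun q => F (ρ (projIcc (0 : ℝ) 1 zero_le_one q.2)) q.1
    have hf : Measurable f := hF.comp
      (measurable_fst.prodMk ((continuous_projIcc (h := zero_le_one)).measurable.comp
        measurable_snd))
    have hfF : ∀ (y : Sp d) (t : ℝ), t ∈ Icc (0 : ℝ) 1 → F (ρ t) y = f (y, t) := fun y t ht => by
      simp only [f, projIcc_of_mem zero_le_one ht]
    have htime := Measure.quasiMeasurePreserving_snd (μ := μ) (ν := time).ae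
      (ae_restrict_mem measurableSet_Icc)
    rw [extIntegral_congr (g := fun p : Sp d × ℝ => 1 / 2 * ‖v (Y p.1 p.2) p.2‖ ^ 2 +
        f (Y p.1 p.2, p.2)) (by
          filter_upwards [hdtY, htime] with p h1 h2
          rw [h1, hfF _ _ h2]),
      extIntegral_congr (f := fun p : Sp d × ℝ => 1 / 2 * ‖dt X p.1 p.2‖ ^ 2 +
        F (ρ p.2) (X p.1 p.2)) (g := fun p : Sp d × ℝ => 1 / 2 * ‖A p.1 p.2‖ ^ 2 +
        f (primitive A p.1 p.2, p.2)) (by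
          filter_upwards [hA.dt_eq, hA.ae_eq_prod, htime] with p h1 h2 h3
          rw [h1, h2, hfF _ _ h3])]
    have hsq : ∀ {g : Sp d × ℝ → Sp d}, MemLp g 2 (μ.prod time) →
        ∫⁻ p, ENNReal.ofReal (1 / 2 * ‖g p‖ ^ 2) ∂(μ.prod time) =
          ENNReal.ofReal (1 / 2 * ∫ p, ‖g p‖ ^ 2 ∂(μ.prod time)) := fun hg => by
      rw [← integral_const_mul, ofReal_integral_eq_lintegral_ofReal
        ((hg.integrable_norm_pow (p := 2) (by norm_num)).const_mul _)
        (ae_of_all _ fun p => by positivity)]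
    have hkY : ∫⁻ p, ENNReal.ofReal (1 / 2 * ‖v (Y p.1 p.2) p.2‖ ^ 2) ∂(μ.prod time) =
        ∫⁻ p, ENNReal.ofReal (1 / 2 * ‖v (primitive A p.1 p.2) p.2‖ ^ 2) ∂(μ.prod time) :=
      hch.lintegral_eq hA hv hl (f := fun q => ENNReal.ofReal (1 / 2 * ‖v q.1 q.2‖ ^ 2))
        ((hv.1.norm.pow_const 2).const_mul _).ennreal_ofReal
    refine extIntegral_add_le (((hv.1.comp_aemeasurable hYp).norm.pow_const 2).const_mul _)
      ((hA.meas.norm.pow_const 2).const_mul _).aemeasurable (hf.comp_aemeasurable hYp)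
      (hf.comp hXp).aemeasurable (fun p => by positivity) (fun p => by positivity) ?_ ?_
      (hch.lintegral_eq hA hv hl hf.ennreal_ofReal)
      (hch.lintegral_eq hA hv hl hf.neg.ennreal_ofReal)
    · rw [hkY, hsq hA.memLp, hsq (hA.memLp_isFlowMatching hv)]
      exact ENNReal.ofReal_le_ofReal (mul_le_mul_of_nonneg_left
        (hA.integral_norm_sq_isFlowMatching hv) (by norm_num))
    · rw [hsq hA.memLp]
      exact ENNReal.ofReal_ne_top
  · have h1 : (1 : ℝ) ∈ Icc (0 : ℝ) 1 := ⟨zero_le_one, le_rfl⟩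
    have hlaw : ∀ {f : Sp d → ℝ≥0∞}, Measurable f →
        ∫⁻ x, f (Y x 1) ∂μ = ∫⁻ x, f (primitive A x 1) ∂μ := fun hf => by
      rw [← lintegral_map' hf.aemeasurable (hch.aemeasurable_at hv.1 hl h1),
        hch.map_eq hA hv hl h1, lintegral_map hf (hA.measurable_at 1)]
    rw [extIntegral_congr (f := fun x => G (ρ 1) (X x 1)) (g := fun x => G (ρ 1) (primitive A x 1))
      ((hA.ae_eq_at h1).mono fun x hx => by beta_reduce at hx ⊢; rw [hx])]
    rw [extIntegral, extIntegral, hlaw hG.ennreal_ofReal,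
      hlaw (f := fun y => ENNReal.ofReal (-G (ρ 1) y)) hG.neg.ennreal_ofReal]

end MFG

end

theorem mainTheorem5 {d : ℕ} (μ : Measure (MFG.Sp d)) (hμ : MFG.MemP2 μ) (hμr : μ ≪ volume)
    (F G : Measure (MFG.Sp d) → MFG.Sp d → ℝ)
    (X : MFG.Sp d → ℝ → MFG.Sp d) (hX : MFG.MemCX μ X) :
    MFG.MemCrho (fun t => μ.map (fun x => X x t)) ∧
    (∃ v : MFG.Sp d → ℝ → MFG.Sp d, MFG.IsFlowMatching μ X v) ∧
    (∀ v w : MFG.Sp d → ℝ → MFG.Sp d,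
      MFG.IsFlowMatching μ X v → MFG.IsFlowMatching μ X w →
      ∀ᵐ t ∂MFG.time, ∀ᵐ y ∂(μ.map (fun x => X x t)), v y t = w y t) ∧
    (∀ v : MFG.Sp d → ℝ → MFG.Sp d, MFG.IsFlowMatching μ X v → MFG.MemCv v →
      (∃ Y : MFG.Sp d → ℝ → MFG.Sp d, MFG.MemCXv μ Y v) ∧
      ∀ Y : MFG.Sp d → ℝ → MFG.Sp d, MFG.MemCXv μ Y v →
        ∀ ρ : ℝ → Measure (MFG.Sp d), MFG.MemCrho ρ →
          Measurable (fun p : MFG.Sp d × Icc (0 : ℝ) 1 => F (ρ p.2) p.1) →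
          Measurable (G (ρ 1)) →
          MFG.cost μ F G Y ρ ≤ MFG.cost μ F G X ρ) := by
  have := hμ.1
  obtain ⟨A, hA⟩ := hX.exists_isVelocity
  refine ⟨hA.memCrho hμ, hA.exists_isFlowMatching,
    fun v w hv hw => hA.ae_eq_of_isFlowMatching hv hw,
    fun v hv hC => ⟨⟨_, MFG.memCXv_characteristic hX hA hv hC.isLocLipField⟩,
      fun Y hY ρ _ hF hG => MFG.cost_le hA hv hC.isLocLipField hY hF hG⟩⟩
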